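/- Let $r,n\ge 1$ be integers, let $W=G(r,1,n)$ be the group of $n\times n$ monomial matrices whose non-zero entries are $r$-th roots of unity, put $\zeta=e^{2\pi i/r}$, let $\zeta_i\in W$ be the diagonal matrix with $\zeta$ in position $i$ and ones elsewhere on the diagonal, and let $s_{ij},s_i=s_{i,i+1}\in S_n\subset W$ be the transpositions. Let $F=\mathbb{C}(\kappa,c_0,d_1,\dots,d_{r-1})$ be the field of rational functions in the parameters; put $d_0=-(d_1+\cdots+d_{r-1})$ and read the indices of the $d_i$ modulo $r$. Let $\mathbb{H}$ be the rational Cherednik algebra of $W$: the $F$-algebra generated by commuting elements $x_1,\dots,x_n$ (the dual basis of $(\mathbb{C}^n)^*$), commuting elements $y_1,\dots,y_n$ (the standard basis of $\mathbb{C}^n$) and the group algebra $FW$ with basis $(t_w)_{w\in W}$, with relations $t_wx=(wx)t_w$, $t_wy=(wy)t_w$, $$y_ix_j=x_jy_i+c_0\sum_{l=0}^{r-1}\zeta^{-l}t_{\zeta_i^ls_{ij}\zeta_i^{-l}}\quad(i\ne j),$$ $$y_ix_i=x_iy_i+\kappa-\sum_{j=0}^{r-1}(d_j-d_{j-1})e_{ij}-c_0\sum_{j\neq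 i}\sum_{l=0}^{r-1}t_{\zeta_i^ls_{ij}\zeta_i^{-l}},\qquad e_{ij}=\frac1r\sum_{l=0}^{r-1}\zeta^{-lj}t_{\zeta_i^l}.$$ Let $\lambda=(\lambda^0,\dots,\lambda^{r-1})$ be an $r$-partition of $n$. For a box $b$ of $\lambda^i$ in row $p$ and column $q$ put $\beta(b)=i$ and $\mathrm{ct}(b)=q-p$. A standard tableau $T\in\mathrm{SYT}(\lambda)$ is viewed as a bijection from $\{1,\dots,n\}$ to the boxes of $\lambda$, and $s_i.T$ is obtained from $T$ by interchanging the entries $i$ and $i+1$. Let $S^\lambda$ be the irreducible $W$-module with basis $v_T$, $T\in\mathrm{SYT}(\lambda)$, in Young's orthonormal form: $t_{\zeta_i}v_T=\zeta^{\beta(T(i))}v_T$; if $\beta(T(i))\ne\beta(T(i+1))$ then $t_{s_i}v_T=v_{s_i.T}$; otherwise, with $m=\mathrm{ct}(T(i+1))-\mathrm{ct}(T(i))$, $t_{s_i}v_T=\frac1m v_T+\bigl(1-\frac1{m^2}\bigr)^{1/2}v_{s_i.T}$, where the last term is omitted if $s_i.T$ is not standard. Let $M(\lambda)=\mathrm{Ind}_{FW\otimes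 F[y_1,\dots,y_n]}^{\mathbb{H}}S^\lambda$ be the standard module, where the $y_i$ act on $S^\lambda$ by zero. For $\mu\in\mathbb{Z}_{\ge0}^n$ let $w_\mu\in S_n$ be the longest element for which $w_\mu.\mu=(\mu_{w_\mu^{-1}(1)},\dots,\mu_{w_\mu^{-1}(n)})$ is non-decreasing, and put $v_T^\mu=t_{w_\mu}^{-1}v_T$. Write $\mu<\nu$ if the non-increasing rearrangement $\mu^+$ is strictly below $\nu^+$ in dominance order, or $\mu^+=\nu^+$ and $w_\mu<w_\nu$ in Bruhat order. Let $\mathfrak{t}\subset\mathbb{H}$ be the subalgebra generated by the $t_{\zeta_i}$ and by $z_i=y_ix_i+c_0\sum_{j<i}\sum_{l=0}^{r-1}t_{\zeta_i^ls_{ij}\zeta_i^{-l}}$, $1\le i\le n$. Then the following hold. (1) There is exactly one form $\langle\cdot,\cdot\rangle$ on $M(\lambda)$, the contravariant form, which is sesquilinear and Hermitian with respect to the automorphism of $F$ that extends complex conjugation and fixes $\kappa,c_0,d_1,\dots,d_{r-1}$, and which satisfies $\langle v_T,v_T\rangle=1$ for all $T\in\mathrm{SYT}(\lambda)$, $\langle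 t_wf,t_wg\rangle=\langle f,g\rangle$, $\langle x_if,g\rangle=\langle f,y_ig\rangle$ and $\langle y_if,g\rangle=\langle f,x_ig\rangle$ for all $f,g\in M(\lambda)$, $w\in W$ and $1\le i\le n$. (2) For all $\mu\in\mathbb{Z}_{\ge0}^n$ and $T\in\mathrm{SYT}(\lambda)$ there is exactly one $\mathfrak{t}$-eigenvector $f_{\mu,T}\in M(\lambda)$ for which $f_{\mu,T}-x^\mu v_T^\mu$ is an $F$-linear combination of elements $x^\nu v_S^\nu$ with $\nu<\mu$ and $S\in\mathrm{SYT}(\lambda)$. (3) (Norm formula.) For all such $\mu$ and $T$, with $a_i=\mathrm{ct}(T(w_\mu(i)))$ and $b_i=\beta(T(w_\mu(i)))$, $$\begin{aligned}\langle f_{\mu,T},f_{\mu,T}\rangle&=\prod_{i=1}^n\prod_{k=1}^{\mu_i}\bigl(\kappa k-(d_{b_i}-d_{b_i-k})-c_0ra_i\bigr)\\ &\times\prod_{\substack{1\le i<j\le n\\ \mu_i>\mu_j}}\ \prod_{\substack{1\le k\le\mu_i-\mu_j\\ k\equiv b_i-b_j\ (\mathrm{mod}\ r)}}\frac{\bigl(\kappa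 k-(d_{b_i}-d_{b_j})-c_0r(a_i-a_j)\bigr)^2-(c_0r)^2}{\bigl(\kappa k-(d_{b_i}-d_{b_j})-c_0r(a_i-a_j)\bigr)^2}\\ &\times\prod_{\substack{1\le i<j\le n\\ \mu_i<\mu_j-1}}\ \prod_{\substack{1\le k\le\mu_j-\mu_i-1\\ k\equiv b_j-b_i\ (\mathrm{mod}\ r)}}\frac{\bigl(\kappa k-(d_{b_j}-d_{b_i})-c_0r(a_j-a_i)\bigr)^2-(c_0r)^2}{\bigl(\kappa k-(d_{b_j}-d_{b_i})-c_0r(a_j-a_i)\bigr)^2}.\end{aligned}$$ -/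

import Mathlib

open scoped BigOperators

namespace Cherednik

noncomputable section

/-! ### The group `G(r,1,n)` -/

/-- The primitive root of unity `ζ = exp (2πi/r)`. -/
def zeta (r : ℕ) : ℂ := Complex.exp (2 * Real.pi * Complex.I / r)

/-- `ζ` as an element of the group of `r`-th roots of unity. -/
def zetaRoot (r : ℕ) [NeZero r] : rootsOfUnity r ℂ :=
  (Complex.isPrimitiveRoot_exp r (NeZero.ne r)).toRootsOfUnity

/-- The group `G(r,1,n)` of `n × n` monomial matrices whose non-zero entries are `r`-th roots of
unity. The pair `(a, σ)` stands for the matrix with entry `a (σ j)` in position `(σ j, j)`, and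
with all other entries zero. -/
abbrev W (r n : ℕ) : Type :=
  (Fin n → rootsOfUnity r ℂ) ⋊[mulAutArrow] Equiv.Perm (Fin n)

/-- The permutation matrix of `σ`. -/
def perm (r : ℕ) {n : ℕ} (σ : Equiv.Perm (Fin n)) : W r n := SemidirectProduct.inr σ

/-- The diagonal matrix `ζ_i`, with `ζ` in position `i` and ones elsewhere on the diagonal. -/
def zetaElt (r : ℕ) [NeZero r] {n : ℕ} (i : Fin n) : W r n :=
  SemidirectProduct.inl (Pi.mulSingle i (zetaRoot r))

/-- The reflection `ζ_i^l s_{ij} ζ_i^{-l}`. -/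
def refl (r : ℕ) [NeZero r] {n : ℕ} (i j : Fin n) (l : ℕ) : W r n :=
  zetaElt r i ^ l * perm r (Equiv.swap i j) * (zetaElt r i ^ l)⁻¹

/-- The non-zero entry of the matrix `w` in column `j`, so that `w y_j = entry w j • y_{w j}`
on the standard basis, and `w x_j = (entry w j)⁻¹ • x_{w j}` on the dual basis. -/
def entry {r n : ℕ} (w : W r n) (j : Fin n) : ℂ :=
  (((w.left (w.right j) : rootsOfUnity r ℂ) : ℂˣ) : ℂ)

/-! ### The rational Cherednik algebra of type `G(r,1,n)` -/

/-- Parameters `κ, c₀, d_0, …, d_{r-1}` in a field `F`, with `d_0 + ⋯ + d_{r-1} = 0`. The indices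
of the `d_i` are read modulo `r`. -/
structure Params (r : ℕ) [NeZero r] (F : Type) [Field F] where
  κ : F
  c₀ : F
  d : ZMod r → F
  sum_d : ∑ j, d j = 0

/-- Generators of the rational Cherednik algebra. -/
inductive Gen (r n : ℕ) : Type
  | x (i : Fin n) : Gen r n
  | y (i : Fin n) : Gen r n
  | t (w : W r n) : Gen r n

section Algebra

variable {r : ℕ} [NeZero r] (n : ℕ) {F : Type} [Field F] [Algebra ℂ F] (p : Params r F)

/-- The generator `g` in the free algebra. -/
abbrev gen (r : ℕ) {n : ℕ} (F : Type) [Field F] (g : Gen r n) : FreeAlgebra F (Gen r n) :=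
  FreeAlgebra.ι F g

/-- The idempotent `e_{ij} = (1/r) ∑_l ζ^{-lj} t_{ζ_i^l}`, written in the free algebra. -/
def idem (r : ℕ) [NeZero r] {n : ℕ} (F : Type) [Field F] [Algebra ℂ F] (i : Fin n) (j : ℕ) :
    FreeAlgebra F (Gen r n) :=
  (r : F)⁻¹ • ∑ l ∈ Finset.range r,
    algebraMap ℂ F ((zeta r)⁻¹ ^ (l * j)) • gen r F (Gen.t (zetaElt r i ^ l))

/-- Defining relations of the rational Cherednik algebra. -/
inductive Rel : FreeAlgebra F (Gen r n) → FreeAlgebra F (Gen r n) → Prop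
  | x_comm (i j : Fin n) :
      Rel (gen r F (Gen.x i) * gen r F (Gen.x j)) (gen r F (Gen.x j) * gen r F (Gen.x i))
  | y_comm (i j : Fin n) :
      Rel (gen r F (Gen.y i) * gen r F (Gen.y j)) (gen r F (Gen.y j) * gen r F (Gen.y i))
  | t_one : Rel (gen r F (Gen.t 1)) 1
  | t_mul (v w : W r n) :
      Rel (gen r F (Gen.t v) * gen r F (Gen.t w)) (gen r F (Gen.t (v * w)))
  | t_x (w : W r n) (j : Fin n) :
      Rel (gen r F (Gen.t w) * gen r F (Gen.x j))
        (algebraMap ℂ F (entry w j)⁻¹ • (gen r F (Gen.x (w.right j)) * gen r F (Gen.t w)))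
  | t_y (w : W r n) (j : Fin n) :
      Rel (gen r F (Gen.t w) * gen r F (Gen.y j))
        (algebraMap ℂ F (entry w j) • (gen r F (Gen.y (w.right j)) * gen r F (Gen.t w)))
  | y_x_ne (i j : Fin n) (hij : i ≠ j) :
      Rel (gen r F (Gen.y i) * gen r F (Gen.x j))
        (gen r F (Gen.x j) * gen r F (Gen.y i) +
          p.c₀ • ∑ l ∈ Finset.range r,
            algebraMap ℂ F ((zeta r)⁻¹ ^ l) • gen r F (Gen.t (refl r i j l)))
  | y_x_self (i : Fin n) :
      Rel (gen r F (Gen.y i) * gen r F (Gen.x i))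
        (gen r F (Gen.x i) * gen r F (Gen.y i) + algebraMap F _ p.κ
          - ∑ j ∈ Finset.range r,
              (p.d (j : ZMod r) - p.d ((j : ZMod r) - 1)) • idem r F i j
          - p.c₀ • ∑ j ∈ Finset.univ.filter (fun j : Fin n => j ≠ i),
              ∑ l ∈ Finset.range r, gen r F (Gen.t (refl r i j l)))

/-- The rational Cherednik algebra of type `G(r,1,n)` with parameters `p`. -/
def RCA : Type := RingQuot (Rel n p)

instance : Ring (RCA n p) := inferInstanceAs (Ring (RingQuot (Rel n p)))

instance : Algebra F (RCA n p) := inferInstanceAs (Algebra F (RingQuot (Rel n p)))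

/-- The quotient map from the free algebra. -/
def RCA.mk : FreeAlgebra F (Gen r n) →ₐ[F] RCA n p := RingQuot.mkAlgHom F (Rel n p)

variable {n}

/-- The element `x_i`. -/
def X (i : Fin n) : RCA n p := RCA.mk n p (gen r F (Gen.x i))

/-- The element `y_i`. -/
def Y (i : Fin n) : RCA n p := RCA.mk n p (gen r F (Gen.y i))

/-- The element `t_w`. -/
def t (w : W r n) : RCA n p := RCA.mk n p (gen r F (Gen.t w))

/-- The monomial `x^μ = x_1^{μ_1} ⋯ x_n^{μ_n}`. -/
def xPow (μ : Fin n → ℕ) : RCA n p := (List.ofFn fun i => X p i ^ μ i).prod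

/-- The Jucys–Murphy element `φ_i = ∑_{j < i} ∑_l t_{ζ_i^l s_{ij} ζ_i^{-l}}`. -/
def jm (i : Fin n) : RCA n p :=
  ∑ j ∈ Finset.univ.filter (fun j : Fin n => j < i), ∑ l ∈ Finset.range r, t p (refl r i j l)

/-- The Dunkl–Opdam element `z_i = y_i x_i + c₀ φ_i`. -/
def z (i : Fin n) : RCA n p := Y p i * X p i + p.c₀ • jm p i

variable (n) in
/-- The subalgebra `𝔱` generated by `z_1, …, z_n` and `t_{ζ_1}, …, t_{ζ_n}`. -/
def tAlg : Subalgebra F (RCA n p) :=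
  Algebra.adjoin F (Set.range (z p) ∪ Set.range fun i : Fin n => t p (zetaElt r i))

end Algebra

/-! ### `r`-partitions and standard tableaux -/

/-- An `r`-partition of `n`: a sequence `(λ^0, …, λ^{r-1})` of partitions (as Young diagrams) with
`n` boxes in total. The components are indexed by the residues modulo `r`. -/
structure RPartition (r n : ℕ) [NeZero r] where
  part : ZMod r → YoungDiagram
  card_eq : ∑ i, (part i).card = n

variable {r n : ℕ} [NeZero r]

/-- The boxes of `λ`: triples `(β, row, column)`. -/
def Box (lam : RPartition r n) : Type := {b : ZMod r × ℕ × ℕ // b.2 ∈ lam.part b.1}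

namespace Box

variable {lam : RPartition r n}

/-- `β b = i` if `b` lies in `λ^i`. -/
def β (b : Box lam) : ZMod r := b.1.1

/-- The row of a box. -/
def row (b : Box lam) : ℕ := b.1.2.1

/-- The column of a box. -/
def col (b : Box lam) : ℕ := b.1.2.2

/-- The content of a box. -/
def ct (b : Box lam) : ℤ := (b.col : ℤ) - (b.row : ℤ)

end Box

/-- Entries increase strictly from left to right and from top to bottom in each component; `T i` is
the box in which `i` appears. -/
def IsStandard {lam : RPartition r n} (T : Fin n ≃ Box lam) : Prop :=
  ∀ i j : Fin n, (T i).β = (T j).β →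
    ((T i).row = (T j).row → (T i).col < (T j).col → i < j) ∧
    ((T i).col = (T j).col → (T i).row < (T j).row → i < j)

/-- Standard Young tableaux on `λ`. -/
def SYT (lam : RPartition r n) : Type := {T : Fin n ≃ Box lam // IsStandard T}

/-- The filling `s_{ij}.T`, obtained from `T` by interchanging the entries `i` and `j`. -/
def SYT.swap {lam : RPartition r n} (T : SYT lam) (i j : Fin n) : Fin n ≃ Box lam :=
  (Equiv.swap i j).trans T.1

/-! ### The standard module -/

section Standard

variable {F : Type} [Field F] [Algebra ℂ F] (p : Params r F) (lam : RPartition r n)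

/-- The number `1 / (ct (T j) - ct (T i))`. -/
def invDist {lam : RPartition r n} (T : SYT lam) (i j : Fin n) : ℝ :=
  1 / (((T.1 j).ct - (T.1 i).ct : ℤ) : ℝ)

/-- The coefficient of `v_T` in `t_{s_i}.v_T`, where `j = i + 1`. -/
def diagCoeff {lam : RPartition r n} (T : SYT lam) (i j : Fin n) : ℝ :=
  if (T.1 i).β = (T.1 j).β then invDist T i j else 0

/-- The coefficient of `v_{s_i.T}` in `t_{s_i}.v_T`, where `j = i + 1` and `s_i.T` is standard. -/
def offCoeff {lam : RPartition r n} (T : SYT lam) (i j : Fin n) : ℝ :=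
  if (T.1 i).β = (T.1 j).β then Real.sqrt (1 - invDist T i j ^ 2) else 1

open Classical in
/-- The vector `t_{s_i}.v_T` in Young's orthonormal form of the irreducible `G(r,1,n)`-module
`S^λ`, where `j = i + 1`, written with coefficients in the Cherednik algebra. -/
def youngVec {lam : RPartition r n} (T : SYT lam) (i j : Fin n) : SYT lam →₀ RCA n p :=
  Finsupp.single T (algebraMap F (RCA n p) (algebraMap ℂ F (diagCoeff T i j : ℂ))) +
    (if h : IsStandard (T.swap i j) then
      (Finsupp.single ⟨T.swap i j, h⟩
        (algebraMap F (RCA n p) (algebraMap ℂ F (offCoeff T i j : ℂ))) : SYT lam →₀ RCA n p)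
    else 0)

/-- The relations in the free module on the `v_T` which define the standard module: the `y_i` kill
`v_T`, and the generators `ζ_i` and `s_i` of `G(r,1,n)` act on the `v_T` as they do on the basis
`v_T` of `S^λ`. -/
inductive ModRel : (SYT lam →₀ RCA n p) → Prop
  | y (T : SYT lam) (i : Fin n) : ModRel (Finsupp.single T (Y p i))
  | zeta (T : SYT lam) (i : Fin n) :
      ModRel (Finsupp.single T (t p (zetaElt r i)) -
        Finsupp.single T (algebraMap F (RCA n p)
          (algebraMap ℂ F (zeta r ^ ((T.1 i).β).val))))
  | s (T : SYT lam) (i j : Fin n) (hij : (i : ℕ) + 1 = j) :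
      ModRel (Finsupp.single T (t p (perm r (Equiv.swap i j))) - youngVec p T i j)

/-- The standard module `M(λ)`, induced from the representation `S^λ` of `G(r,1,n)` on which the
`y_i` act by zero. -/
def StdModule : Type :=
  (SYT lam →₀ RCA n p) ⧸ Submodule.span (RCA n p) {v | ModRel p lam v}

instance : AddCommGroup (StdModule p lam) :=
  inferInstanceAs (AddCommGroup (_ ⧸ Submodule.span (RCA n p) {v | ModRel p lam v}))

instance : Module (RCA n p) (StdModule p lam) :=
  inferInstanceAs (Module (RCA n p) (_ ⧸ Submodule.span (RCA n p) {v | ModRel p lam v}))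

instance : Module F (StdModule p lam) :=
  inferInstanceAs (Module F (_ ⧸ Submodule.span (RCA n p) {v | ModRel p lam v}))

instance : IsScalarTower F (RCA n p) (StdModule p lam) :=
  inferInstanceAs (IsScalarTower F (RCA n p)
    (_ ⧸ Submodule.span (RCA n p) {v | ModRel p lam v}))

variable {lam}

/-- The vector `v_T` of `S^λ ⊆ M(λ)`. -/
def vec (T : SYT lam) : StdModule p lam :=
  Submodule.Quotient.mk (Finsupp.single T (1 : RCA n p))

end Standard

/-! ### The order on `ℤ_{≥0}^n` -/

/-- `w_μ i`, counted from `0`. -/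
def wFun (μ : Fin n → ℕ) (i : Fin n) : ℕ :=
  (Finset.univ.filter fun j : Fin n => j < i ∧ μ j < μ i).card +
    (Finset.univ.filter fun j : Fin n => i < j ∧ μ j ≤ μ i).card

theorem wFun_eq (μ : Fin n → ℕ) (i : Fin n) :
    wFun μ i = (Finset.univ.filter fun j : Fin n => μ j < μ i ∨ (μ j = μ i ∧ i < j)).card := by
  unfold wFun
  rw [← Finset.card_union_of_disjoint]
  · congr 1
    ext j
    simp only [Finset.mem_union, Finset.mem_filter, Finset.mem_univ, true_and]
    rcases lt_trichotomy i j with h | h | h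
    · have := h.not_gt; grind
    · subst h; simp
    · have := h.not_gt; grind
  · rw [Finset.disjoint_left]
    intro j h1 h2
    simp only [Finset.mem_filter, Finset.mem_univ, true_and] at h1 h2
    exact lt_asymm h1.1 h2.1

theorem wFun_lt (μ : Fin n → ℕ) (i : Fin n) : wFun μ i < n := by
  rw [wFun_eq]
  refine lt_of_lt_of_eq (Finset.card_lt_card (t := Finset.univ) ?_) (by simp)
  rw [Finset.ssubset_univ_iff]
  intro h
  have := h ▸ Finset.mem_univ i
  simp at this

theorem wFun_lt_wFun (μ : Fin n → ℕ) {i j : Fin n} (h : μ j < μ i ∨ (μ j = μ i ∧ i < j)) :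
    wFun μ j < wFun μ i := by
  rw [wFun_eq, wFun_eq]
  apply Finset.card_lt_card
  rw [Finset.ssubset_iff_of_subset]
  · exact ⟨j, by simpa using h, by simp⟩
  · intro k hk
    simp only [Finset.mem_filter, Finset.mem_univ, true_and] at hk ⊢
    rcases h with h | ⟨h, h'⟩ <;> rcases hk with hk | ⟨hk, hk'⟩
    · left; omega
    · left; omega
    · left; omega
    · right; exact ⟨by omega, h'.trans hk'⟩

theorem wFun_injective (μ : Fin n → ℕ) :
    Function.Injective fun i => (⟨wFun μ i, wFun_lt μ i⟩ : Fin n) := by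
  intro i j h
  have h' : wFun μ i = wFun μ j := congrArg Fin.val h
  by_contra hne
  rcases lt_trichotomy (μ i) (μ j) with h1 | h1 | h1
  · exact absurd (wFun_lt_wFun μ (Or.inl h1)) (by omega)
  · rcases lt_or_gt_of_ne hne with h2 | h2
    · exact absurd (wFun_lt_wFun μ (Or.inr ⟨h1.symm, h2⟩)) (by omega)
    · exact absurd (wFun_lt_wFun μ (Or.inr ⟨h1, h2⟩)) (by omega)
  · exact absurd (wFun_lt_wFun μ (Or.inl h1)) (by omega)

/-- The longest permutation `w_μ` for which `w_μ.μ` is non-decreasing. -/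
def wPerm (μ : Fin n → ℕ) : Equiv.Perm (Fin n) :=
  Equiv.ofBijective (fun i => (⟨wFun μ i, wFun_lt μ i⟩ : Fin n))
    (Finite.injective_iff_bijective.mp (wFun_injective μ))

/-- The non-increasing rearrangement `μ^+`. -/
def plus (μ : Fin n → ℕ) : Fin n → ℕ := fun i => μ (Tuple.sort μ i.rev)

/-- The dominance order on non-increasing sequences, including equality. -/
def DomLE (μ ν : Fin n → ℕ) : Prop :=
  ∑ i, μ i = ∑ i, ν i ∧
    ∀ m : Fin n, ∑ i ∈ Finset.univ.filter (fun i => i ≤ m), μ i ≤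
      ∑ i ∈ Finset.univ.filter (fun i => i ≤ m), ν i

/-- The length (number of inversions) of a permutation. -/
def len (w : Equiv.Perm (Fin n)) : ℕ :=
  (Finset.univ.filter fun q : Fin n × Fin n => q.1 < q.2 ∧ w q.2 < w q.1).card

/-- The strict Bruhat order on the symmetric group. -/
def BruhatLT : Equiv.Perm (Fin n) → Equiv.Perm (Fin n) → Prop :=
  Relation.TransGen fun v w => (∃ i j : Fin n, i ≠ j ∧ w = v * Equiv.swap i j) ∧ len v < len w

/-- The partial order on `ℤ_{≥0}^n`: `μ < ν` if `μ^+` is strictly below `ν^+` in dominance order,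
or `μ^+ = ν^+` and `w_μ < w_ν` in Bruhat order. -/
def WeightLT (μ ν : Fin n → ℕ) : Prop :=
  (DomLE (plus μ) (plus ν) ∧ plus μ ≠ plus ν) ∨
    (plus μ = plus ν ∧ BruhatLT (wPerm μ) (wPerm ν))

/-! ### The eigenvectors `f_{μ,T}` -/

section Eigen

variable {F : Type} [Field F] [Algebra ℂ F] (p : Params r F) {lam : RPartition r n}

/-- The vector `x^μ v_T^μ`, where `v_T^μ = t_{w_μ}^{-1}.v_T`. -/
def leading (μ : Fin n → ℕ) (T : SYT lam) : StdModule p lam :=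
  xPow p μ • t p (perm r (wPerm μ))⁻¹ • vec p T

/-- `f` is an eigenvector of `𝔱` of the form `x^μ v_T^μ + lower terms`. -/
def IsEigenfunction (μ : Fin n → ℕ) (T : SYT lam) (f : StdModule p lam) : Prop :=
  f ≠ 0 ∧ (∀ a ∈ tAlg n p, ∃ c : F, a • f = c • f) ∧
    f - leading p μ T ∈
      Submodule.span F {g : StdModule p lam |
        ∃ (ν : Fin n → ℕ) (S : SYT lam), WeightLT ν μ ∧ g = leading p ν S}

end Eigen

/-! ### Generic parameters and the contravariant form -/

/-- The independent parameters `κ, c₀, d_1, …, d_{r-1}`. -/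
inductive Param (r : ℕ) : Type
  | κ : Param r
  | c₀ : Param r
  | d (j : {j : ZMod r // j ≠ 0}) : Param r

/-- The field of rational functions `ℂ(κ, c₀, d_1, …, d_{r-1})`. -/
abbrev GenericField (r : ℕ) : Type := FractionRing (MvPolynomial (Param r) ℂ)

/-- An independent parameter as an element of the field of rational functions. -/
def paramVal {r : ℕ} (q : Param r) : GenericField r :=
  algebraMap (MvPolynomial (Param r) ℂ) (GenericField r) (MvPolynomial.X q)

/-- `d_j` for `j ≠ 0` is an independent parameter, and `d_0 = -(d_1 + ⋯ + d_{r-1})`. -/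
def genericD (r : ℕ) [NeZero r] (j : ZMod r) : GenericField r :=
  if h : j = 0 then -∑ k : {k : ZMod r // k ≠ 0}, paramVal (Param.d k)
  else paramVal (Param.d ⟨j, h⟩)

theorem sum_genericD (r : ℕ) [NeZero r] : ∑ j, genericD r j = 0 := by
  rw [← Finset.add_sum_erase _ _ (Finset.mem_univ (0 : ZMod r))]
  have h : ∑ j ∈ Finset.univ.erase (0 : ZMod r), genericD r j =
      ∑ k : {k : ZMod r // k ≠ 0}, paramVal (Param.d k) := by
    rw [Finset.sum_subtype (Finset.univ.erase (0 : ZMod r)) (p := fun k => k ≠ 0) (by simp)]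
    exact Finset.sum_congr rfl fun k _ => by simp [genericD, k.2]
  rw [h]
  simp [genericD]

/-- The generic parameters. -/
def generic (r : ℕ) [NeZero r] : Params r (GenericField r) where
  κ := paramVal Param.κ
  c₀ := paramVal Param.c₀
  d := genericD r
  sum_d := sum_genericD r

/-- Complex conjugation, extended to `ℂ(κ, c₀, d_1, …, d_{r-1})` by fixing the parameters. -/
def conjF (r : ℕ) : GenericField r →+* GenericField r :=
  (IsFractionRing.ringEquivOfRingEquiv
    (MvPolynomial.mapEquiv (Param r) (starRingAut (R := ℂ)))).toRingHom

/-- The contravariant form on `M(λ)`, which is linear in the first and conjugate linear in the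
second variable: it is Hermitian and `G(r,1,n)`-invariant, satisfies `⟨v_T, v_T⟩ = 1` for all
standard tableaux `T`, and `x_i` and `y_i` are adjoint to each other. -/
structure IsContravariantForm (lam : RPartition r n)
    (B : StdModule (generic r) lam →ₗ[GenericField r]
      StdModule (generic r) lam →ₛₗ[conjF r] GenericField r) : Prop where
  hermitian : ∀ f g, B g f = conjF r (B f g)
  norm_vec : ∀ T : SYT lam, B (vec (generic r) T) (vec (generic r) T) = 1
  invariant : ∀ (w : W r n) (f g : StdModule (generic r) lam),
    B (t (generic r) w • f) (t (generic r) w • g) = B f g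
  adjoint_x : ∀ (i : Fin n) (f g : StdModule (generic r) lam),
    B (X (generic r) i • f) g = B f (Y (generic r) i • g)
  adjoint_y : ∀ (i : Fin n) (f g : StdModule (generic r) lam),
    B (Y (generic r) i • f) g = B f (X (generic r) i • g)

end

end Cherednik

open scoped BigOperators
namespace Cherednik

set_option linter.unusedSectionVars false

noncomputable section

/-! ### Characters of the group of roots of unity -/

section Chr

variable {r : ℕ} [NeZero r] (F : Type) [Field F] [Algebra ℂ F]

/-! The module `M(λ)` is a quotient and hard to control directly, so it is compared with a concrete
model: polynomials in the `x_i` with coefficients in `S^λ`, on which the `y_i` act by Dunkl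
operators. That Young's formulas define a representation is itself proved: their Coxeter relations
are verified, and `exists_permHom` shows that these relations present the symmetric group. The Dunkl
operators satisfy the relations of the Cherednik algebra because the defect of such a relation kills
constants and commutes with the `x_j` up to a scalar and a permutation of indices, hence vanishes
(`PolyMod.hom_eq_zero`). The isomorphism `stdEquiv` then transports everything to `M(λ)`.

In the basis `x^μ v_T^μ` the `z_i` are triangular. The divided differences in `y_i x_i x^μ v`
produce `x^μ` again, a reflected monomial, and monomials strictly below in dominance; the
Jucys–Murphy term of `z_i` cancels the reflected monomials that are not lower
(`pairOp_inc_sub_mem`). The twist of `v_T` by `w_μ` turns the remaining reflections into a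
Jucys–Murphy element acting on `v_T`, which explains the contents in the eigenvalues. For generic
parameters the joint diagonal entries of the `z_i` and of the diagonal matrices determine `(μ, T)`.
Commuting triangular operators with distinct joint diagonal entries have exactly one eigenvector for
each leading term (`IsTriangular.exists_eigenvector`, `IsTriangular.eq_smul`).

Adjointness leaves no freedom for the form: the pairing of `x^ν v` with `g` must be the pairing of
`v` with the constant term of `y^ν g`. This defines `contraForm`, and its symmetry rests on
`bracket_adjoint`: the commutators `[y_i, x_j]` and `[y_j, x_i]` are adjoint to each other. On `S^λ`
the form is determined because the `v_T` are separated by contents and components.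

The norms follow from two intertwiners. The affine one, `x_n t_c` for the cyclic permutation `c`,
raises the degree by one; composed with its adjoint it is `y_1 x_1 = z_1`, so it multiplies the norm
by an eigenvalue of `z_1` (`IsContravariant.norm_rotate`). If `μ_i < μ_{i+1}`, then `t_{s_i}` plus a
scalar `c` maps `f_{μ,T}` to an orthogonal eigenvector, and since `t_{s_i}` is an isometry the norm
is multiplied by `1 - c^2` (`IsContravariant.norm_swap`). Every exponent is reached from `0` in this
way, and the product in the norm formula obeys the same two recursions (`normProd_rotate`,
`normProd_swap`). -/

instance : Fintype (rootsOfUnity r ℂ) := Fintype.ofFinite _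

/-- The embedding of the `r`-th roots of unity into `F`. -/
def emb : rootsOfUnity r ℂ →* F :=
  ((algebraMap ℂ F : ℂ →* F).comp (Units.coeHom ℂ)).comp (rootsOfUnity r ℂ).subtype

/-- The character `u ↦ u ^ k` for a residue `k` modulo `r`. -/
def chr (k : ZMod r) : rootsOfUnity r ℂ →* F := (emb F).comp (powMonoidHom k.val)

theorem rootsOfUnity_pow_eq (u : rootsOfUnity r ℂ) : u ^ r = 1 := by
  have := u.2
  rw [mem_rootsOfUnity] at this
  exact Subtype.ext this

theorem rootsOfUnity_pow_mod (u : rootsOfUnity r ℂ) (m : ℕ) : u ^ (m % r) = u ^ m :=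
  (pow_eq_pow_mod m (rootsOfUnity_pow_eq u)).symm

theorem chr_apply (k : ZMod r) (u : rootsOfUnity r ℂ) : chr F k u = emb F (u ^ k.val) := rfl

theorem chr_natCast (m : ℕ) (u : rootsOfUnity r ℂ) : chr F (m : ZMod r) u = emb F u ^ m := by
  rw [chr_apply, ZMod.val_natCast, rootsOfUnity_pow_mod, map_pow]

@[simp] theorem chr_zero (u : rootsOfUnity r ℂ) : chr F 0 u = 1 := by
  simp [chr_apply]

theorem chr_one (u : rootsOfUnity r ℂ) : chr F 1 u = emb F u := by
  simpa using chr_natCast F 1 u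

theorem chr_add (k l : ZMod r) (u : rootsOfUnity r ℂ) :
    chr F (k + l) u = chr F k u * chr F l u := by
  have h : chr F ((k.val + l.val : ℕ) : ZMod r) u = chr F k u * chr F l u := by
    rw [chr_natCast, pow_add, chr_apply, chr_apply, map_pow, map_pow]
  simpa using h

theorem chr_mul_neg (k : ZMod r) (u : rootsOfUnity r ℂ) : chr F k u * chr F (-k) u = 1 := by
  rw [← chr_add]; simp

theorem chr_neg (k : ZMod r) (u : rootsOfUnity r ℂ) : chr F (-k) u = (chr F k u)⁻¹ :=
  eq_inv_of_mul_eq_one_right (chr_mul_neg F k u)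

theorem chr_inv (k : ZMod r) (u : rootsOfUnity r ℂ) : chr F k u⁻¹ = chr F (-k) u := by
  rw [chr_neg]
  apply eq_inv_of_mul_eq_one_right
  rw [← map_mul]; simp

theorem chr_sub (k l : ZMod r) (u : rootsOfUnity r ℂ) :
    chr F (k - l) u = chr F k u * chr F (-l) u := by
  rw [sub_eq_add_neg, chr_add]

theorem emb_zetaRoot : emb F (zetaRoot r) = algebraMap ℂ F (zeta r) := rfl

theorem isPrimitiveRoot_zeta (r : ℕ) [NeZero r] : IsPrimitiveRoot (zeta r) r :=
  Complex.isPrimitiveRoot_exp r (NeZero.ne r)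

theorem chr_zetaRoot (k : ZMod r) : chr F k (zetaRoot r) = algebraMap ℂ F (zeta r ^ k.val) := by
  rw [chr_apply, map_pow, map_pow, emb_zetaRoot]

theorem chr_zetaRoot_injective {k l : ZMod r} (h : chr F k (zetaRoot r) = chr F l (zetaRoot r)) :
    k = l := by
  rw [chr_zetaRoot, chr_zetaRoot] at h
  have := (algebraMap ℂ F).injective h
  exact ZMod.val_injective r ((isPrimitiveRoot_zeta r).pow_inj (ZMod.val_lt k) (ZMod.val_lt l) this)

/-- Orthogonality of characters. A nonzero residue gives a nontrivial character because the residue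
can be recovered from the value at `zetaRoot r`. -/
theorem sum_chr (k : ZMod r) :
    ∑ u : rootsOfUnity r ℂ, chr F k u = if k = 0 then (r : F) else 0 := by
  classical
  rw [sum_hom_units]
  have hc : Fintype.card (rootsOfUnity r ℂ) = r := by
    rw [← Nat.card_eq_fintype_card, Complex.card_rootsOfUnity r]
  by_cases hk : k = 0
  · subst hk
    have : chr F (0 : ZMod r) = 1 := by ext u; simp
    simp [this, hc]
  · have : chr F k ≠ 1 := by
      intro h
      apply hk
      apply chr_zetaRoot_injective F
      rw [h]; simp
    simp [this, hk]

/-- Sums over exponents become sums over the group, where translation and inversion of the summation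
variable are available. -/
theorem sum_range_zetaRoot {A : Type*} [AddCommMonoid A] (f : rootsOfUnity r ℂ → A) :
    ∑ l ∈ Finset.range r, f (zetaRoot r ^ l) = ∑ u, f u := by
  have hp : IsPrimitiveRoot (zetaRoot r) r := by
    rw [← IsPrimitiveRoot.coe_submonoidClass_iff, ← IsPrimitiveRoot.coe_units_iff]
    exact isPrimitiveRoot_zeta r
  have hp' : IsPrimitiveRoot (zetaRoot r : ℂˣ) r := by
    rw [← IsPrimitiveRoot.coe_units_iff]
    exact isPrimitiveRoot_zeta r
  refine Finset.sum_bij (fun l _ => zetaRoot r ^ l) (by simp) ?_ ?_ (by simp)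
  · intro a ha b hb h
    exact hp.pow_inj (Finset.mem_range.1 ha) (Finset.mem_range.1 hb) h
  · intro u _
    obtain ⟨i, hi, h⟩ := (hp'.eq_pow_of_mem_rootsOfUnity u.2)
    refine ⟨i, Finset.mem_range.2 hi, ?_⟩
    apply Subtype.ext
    simpa using h

end Chr

/-! ### Elements of `G(r,1,n)` -/

section Group

variable {r n : ℕ} [NeZero r]

/-- The diagonal matrix with entries `a`. -/
def diag (a : Fin n → rootsOfUnity r ℂ) : W r n := SemidirectProduct.inl a

/-- The reflection `u_i s_{ij} u_i⁻¹`, where `u_i` is diagonal with `u` in position `i`. -/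
def reflAt (i j : Fin n) (u : rootsOfUnity r ℂ) : W r n :=
  ⟨Pi.mulSingle i u * Pi.mulSingle j u⁻¹, Equiv.swap i j⟩

theorem W_mul_left (v w : W r n) (k : Fin n) :
    (v * w).left k = v.left k * w.left (v.right⁻¹ k) := rfl

theorem W_mul_right (v w : W r n) : (v * w).right = v.right * w.right := rfl

theorem W_one_left (k : Fin n) : (1 : W r n).left k = 1 := rfl

theorem W_ext {v w : W r n} (h : ∀ k, v.left k = w.left k) (h' : v.right = w.right) : v = w :=
  SemidirectProduct.ext (funext h) h'

theorem zetaElt_pow (i : Fin n) (l : ℕ) :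
    zetaElt r i ^ l = diag (Pi.mulSingle i (zetaRoot r ^ l)) := by
  unfold zetaElt diag
  rw [← map_pow, Pi.mulSingle_pow]

theorem zetaElt_eq (i : Fin n) : zetaElt r i = diag (Pi.mulSingle i (zetaRoot r)) := rfl

theorem diag_mul_perm (a : Fin n → rootsOfUnity r ℂ) (σ : Equiv.Perm (Fin n)) :
    diag a * perm r σ = ⟨a, σ⟩ := by
  unfold diag perm
  rw [SemidirectProduct.mk_eq_inl_mul_inr]

theorem W_eq_diag_mul_perm (w : W r n) : w = diag w.left * perm r w.right := by
  rw [diag_mul_perm]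

@[simp] theorem diag_left (a : Fin n → rootsOfUnity r ℂ) : (diag a).left = a := rfl
@[simp] theorem diag_right (a : Fin n → rootsOfUnity r ℂ) : (diag a).right = 1 := rfl
@[simp] theorem perm_left (σ : Equiv.Perm (Fin n)) (k : Fin n) : (perm r σ).left k = 1 := rfl
@[simp] theorem perm_right (σ : Equiv.Perm (Fin n)) : (perm r σ).right = σ := rfl
@[simp] theorem reflAt_left (i j : Fin n) (u : rootsOfUnity r ℂ) :
    (reflAt i j u).left = Pi.mulSingle i u * Pi.mulSingle j u⁻¹ := rfl
@[simp] theorem reflAt_right (i j : Fin n) (u : rootsOfUnity r ℂ) :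
    (reflAt i j u).right = Equiv.swap i j := rfl

theorem diag_mul (a b : Fin n → rootsOfUnity r ℂ) : diag (a * b) = diag a * diag b :=
  map_mul SemidirectProduct.inl a b

theorem diag_inv (a : Fin n → rootsOfUnity r ℂ) : diag a⁻¹ = (diag a)⁻¹ :=
  map_inv SemidirectProduct.inl a

theorem perm_mul (σ τ : Equiv.Perm (Fin n)) : perm r (σ * τ) = perm r σ * perm r τ :=
  map_mul SemidirectProduct.inr σ τ

theorem reflAt_comm (i j : Fin n) (u : rootsOfUnity r ℂ) : reflAt i j u = reflAt j i u⁻¹ := by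
  refine W_ext (fun k => ?_) (Equiv.swap_comm i j)
  simp [mul_comm]

theorem reflAt_mul_self {i j : Fin n} (h : i ≠ j) (u : rootsOfUnity r ℂ) :
    reflAt i j u * reflAt i j u = 1 := by
  refine W_ext (fun k => ?_) ?_
  · rw [W_mul_left]
    simp only [reflAt_left, reflAt_right, Equiv.swap_inv, Pi.mul_apply, W_one_left]
    by_cases hi : k = i
    · subst hi; simp [h, h.symm]
    · by_cases hj : k = j
      · subst hj; simp [h, h.symm]
      · simp [hi, hj, Equiv.swap_apply_of_ne_of_ne hi hj]
  · simp

theorem reflAt_inv {i j : Fin n} (h : i ≠ j) (u : rootsOfUnity r ℂ) :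
    (reflAt i j u)⁻¹ = reflAt i j u :=
  inv_eq_of_mul_eq_one_left (reflAt_mul_self h u)

theorem reflAt_eq (i j : Fin n) (u : rootsOfUnity r ℂ) :
    reflAt i j u = diag (Pi.mulSingle i u * Pi.mulSingle j u⁻¹) * perm r (Equiv.swap i j) := by
  rw [diag_mul_perm]; rfl

theorem refl_eq {i j : Fin n} (h : i ≠ j) (l : ℕ) : refl r i j l = reflAt i j (zetaRoot r ^ l) := by
  unfold refl
  rw [zetaElt_pow, ← diag_inv]
  refine W_ext (fun k => ?_) (by simp)
  simp only [W_mul_left, W_mul_right, diag_left, diag_right, perm_left, perm_right, one_mul, mul_one,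
    reflAt_left, inv_one, Equiv.Perm.one_apply, Equiv.swap_inv, Pi.inv_apply, Pi.mul_apply]
  congr 1
  by_cases hi : k = i
  · subst hi; simp [h, h.symm]
  · by_cases hj : k = j
    · subst hj; simp
    · simp [hi, hj, Equiv.swap_apply_of_ne_of_ne hi hj]

/-- Conjugation by `w` permutes these reflections, and the root of unity is twisted by the ratio of
two entries of `w`. The form without inverses is the one that rewrites products in the algebra. -/
theorem mul_reflAt (w : W r n) (i j : Fin n) (u : rootsOfUnity r ℂ) :
    w * reflAt i j u =
      reflAt (w.right i) (w.right j) (w.left (w.right i) * u * (w.left (w.right j))⁻¹) * w := by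
  refine W_ext (fun k => ?_) ?_
  · simp only [W_mul_left, reflAt_left, reflAt_right, Pi.mul_apply, Equiv.swap_inv]
    obtain ⟨k, rfl⟩ := w.right.surjective k
    have hinv : ∀ l, w.right⁻¹ (w.right l) = l := fun l => w.right.symm_apply_apply l
    simp only [hinv, Pi.mulSingle_apply, EmbeddingLike.apply_eq_iff_eq]
    by_cases hi : k = i
    · subst hi
      by_cases hj : k = j
      · subst hj; simp
      · simp [hj, mul_comm]
    · by_cases hj : k = j
      · subst hj
        have h1 : ∀ a b c : rootsOfUnity r ℂ, c⁻¹ * a = b * (c⁻¹ * b⁻¹ * a) := fun a b c => by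
          rw [mul_comm c⁻¹ b⁻¹, mul_assoc, mul_inv_cancel_left]
        simp only [hi, mul_comm, if_false, if_true, mul_inv_rev, inv_inv, one_mul, mul_one,
          Equiv.swap_apply_right]
        exact h1 _ _ _
      · have h1 : w.right k ≠ w.right i := by simpa using hi
        have h2 : w.right k ≠ w.right j := by simpa using hj
        simp [hi, hj, Equiv.swap_apply_of_ne_of_ne h1 h2]
  · simp only [W_mul_right, reflAt_right]
    ext k
    simp [Equiv.swap_apply_def]
    split_ifs <;> simp_all

theorem mul_diag_single (w : W r n) (i : Fin n) (u : rootsOfUnity r ℂ) :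
    w * diag (Pi.mulSingle i u) = diag (Pi.mulSingle (w.right i) u) * w := by
  refine W_ext (fun k => ?_) (by simp)
  obtain ⟨k, rfl⟩ := w.right.surjective k
  simp [W_mul_left, Pi.mulSingle_apply, mul_comm]

end Group

/-! ### The commutators `[y_i, x_j]` -/

section Bracket

variable {r n : ℕ} [NeZero r] {F : Type} [Field F] [Algebra ℂ F] (p : Params r F)
  {A : Type*} [Ring A] [Algebra F A] (τ : W r n →* A)

/-- The sum of the reflections which interchange the `i`-th and the `j`-th coordinate, weighted by
a character of the group of roots of unity. -/
def reflSum (k : ZMod r) (i j : Fin n) : A := ∑ u, chr F k u • τ (reflAt i j u)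

/-- `∑_k (d_k - d_{k-1}) e_{ik}`. -/
def dSum (i : Fin n) : A :=
  ∑ k : ZMod r, (p.d k - p.d (k - 1)) •
    ((r : F)⁻¹ • ∑ u, chr F (-k) u • τ (diag (Pi.mulSingle i u)))

/-- The commutator of `y_i` and `x_j`. -/
def bracket (i j : Fin n) : A :=
  if i = j then
    algebraMap F A p.κ - dSum p τ i -
      p.c₀ • ∑ k ∈ Finset.univ.filter (fun k : Fin n => k ≠ i), reflSum (F := F) τ 0 i k
  else p.c₀ • reflSum (F := F) τ (-1) i j

variable {p τ}

theorem reflSum_comm (k : ZMod r) (i j : Fin n) :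
    reflSum (F := F) τ k i j = reflSum (F := F) τ (-k) j i := by
  unfold reflSum
  refine Fintype.sum_equiv (Equiv.inv _) _ _ fun u => ?_
  rw [Equiv.inv_apply, chr_inv, neg_neg, reflAt_comm i j]

/-- Conjugation translates the summation variable by a fixed root of unity; the character turns the
translation into a scalar. -/
theorem map_mul_reflSum (w : W r n) (k : ZMod r) (i j : Fin n) :
    τ w * reflSum (F := F) τ k i j =
      (chr F (-k) (w.left (w.right i)) * chr F k (w.left (w.right j))) •
        (reflSum (F := F) τ k (w.right i) (w.right j) * τ w) := by
  unfold reflSum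
  rw [Finset.mul_sum, Finset.sum_mul, Finset.smul_sum]
  refine Fintype.sum_equiv (Equiv.mulLeft (w.left (w.right i) * (w.left (w.right j))⁻¹)) _ _
    fun u => ?_
  rw [mul_smul_comm, ← map_mul, mul_reflAt, map_mul, smul_mul_assoc, smul_smul, Equiv.coe_mulLeft]
  congr 1
  · have h1 := chr_mul_neg F k (w.left (w.right i))
    have h2 := chr_mul_neg F k (w.left (w.right j))
    simp only [map_mul, chr_inv]
    linear_combination (-chr F k u * chr F k (w.left (w.right j)) * chr F (-k) (w.left (w.right j))) * h1
      - chr F k u * h2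
  · rw [mul_right_comm]

theorem map_mul_dSum (w : W r n) (i : Fin n) : τ w * dSum p τ i = dSum p τ (w.right i) * τ w := by
  unfold dSum
  simp only [Finset.mul_sum, Finset.sum_mul, mul_smul_comm, smul_mul_assoc, ← map_mul,
    mul_diag_single]

/-- Equivariance of the commutators: `y_i` and `x_j` transform by inverse scalars, so nothing but
the permutation remains when `i = j`. -/
theorem map_mul_bracket (w : W r n) (i j : Fin n) :
    τ w * bracket p τ i j =
      (chr F 1 (w.left (w.right i)) * chr F (-1) (w.left (w.right j))) •
        (bracket p τ (w.right i) (w.right j) * τ w) := by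
  unfold bracket
  by_cases h : i = j
  · subst h
    rw [chr_mul_neg, one_smul, if_pos rfl, if_pos rfl]
    rw [mul_sub, mul_sub, sub_mul, sub_mul, map_mul_dSum, Algebra.commutes, mul_smul_comm,
      smul_mul_assoc, Finset.mul_sum, Finset.sum_mul]
    congr 2
    refine Finset.sum_equiv w.right (by simp) fun k _ => ?_
    rw [map_mul_reflSum]
    simp
  · rw [if_neg h, if_neg (by simpa using h), mul_smul_comm, map_mul_reflSum]
    simp [smul_smul, mul_comm]

/-! ### A Jacobi identity for the commutators. -/

section Jacobi

variable {y : Fin n → A} (hy : ∀ w j, τ w * y j = chr F 1 (w.left (w.right j)) • (y (w.right j) * τ w))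
include hy

theorem reflSum_mul_of_ne {i j k : Fin n} (hi : k ≠ i) (hj : k ≠ j) (l : ZMod r) :
    reflSum (F := F) τ l i j * y k = y k * reflSum (F := F) τ l i j := by
  unfold reflSum
  rw [Finset.sum_mul, Finset.mul_sum]
  refine Finset.sum_congr rfl fun u _ => ?_
  rw [smul_mul_assoc, hy, mul_smul_comm, reflAt_right, Equiv.swap_apply_of_ne_of_ne hi hj]
  simp [hi, hj]

/-- The reflection with parameter `u` sends `y_j` to `u y_i`, and the extra factor `u` raises the
character by one. -/
theorem reflSum_mul_right {i j : Fin n} (h : i ≠ j) (l : ZMod r) :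
    reflSum (F := F) τ l i j * y j = y i * reflSum (F := F) τ (l + 1) i j := by
  unfold reflSum
  rw [Finset.sum_mul, Finset.mul_sum]
  refine Finset.sum_congr rfl fun u _ => ?_
  rw [smul_mul_assoc, hy, mul_smul_comm, reflAt_right, Equiv.swap_apply_right, smul_smul, chr_add]
  simp [h]

theorem dSum_mul_of_ne {i j : Fin n} (h : i ≠ j) : dSum p τ i * y j = y j * dSum p τ i := by
  unfold dSum
  rw [Finset.sum_mul, Finset.mul_sum]
  refine Finset.sum_congr rfl fun k _ => ?_
  rw [smul_mul_assoc, mul_smul_comm, smul_mul_assoc, mul_smul_comm, Finset.sum_mul, Finset.mul_sum]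
  congr 2
  refine Finset.sum_congr rfl fun u _ => ?_
  rw [smul_mul_assoc, hy, mul_smul_comm]
  simp [h.symm]

/-- In the commutator of `y_i` and `x_i`, only the reflections interchanging `i` and `j` fail to
commute with `y_j`. Both sides reduce to `c₀` times the same difference of two terms, one with `y_i`
and one with `y_j` on the left. -/
theorem bracket_jacobi_of_eq {i j : Fin n} (h : i ≠ j) :
    bracket p τ i i * y j - y j * bracket p τ i i = bracket p τ j i * y i - y i * bracket p τ j i := by
  unfold bracket
  rw [if_pos rfl, if_neg h.symm]
  have e1 : (∑ k ∈ Finset.univ.filter (fun k : Fin n => k ≠ i), reflSum (F := F) τ 0 i k) =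
      reflSum (F := F) τ 0 i j +
        ∑ k ∈ (Finset.univ.filter (fun k : Fin n => k ≠ i)).erase j, reflSum (F := F) τ 0 i k := by
    rw [Finset.add_sum_erase _ _ (by simp [h.symm])]
  have e2 : (∑ k ∈ (Finset.univ.filter (fun k : Fin n => k ≠ i)).erase j,
        reflSum (F := F) τ 0 i k) * y j =
      y j * ∑ k ∈ (Finset.univ.filter (fun k : Fin n => k ≠ i)).erase j, reflSum (F := F) τ 0 i k := by
    rw [Finset.sum_mul, Finset.mul_sum]
    refine Finset.sum_congr rfl fun k hk => ?_
    simp only [Finset.mem_erase, Finset.mem_filter, Finset.mem_univ, true_and] at hk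
    exact reflSum_mul_of_ne hy h.symm hk.1.symm 0
  have e3 := reflSum_mul_right hy h 0
  have e4 := reflSum_mul_right hy h.symm (-1)
  have e5 := dSum_mul_of_ne (p := p) hy h
  have e6 : reflSum (F := F) τ (-1) j i = reflSum (F := F) τ 1 i j := by
    rw [reflSum_comm]; simp
  have e7 : reflSum (F := F) τ (-1 + 1) j i = reflSum (F := F) τ 0 i j := by
    rw [reflSum_comm]; simp
  rw [e7] at e4
  rw [zero_add] at e3
  rw [e1]
  simp only [sub_mul, mul_sub, smul_mul_assoc, mul_smul_comm, add_mul, mul_add, e2, e3, e5, e6,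
    smul_add, ← Algebra.commutes p.κ (y j)]
  rw [← e6, e4]
  abel

/-- This is what the Jacobi identity for `y_i`, `y_j`, `x_k` says once the `y` commute. Only the
equivariance of the `y` is assumed, because the identity is used to prove that the Dunkl operators
commute. -/
theorem bracket_jacobi (i j k : Fin n) :
    bracket p τ i k * y j - y j * bracket p τ i k = bracket p τ j k * y i - y i * bracket p τ j k := by
  by_cases hij : i = j
  · subst hij; rfl
  by_cases hik : i = k
  · subst hik; exact bracket_jacobi_of_eq hy hij
  by_cases hjk : j = k
  · subst hjk; exact (bracket_jacobi_of_eq hy (Ne.symm hij)).symm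
  · unfold bracket
    rw [if_neg hik, if_neg hjk, smul_mul_assoc, mul_smul_comm, smul_mul_assoc, mul_smul_comm,
      reflSum_mul_of_ne hy (Ne.symm hij) hjk, reflSum_mul_of_ne hy hij hik]
    simp

end Jacobi

end Bracket

end

noncomputable section

/-! ### Presentation of the Cherednik algebra by commutators -/

section Presentation

variable {r n : ℕ} [NeZero r] {F : Type} [Field F] [Algebra ℂ F] {p : Params r F}

theorem sum_range_zmod {A : Type*} [AddCommMonoid A] (f : ZMod r → A) :
    ∑ j ∈ Finset.range r, f (j : ZMod r) = ∑ k, f k := by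
  refine Finset.sum_bij (fun l _ => (l : ZMod r)) (by simp) ?_ ?_ (by simp)
  · intro a ha b hb h
    have := congrArg ZMod.val h
    rwa [ZMod.val_natCast, ZMod.val_natCast, Nat.mod_eq_of_lt (Finset.mem_range.1 ha),
      Nat.mod_eq_of_lt (Finset.mem_range.1 hb)] at this
  · intro k _
    exact ⟨k.val, Finset.mem_range.2 (ZMod.val_lt k), by simp⟩

theorem chr_neg_natCast_zetaRoot_pow (j l : ℕ) :
    chr F (-(j : ZMod r)) (zetaRoot r ^ l) = algebraMap ℂ F ((zeta r)⁻¹ ^ (l * j)) := by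
  rw [chr_neg, chr_natCast, map_pow, emb_zetaRoot, map_pow, map_inv₀, pow_mul, inv_pow, inv_pow]

section Hom

variable {A : Type*} [Ring A] [Algebra F A] {τ : W r n →* A}
  {φ : FreeAlgebra F (Gen r n) →ₐ[F] A} (hφ : ∀ w, φ (gen r F (Gen.t w)) = τ w)
include hφ

/-- Stated for an arbitrary homomorphism out of the free algebra, so that one computation serves
both the quotient map, in `Y_mul_X`, and the check of the relations in `RCA.lift`. -/
theorem map_relation_ne {i j : Fin n} (h : i ≠ j) :
    φ (p.c₀ • ∑ l ∈ Finset.range r,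
      algebraMap ℂ F ((zeta r)⁻¹ ^ l) • gen r F (Gen.t (refl r i j l))) = bracket p τ i j := by
  rw [bracket, if_neg h, map_smul, map_sum, reflSum, ← sum_range_zetaRoot]
  congr 1
  refine Finset.sum_congr rfl fun l _ => ?_
  have := chr_neg_natCast_zetaRoot_pow (F := F) (r := r) 1 l
  rw [Nat.cast_one, mul_one] at this
  rw [map_smul, hφ, refl_eq h, this]

theorem map_relation_self (i : Fin n) :
    φ (gen r F (Gen.x i) * gen r F (Gen.y i) + algebraMap F _ p.κ
          - ∑ j ∈ Finset.range r,
              (p.d (j : ZMod r) - p.d ((j : ZMod r) - 1)) • idem r F i j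
          - p.c₀ • ∑ j ∈ Finset.univ.filter (fun j : Fin n => j ≠ i),
              ∑ l ∈ Finset.range r, gen r F (Gen.t (refl r i j l))) =
      φ (gen r F (Gen.x i)) * φ (gen r F (Gen.y i)) + bracket p τ i i := by
  have h1 : φ (∑ j ∈ Finset.range r,
      (p.d (j : ZMod r) - p.d ((j : ZMod r) - 1)) • idem r F i j) = dSum p τ i := by
    rw [dSum, ← sum_range_zmod (fun k : ZMod r => (p.d k - p.d (k - 1)) •
      ((r : F)⁻¹ • ∑ u, chr F (-k) u • τ (diag (Pi.mulSingle i u)))), map_sum]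
    refine Finset.sum_congr rfl fun j _ => ?_
    rw [map_smul, idem, map_smul, map_sum, ← sum_range_zetaRoot]
    congr 2
    refine Finset.sum_congr rfl fun l _ => ?_
    rw [map_smul, hφ, zetaElt_pow, chr_neg_natCast_zetaRoot_pow]
  have h2 : φ (∑ j ∈ Finset.univ.filter (fun j : Fin n => j ≠ i),
      ∑ l ∈ Finset.range r, gen r F (Gen.t (refl r i j l))) =
      ∑ k ∈ Finset.univ.filter (fun k : Fin n => k ≠ i), reflSum (F := F) τ 0 i k := by
    rw [map_sum]
    refine Finset.sum_congr rfl fun j hj => ?_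
    have hj' : i ≠ j := by simpa [eq_comm] using hj
    rw [map_sum, reflSum, ← sum_range_zetaRoot]
    refine Finset.sum_congr rfl fun l _ => ?_
    rw [hφ, refl_eq hj', chr_zero, one_smul]
  rw [bracket, if_pos rfl, map_sub, map_sub, map_add, map_mul, map_smul, h1, h2, AlgHom.commutes]
  abel

end Hom

theorem RCA.mk_rel {a b : FreeAlgebra F (Gen r n)} (h : Rel n p a b) :
    RCA.mk n p a = RCA.mk n p b :=
  RingQuot.mkAlgHom_rel F h

theorem RCA.mk_surjective : Function.Surjective (RCA.mk n p) :=
  RingQuot.mkAlgHom_surjective F (Rel n p)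

theorem algebraMap_entry (w : W r n) (j : Fin n) :
    algebraMap ℂ F (entry w j) = chr F 1 (w.left (w.right j)) := by
  rw [chr_one]; rfl

variable (p) in
/-- The homomorphism from `G(r,1,n)` to the Cherednik algebra. -/
def tHom : W r n →* RCA n p where
  toFun := t p
  map_one' := by
    have := RCA.mk_rel (Rel.t_one (n := n) (p := p))
    rwa [map_one] at this
  map_mul' v w := by
    have := RCA.mk_rel (Rel.t_mul (p := p) v w)
    rw [map_mul] at this
    exact this.symm

variable (p)

theorem tHom_apply (w : W r n) : tHom p w = t p w := rfl

theorem t_one : t p (1 : W r n) = 1 := map_one (tHom p)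

theorem t_mul (v w : W r n) : t p (v * w) = t p v * t p w := map_mul (tHom p) v w

theorem X_mul_X (i j : Fin n) : X p i * X p j = X p j * X p i := by
  have := RCA.mk_rel (Rel.x_comm (p := p) i j)
  rwa [map_mul, map_mul] at this

theorem Y_mul_Y (i j : Fin n) : Y p i * Y p j = Y p j * Y p i := by
  have := RCA.mk_rel (Rel.y_comm (p := p) i j)
  rwa [map_mul, map_mul] at this

theorem t_mul_X (w : W r n) (j : Fin n) :
    t p w * X p j = chr F (-1) (w.left (w.right j)) • (X p (w.right j) * t p w) := by
  have := RCA.mk_rel (Rel.t_x (p := p) w j)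
  rwa [map_mul, map_smul, map_mul, map_inv₀, algebraMap_entry, ← chr_neg] at this

theorem t_mul_Y (w : W r n) (j : Fin n) :
    t p w * Y p j = chr F 1 (w.left (w.right j)) • (Y p (w.right j) * t p w) := by
  have := RCA.mk_rel (Rel.t_y (p := p) w j)
  rwa [map_mul, map_smul, map_mul, algebraMap_entry] at this

theorem Y_mul_X (i j : Fin n) : Y p i * X p j = X p j * Y p i + bracket p (tHom p) i j := by
  by_cases h : i = j
  · subst h
    have := RCA.mk_rel (Rel.y_x_self (p := p) i)
    rwa [map_mul, map_relation_self (τ := tHom p) (φ := RCA.mk n p)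
      (fun _ => rfl)] at this
  · have := RCA.mk_rel (Rel.y_x_ne (p := p) i j h)
    rwa [map_mul, map_add, map_relation_ne (τ := tHom p) (φ := RCA.mk n p)
      (fun _ => rfl) h, map_mul] at this

variable {p}

section Lift

variable {A : Type*} [Ring A] [Algebra F A] (x y : Fin n → A) (τ : W r n →* A)

/-- The map on generators given by the `x_i`, `y_i` and `t_w`. -/
def genMap : Gen r n → A
  | Gen.x i => x i
  | Gen.y i => y i
  | Gen.t w => τ w

variable (hx : ∀ i j, x i * x j = x j * x i) (hy : ∀ i j, y i * y j = y j * y i)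
  (htx : ∀ w j, τ w * x j = chr F (-1) (w.left (w.right j)) • (x (w.right j) * τ w))
  (hty : ∀ w j, τ w * y j = chr F 1 (w.left (w.right j)) • (y (w.right j) * τ w))
  (hyx : ∀ i j, y i * x j = x j * y i + bracket p τ i j)

/-- The universal property of the Cherednik algebra. -/
def RCA.lift : RCA n p →ₐ[F] A :=
  RingQuot.liftAlgHom F ⟨FreeAlgebra.lift F (genMap x y τ), by
    intro a b h
    have ht : ∀ w, FreeAlgebra.lift F (genMap x y τ) (gen r F (Gen.t w)) = τ w := fun w => by
      simp [genMap]
    induction h with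
    | x_comm i j => simpa [genMap] using hx i j
    | y_comm i j => simpa [genMap] using hy i j
    | t_one => simp [genMap]
    | t_mul v w => simp [genMap]
    | t_x w j =>
      have := htx w j
      rw [chr_neg, ← algebraMap_entry, ← map_inv₀] at this
      simpa [genMap] using this
    | t_y w j =>
      have := hty w j
      rw [← algebraMap_entry] at this
      rw [map_mul, map_smul, map_mul]
      simpa [genMap] using this
    | y_x_ne i j hij =>
      rw [map_add, map_relation_ne ht hij]
      simpa [genMap] using hyx i j
    | y_x_self i =>
      rw [map_relation_self ht]
      simpa [genMap] using hyx i i⟩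

theorem RCA.lift_X (i : Fin n) : RCA.lift x y τ hx hy htx hty hyx (X p i) = x i := by
  refine (RingQuot.liftAlgHom_mkAlgHom_apply F _ _ _).trans ?_
  simp [genMap]

theorem RCA.lift_Y (i : Fin n) : RCA.lift x y τ hx hy htx hty hyx (Y p i) = y i := by
  refine (RingQuot.liftAlgHom_mkAlgHom_apply F _ _ _).trans ?_
  simp [genMap]

theorem RCA.lift_t (w : W r n) : RCA.lift x y τ hx hy htx hty hyx (t p w) = τ w := by
  refine (RingQuot.liftAlgHom_mkAlgHom_apply F _ _ _).trans ?_
  simp [genMap]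

end Lift

/-- Induction principle for the Cherednik algebra. -/
theorem RCA.adjoin_eq_top : Algebra.adjoin F
    (Set.range (X p) ∪ Set.range (Y p) ∪ Set.range (t p) : Set (RCA n p)) = ⊤ := by
  have h := FreeAlgebra.adjoin_range_ι (R := F) (X := Gen r n)
  have h1 := congrArg (Subalgebra.map (RCA.mk n p)) h
  rw [AlgHom.map_adjoin, Algebra.map_top, (AlgHom.range_eq_top _).2
    RCA.mk_surjective] at h1
  rw [← top_le_iff, ← h1]
  apply Algebra.adjoin_mono
  rintro _ ⟨_, ⟨g, rfl⟩, rfl⟩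
  cases g with
  | x i => exact Or.inl (Or.inl ⟨i, rfl⟩)
  | y i => exact Or.inl (Or.inr ⟨i, rfl⟩)
  | t w => exact Or.inr ⟨w, rfl⟩

end Presentation

/-! ### The Coxeter presentation of the symmetric group -/

section Coxeter

variable {M : Type*} [Monoid M] (g : ℕ → M)

/-- The product `g_m g_{m-1} ⋯ g_{m-l+1}` of `l` factors, starting with `g_{m-1}`. -/
def descProd (m : ℕ) : ℕ → M
  | 0 => 1
  | l + 1 => descProd m l * g (m - 1 - l)

/-- The submonoid generated by `g_0, …, g_{m-1}`. -/
def initSubmonoid (m : ℕ) : Submonoid M := Submonoid.closure (g '' Set.Iio m)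

variable {g} {N : ℕ} (hsq : ∀ i, i < N → g i * g i = 1)
  (hbraid : ∀ i, i + 1 < N → g i * g (i + 1) * g i = g (i + 1) * g i * g (i + 1))
  (hcomm : ∀ i j, i + 1 < j → j < N → g i * g j = g j * g i)

include hcomm in
-- The factors have indices at least `m - l`, all larger than `i + 1`, so each of them commutes with
-- `g i`.
theorem descProd_mul_comm {m : ℕ} (hm : m < N + 1) {i l : ℕ} (hl : l ≤ m) (hi : i + 1 < m - l) :
    descProd g m l * g i = g i * descProd g m l := by
  induction l with
  | zero => simp [descProd]
  | succ l ih =>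
    rw [descProd, mul_assoc, ← hcomm i (m - 1 - l) (by omega) (by omega), ← mul_assoc,
      ih (by omega) (by omega), mul_assoc]

include hsq hbraid hcomm in
-- Here the run contains both `g i` and `g (i - 1)`: the new factor passes the smaller indices,
-- takes part in one braid relation, and leaves on the left with its index lowered by one.
theorem descProd_mul_braid {m : ℕ} (hm : m < N + 1) {i l : ℕ} (hl : l ≤ m)
    (hi : m - l < i) (him : i < m) :
    descProd g m l * g i = g (i - 1) * descProd g m l := by
  induction l with
  | zero => omega
  | succ l ih =>
    by_cases h : i = m - l
    · obtain ⟨l, rfl⟩ : ∃ l', l = l' + 1 := ⟨l - 1, by omega⟩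
      have e1 : m - 1 - l = i := by omega
      obtain ⟨k, rfl⟩ : ∃ k, i = k + 1 := ⟨i - 1, by omega⟩
      have e2 : m - 1 - (l + 1) = k := by omega
      rw [descProd, descProd, e1, e2, mul_assoc, mul_assoc, ← mul_assoc (g (k + 1)),
        ← hbraid k (by omega), ← mul_assoc, ← mul_assoc,
        descProd_mul_comm hcomm hm (by omega) (by omega), Nat.add_sub_cancel]
      simp only [mul_assoc]
    · rw [descProd, mul_assoc, hcomm (m - 1 - l) i (by omega) (by omega), ← mul_assoc,
        ih (by omega) (by omega), mul_assoc]

include hsq hbraid hcomm in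
-- Normal form for words: the runs play the role of coset representatives of one symmetric group in
-- the next. Multiplying a run on the right by `g i` either commutes past it, lengthens it, cancels
-- its last factor, or braids through it, according to the position of `i` relative to the end of
-- the run.
theorem exists_mul_descProd {m : ℕ} (hm : m < N) {x : M} (hx : x ∈ initSubmonoid g (m + 1)) :
    ∃ a ∈ initSubmonoid g m, ∃ l ≤ m + 1, x = a * descProd g (m + 1) l := by
  induction hx using Submonoid.closure_induction_right with
  | one => exact ⟨1, one_mem _, 0, by omega, by simp [descProd]⟩
  | mul_right x hx y hy ih =>
    obtain ⟨a, ha, l, hl, rfl⟩ := ih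
    obtain ⟨i, hi, rfl⟩ := hy
    have hi' : i < m + 1 := hi
    have hgen : ∀ k, k < m → g k ∈ initSubmonoid g m := fun k hk =>
      Submonoid.subset_closure ⟨k, hk, rfl⟩
    rcases lt_trichotomy (i + l) m with h | h | h
    · exact ⟨a * g i, mul_mem ha (hgen i (by omega)), l, hl, by
        rw [mul_assoc, descProd_mul_comm hcomm (by omega) hl (by omega), mul_assoc]⟩
    · refine ⟨a, ha, l + 1, by omega, ?_⟩
      rw [descProd, mul_assoc]
      congr 3
      omega
    · by_cases h2 : i + l = m + 1
      · obtain ⟨l, rfl⟩ : ∃ l', l = l' + 1 := ⟨l - 1, by omega⟩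
        refine ⟨a, ha, l, by omega, ?_⟩
        have : m + 1 - 1 - l = i := by omega
        rw [descProd, this, mul_assoc, mul_assoc, hsq i (by omega), mul_one]
      · exact ⟨a * g (i - 1), mul_mem ha (hgen _ (by omega)), l, hl, by
          rw [mul_assoc, descProd_mul_braid hsq hbraid hcomm (by omega) hl (by omega) hi', mul_assoc]⟩

end Coxeter

section CoxeterPerm

variable {n : ℕ}

/-- The transposition of `i` and `i + 1`, or `1` if `i + 1` is out of range. -/
def adjSwap (n i : ℕ) : Equiv.Perm (Fin n) :=
  if h : i + 1 < n then Equiv.swap ⟨i, by omega⟩ ⟨i + 1, h⟩ else 1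

theorem adjSwap_apply_of_ne {i : ℕ} {k : Fin n} (h : (k : ℕ) ≠ i) (h' : (k : ℕ) ≠ i + 1) :
    adjSwap n i k = k := by
  unfold adjSwap
  split_ifs with hi
  · exact Equiv.swap_apply_of_ne_of_ne (by simpa [Fin.ext_iff] using h)
      (by simpa [Fin.ext_iff] using h')
  · rfl

theorem adjSwap_mul_self (i : ℕ) : adjSwap n i * adjSwap n i = 1 := by
  unfold adjSwap
  split_ifs <;> simp

theorem swap_braid {α : Type*} [DecidableEq α] {a b c : α} (hab : a ≠ b) (hac : a ≠ c)
    (hbc : b ≠ c) :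
    Equiv.swap a b * Equiv.swap b c * Equiv.swap a b =
      Equiv.swap b c * Equiv.swap a b * Equiv.swap b c := by
  rw [Equiv.swap_mul_swap_mul_swap hab hac, Equiv.swap_comm a b, Equiv.swap_comm b c,
    Equiv.swap_mul_swap_mul_swap hbc.symm hac.symm, Equiv.swap_comm]

theorem adjSwap_braid {i : ℕ} (h : i + 2 < n) :
    adjSwap n i * adjSwap n (i + 1) * adjSwap n i =
      adjSwap n (i + 1) * adjSwap n i * adjSwap n (i + 1) := by
  unfold adjSwap
  rw [dif_pos (by omega), dif_pos (by omega)]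
  have h1 : (⟨i, by omega⟩ : Fin n) ≠ ⟨i + 1, by omega⟩ := by simp
  have h2 : (⟨i, by omega⟩ : Fin n) ≠ ⟨i + 1 + 1, by omega⟩ := by simp [Fin.ext_iff]; omega
  have h3 : (⟨i + 1, by omega⟩ : Fin n) ≠ ⟨i + 1 + 1, by omega⟩ := by simp
  exact swap_braid h1 h2 h3

theorem adjSwap_comm {i j : ℕ} (h : i + 1 < j) :
    adjSwap n i * adjSwap n j = adjSwap n j * adjSwap n i := by
  unfold adjSwap
  split_ifs
  · apply Equiv.Perm.Disjoint.commute
    intro k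
    by_cases hk : (k : ℕ) = i ∨ (k : ℕ) = i + 1
    · right
      apply Equiv.swap_apply_of_ne_of_ne <;> simp [Fin.ext_iff] <;> omega
    · left
      apply Equiv.swap_apply_of_ne_of_ne <;> simp [Fin.ext_iff] <;> omega
  all_goals simp

variable {G : Type*} [Group G] {g : ℕ → G} (hsq : ∀ i, i + 1 < n → g i * g i = 1)
  (hbraid : ∀ i, i + 2 < n → g i * g (i + 1) * g i = g (i + 1) * g i * g (i + 1))
  (hcomm : ∀ i j, i + 1 < j → j + 1 < n → g i * g j = g j * g i)

include hsq hbraid hcomm in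
-- In the normal form the permutation of the first factor fixes `m + 1`, while the run sends `m + 1
-- - l` to `m + 1`. A trivial permutation therefore forces `l = 0`, and induction applies to the
-- first factor.
theorem eq_one_of_mem_initSubmonoid {m : ℕ} (hm : m + 1 ≤ n) {x : G × Equiv.Perm (Fin n)}
    (hx : x ∈ initSubmonoid (fun i => (g i, adjSwap n i)) m) (h1 : x.2 = 1) : x.1 = 1 := by
  induction m generalizing x with
  | zero =>
    have : x = 1 := by simpa [initSubmonoid] using hx
    simp [this]
  | succ m ih =>
    set q : ℕ → G × Equiv.Perm (Fin n) := fun i => (g i, adjSwap n i) with hq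
    obtain ⟨a, ha, l, hl, rfl⟩ := exists_mul_descProd (g := q) (N := n - 1)
      (fun i hi => by simp [hq, hsq i (by omega), adjSwap_mul_self])
      (fun i hi => by simp [hq, hbraid i (by omega), adjSwap_braid (show i + 2 < n by omega)])
      (fun i j hij hj => by simp [hq, hcomm i j hij (by omega), adjSwap_comm hij])
      (m := m) (by omega) hx
    have hfix : ∀ b ∈ initSubmonoid q m, b.2 ⟨m + 1, by omega⟩ = ⟨m + 1, by omega⟩ := by
      intro b hb
      induction hb using Submonoid.closure_induction with
      | mem b hb =>
        obtain ⟨i, hi, rfl⟩ := hb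
        have hi' : i < m := hi
        apply adjSwap_apply_of_ne <;> simp <;> omega
      | one => simp
      | mul b c _ _ hb hc => simp [hb, hc]
    have hdesc : ∀ l (hl : l ≤ m + 1), (descProd q (m + 1) l).2 ⟨m + 1 - l, by omega⟩ =
        ⟨m + 1, by omega⟩ := by
      intro l hl
      induction l with
      | zero => simp [descProd]
      | succ l ih =>
        have e : adjSwap n (m - l) ⟨m - l, by omega⟩ = (⟨m + 1 - l, by omega⟩ : Fin n) := by
          unfold adjSwap
          rw [dif_pos (by omega), Equiv.swap_apply_left]
          simp [Fin.ext_iff]; omega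
        have e2 : m + 1 - 1 - l = m - l := by omega
        have e3 : (⟨m + 1 - (l + 1), by omega⟩ : Fin n) = ⟨m - l, by omega⟩ := by
          simp
        rw [descProd, e2, e3, Prod.snd_mul, Equiv.Perm.mul_apply]
        simp only [hq] at e ⊢
        rw [e]
        exact ih (by omega)
    have h2 : (a.2 * (descProd q (m + 1) l).2) ⟨m + 1 - l, by omega⟩ = ⟨m + 1, by omega⟩ := by
      rw [Equiv.Perm.mul_apply, hdesc l hl, hfix a ha]
    rw [← Prod.snd_mul, h1] at h2
    have hl0 : l = 0 := by
      simp [Fin.ext_iff] at h2; omega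
    subst hl0
    simp only [descProd, mul_one] at h1 ⊢
    exact ih (by omega) ha h1

include hsq hbraid hcomm in
/-- A family of group elements which satisfies the Coxeter relations of type `A` defines a
homomorphism from the symmetric group. -/
theorem exists_permHom : ∃ f : Equiv.Perm (Fin n) →* G, ∀ i, i + 1 < n → f (adjSwap n i) = g i := by
  rcases Nat.eq_zero_or_pos n with rfl | hn
  · exact ⟨1, fun i hi => by omega⟩
  set q : ℕ → G × Equiv.Perm (Fin n) := fun i => (g i, adjSwap n i) with hq
  set H := initSubmonoid q (n - 1) with hH
  have hinv : ∀ x ∈ H, x⁻¹ ∈ H := by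
    intro x hx
    induction hx using Submonoid.closure_induction with
    | mem x hx =>
      obtain ⟨i, hi, rfl⟩ := hx
      have hi' : i < n - 1 := hi
      have : (q i)⁻¹ = q i := by
        rw [inv_eq_iff_mul_eq_one]
        simp [hq, hsq i (by omega), adjSwap_mul_self]
      rw [this]
      exact Submonoid.subset_closure ⟨i, hi, rfl⟩
    | one => simp
    | mul x y _ _ hx hy => rw [mul_inv_rev]; exact mul_mem hy hx
  -- The homomorphism is obtained as a graph: `K` is generated by the pairs `(g i, s_i)`, and its
  -- projection to the symmetric group is bijective.
  let K : Subgroup (G × Equiv.Perm (Fin n)) := { H with inv_mem' := fun {x} hx => hinv x hx }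
  let π : K →* Equiv.Perm (Fin n) := (MonoidHom.snd G _).comp K.subtype
  have hinj : Function.Injective π := by
    rw [injective_iff_map_eq_one]
    intro x hx
    have h2 : x.1.2 = 1 := hx
    have h1 : x.1.1 = 1 :=
      eq_one_of_mem_initSubmonoid hsq hbraid hcomm (m := n - 1) (by omega) x.2 h2
    exact Subtype.ext (Prod.ext h1 h2)
  have hmem : ∀ i, i + 1 < n → q i ∈ K := fun i hi =>
    Submonoid.subset_closure ⟨i, by simp; omega, rfl⟩
  have hsurj : Function.Surjective π := by
    rw [← MonoidHom.mrange_eq_top, ← top_le_iff]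
    obtain ⟨k, rfl⟩ : ∃ k, n = k + 1 := ⟨n - 1, by omega⟩
    rw [← Equiv.Perm.mclosure_swap_castSucc_succ k, Submonoid.closure_le]
    rintro _ ⟨i, rfl⟩
    refine ⟨⟨q i, hmem i (by omega)⟩, ?_⟩
    change adjSwap (k + 1) i = _
    rw [adjSwap, dif_pos (by omega)]
    rfl
  let e := MulEquiv.ofBijective π ⟨hinj, hsurj⟩
  refine ⟨((MonoidHom.fst G _).comp K.subtype).comp e.symm.toMonoidHom, fun i hi => ?_⟩
  have : e.symm (adjSwap n i) = ⟨q i, hmem i hi⟩ := by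
    rw [MulEquiv.symm_apply_eq]; rfl
  simp [this, hq]

end CoxeterPerm

end

noncomputable section

/-! ### Standard tableaux -/

section Tableaux

variable {r n : ℕ} [NeZero r] {lam : RPartition r n}

theorem Box.ext' {b c : Box lam} (h : b.β = c.β) (h1 : b.row = c.row) (h2 : b.col = c.col) :
    b = c :=
  Subtype.ext (Prod.ext h (Prod.ext h1 h2))

theorem Box.exists_of_le (b : Box lam) {i j : ℕ} (hi : i ≤ b.row) (hj : j ≤ b.col) :
    ∃ c : Box lam, c.β = b.β ∧ c.row = i ∧ c.col = j :=
  ⟨⟨(b.β, i, j), YoungDiagram.up_left_mem _ hi hj b.2⟩, rfl, rfl, rfl⟩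

/-- The box in the row of `T i` and the column of `T j` belongs to the diagram, and one passes from
one entry to the other through it. -/
theorem IsStandard.lt_of_le {T : Fin n ≃ Box lam} (hT : IsStandard T) {i j : Fin n} (hne : i ≠ j)
    (hβ : (T i).β = (T j).β) (hr : (T i).row ≤ (T j).row) (hc : (T i).col ≤ (T j).col) : i < j := by
  obtain ⟨c, h1, h2, h3⟩ := (T j).exists_of_le hr le_rfl
  obtain ⟨m, rfl⟩ := T.surjective c
  have him : i ≤ m := by
    rcases hc.lt_or_eq with h | h
    · exact ((hT i m (hβ.trans h1.symm)).1 h2.symm (by omega)).le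
    · exact (T.injective (Box.ext' (hβ.trans h1.symm) h2.symm (by omega))).le
  have hmj : m ≤ j := by
    rcases hr.lt_or_eq with h | h
    · exact ((hT m j h1).2 h3 (by omega)).le
    · exact (T.injective (Box.ext' h1 (by omega) h3)).le
  exact lt_of_le_of_ne (him.trans hmj) hne

/-- Two boxes of one diagonal span a square. Its two other corners lie in the diagram and carry two
different entries strictly between `i` and `j`. -/
theorem IsStandard.add_two_lt {T : Fin n ≃ Box lam} (hT : IsStandard T) {i j : Fin n}
    (hβ : (T i).β = (T j).β) (hct : (T i).ct = (T j).ct) (hr : (T i).row < (T j).row) :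
    (i : ℕ) + 2 < j := by
  unfold Box.ct at hct
  obtain ⟨c, h1, h2, h3⟩ := (T j).exists_of_le hr.le le_rfl
  obtain ⟨m, rfl⟩ := T.surjective c
  obtain ⟨c, h1', h2', h3'⟩ := (T j).exists_of_le le_rfl (show (T i).col ≤ (T j).col by omega)
  obtain ⟨m', rfl⟩ := T.surjective c
  have a1 := (hT i m (hβ.trans h1.symm)).1 h2.symm (by omega)
  have a2 := (hT m j h1).2 h3 (by omega)
  have a3 := (hT i m' (hβ.trans h1'.symm)).2 h3'.symm (by omega)
  have a4 := (hT m' j h1').1 h2' (by omega)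
  have : m ≠ m' := by
    rintro rfl
    omega
  have : (m : ℕ) ≠ m' := fun h => this (Fin.ext h)
  have := Fin.lt_def.1 a1
  have := Fin.lt_def.1 a2
  have := Fin.lt_def.1 a3
  have := Fin.lt_def.1 a4
  omega

/-- Distance at most two is exactly what the braid relation needs: it involves three consecutive
entries. -/
theorem IsStandard.ct_ne {T : Fin n ≃ Box lam} (hT : IsStandard T) {i j : Fin n} (hij : i < j)
    (hij' : (j : ℕ) ≤ i + 2) (hβ : (T i).β = (T j).β) : (T i).ct ≠ (T j).ct := by
  intro hct
  rcases lt_trichotomy (T i).row (T j).row with h | h | h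
  · have := hT.add_two_lt hβ hct h
    omega
  · have : (T i).col = (T j).col := by unfold Box.ct at hct; omega
    exact hij.ne (T.injective (Box.ext' hβ h this))
  · have := hT.add_two_lt hβ.symm hct.symm h
    have := Fin.lt_def.1 hij
    omega

theorem IsStandard.ct_zero {T : Fin n ≃ Box lam} (hT : IsStandard T) {i : Fin n} (hi : (i : ℕ) = 0) :
    (T i).ct = 0 := by
  obtain ⟨c, h1, h2, h3⟩ := (T i).exists_of_le (Nat.zero_le _) (Nat.zero_le _)
  obtain ⟨m, rfl⟩ := T.surjective c
  have : m = i := by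
    by_contra hne
    have := hT.lt_of_le hne h1 (by omega) (by omega)
    have := Fin.lt_def.1 this
    omega
  subst this
  simp [Box.ct, h2, h3]

/-- A standard tableau is determined by its sequence of contents. -/
theorem SYT.ext_content {T S : SYT lam} (h : ∀ i, (T.1 i).β = (S.1 i).β ∧ (T.1 i).ct = (S.1 i).ct) :
    T = S := by
  -- At the first disagreement, suppose that the box of `T` lies higher on the common diagonal. In
  -- `S` this box carries a smaller entry `m`, but `T` and `S` agree at `m`, so `T` would place both
  -- `m` and `i` there.
  have key : ∀ (T S : SYT lam) (i : Fin n), (∀ j < i, T.1 j = S.1 j) →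
      (T.1 i).β = (S.1 i).β → (T.1 i).ct = (S.1 i).ct → ¬ (T.1 i).row < (S.1 i).row := by
    intro T S i ih hβ hct hr
    unfold Box.ct at hct
    obtain ⟨m, hm⟩ := S.1.surjective (T.1 i)
    have h1 : m < i := S.2.lt_of_le (fun e => by subst e; rw [hm] at hr; omega)
      (by rw [hm]; exact hβ) (by rw [hm]; omega) (by rw [hm]; omega)
    have h2 := ih m h1
    rw [hm] at h2
    exact h1.ne (T.1.injective h2)
  apply Subtype.ext
  ext i
  induction i using WellFoundedLT.induction with
  | ind i ih =>
    obtain ⟨hβ, hct⟩ := h i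
    have h1 := key T S i ih hβ hct
    have h2 := key S T i (fun j hj => (ih j hj).symm) hβ.symm hct.symm
    have hr : (T.1 i).row = (S.1 i).row := by omega
    refine Box.ext' hβ hr ?_
    unfold Box.ct at hct
    omega

/-- An adjacent transposition reverses the order of a single pair. -/
theorem eq_of_swap_le {i j k l : Fin n} (hij : (i : ℕ) + 1 = j) (h : k < l)
    (h' : Equiv.swap i j l ≤ Equiv.swap i j k) : k = i ∧ l = j := by
  rw [Equiv.swap_apply_def, Equiv.swap_apply_def] at h'
  simp only [Fin.lt_def, Fin.ext_iff] at *
  split_ifs at h' <;> simp only [Fin.le_def] at h' <;> omega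

/-- The violated inequality must be the one between `i` and `i + 1`. These entries share a row or a
column, and a box between theirs would carry an entry strictly between consecutive integers; so the
boxes are neighbours. -/
theorem IsStandard.adjacent {T : Fin n ≃ Box lam} (hT : IsStandard T) {i j : Fin n}
    (hij : (i : ℕ) + 1 = j) (h : ¬ IsStandard ((Equiv.swap i j).trans T)) :
    (T i).β = (T j).β ∧ ((T j).ct - (T i).ct = 1 ∨ (T j).ct - (T i).ct = -1) := by
  unfold IsStandard at h
  push Not at h
  obtain ⟨k, l, hβ, h⟩ := h
  simp only [Equiv.trans_apply] at hβ h
  set k' := Equiv.swap i j k with hk'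
  set l' := Equiv.swap i j l with hl'
  have hkk : k = Equiv.swap i j k' := by simp [hk']
  have hll : l = Equiv.swap i j l' := by simp [hl']
  have hlt : k' < l' ∧ l ≤ k := by
    by_cases hrow : (T k').row = (T l').row ∧ (T k').col < (T l').col ∧ l ≤ k
    · exact ⟨(hT k' l' hβ).1 hrow.1 hrow.2.1, hrow.2.2⟩
    · obtain ⟨h1, h2, h3⟩ := h (by intro a b; by_contra hc; exact hrow ⟨a, b, not_lt.1 hc⟩)
      exact ⟨(hT k' l' hβ).2 h1 h2, h3⟩
  have hki : k' = i ∧ l' = j := eq_of_swap_le hij hlt.1 (by rw [← hkk, ← hll]; exact hlt.2)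
  rw [hki.1, hki.2] at h hβ
  refine ⟨hβ, ?_⟩
  have hbetween : ∀ m : Fin n, i < m → m < j → False := fun m h1 h2 => by
    have := Fin.lt_def.1 h1; have := Fin.lt_def.1 h2; omega
  by_cases hrow : (T i).row = (T j).row ∧ (T i).col < (T j).col
  · left
    obtain ⟨hr, hc⟩ := hrow
    have : (T j).col = (T i).col + 1 := by
      by_contra hne
      obtain ⟨c, h1, h2, h3⟩ := (T j).exists_of_le le_rfl (show (T i).col + 1 ≤ (T j).col by omega)
      obtain ⟨m, rfl⟩ := T.surjective c
      exact hbetween m ((hT i m (hβ.trans h1.symm)).1 (by omega) (by omega))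
        ((hT m j h1).1 h2 (by omega))
    unfold Box.ct; omega
  · right
    obtain ⟨hc, hr, -⟩ := h (by intro a b; exact absurd ⟨a, b⟩ hrow)
    have : (T j).row = (T i).row + 1 := by
      by_contra hne
      obtain ⟨c, h1, h2, h3⟩ := (T j).exists_of_le (show (T i).row + 1 ≤ (T j).row by omega) le_rfl
      obtain ⟨m, rfl⟩ := T.surjective c
      exact hbetween m ((hT i m (hβ.trans h1.symm)).2 (by omega) (by omega))
        ((hT m j h1).2 h3 (by omega))
    unfold Box.ct; omega

end Tableaux

/-! ### Young's orthonormal form -/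

section Young

variable {r n : ℕ} [NeZero r] {lam : RPartition r n}

/-- The diagonal coefficient of Young's orthonormal form, as a function of two boxes. -/
def dCoeff (b c : Box lam) : ℝ := if b.β = c.β then 1 / ((c.ct - b.ct : ℤ) : ℝ) else 0

/-- The off-diagonal coefficient of Young's orthonormal form, as a function of two boxes. -/
def eCoeff (b c : Box lam) : ℝ := if b.β = c.β then √(1 - dCoeff b c ^ 2) else 1

theorem dCoeff_swap (b c : Box lam) : dCoeff c b = -dCoeff b c := by
  unfold dCoeff
  by_cases h : b.β = c.β
  · rw [if_pos h, if_pos h.symm, ← neg_sub c.ct b.ct, Int.cast_neg, one_div, one_div, inv_neg]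
  · rw [if_neg h, if_neg (Ne.symm h), neg_zero]

theorem eCoeff_swap (b c : Box lam) : eCoeff c b = eCoeff b c := by
  unfold eCoeff
  rw [dCoeff_swap b c, neg_sq]
  simp only [eq_comm]

theorem dCoeff_sq_le (b c : Box lam) : dCoeff b c ^ 2 ≤ 1 := by
  unfold dCoeff
  split_ifs
  · by_cases h0 : c.ct - b.ct = 0
    · simp [h0]
    · have h1 : (1 : ℝ) ≤ ((c.ct - b.ct : ℤ) : ℝ) ^ 2 := by
        have : (1 : ℤ) ≤ (c.ct - b.ct) ^ 2 := by
          have := sq_pos_of_ne_zero h0 (R := ℤ)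
          omega
        exact_mod_cast this
      rw [div_pow, one_pow]
      exact (div_le_one (by linarith)).2 h1
  · norm_num

theorem eCoeff_mul_self (b c : Box lam) : eCoeff b c * eCoeff b c = 1 - dCoeff b c * dCoeff b c := by
  unfold eCoeff
  split_ifs with h
  · rw [Real.mul_self_sqrt (by linarith [dCoeff_sq_le b c]), sq]
  · simp [dCoeff, h]

/-- Partial fractions for the reciprocals of content differences. This scalar identity is the whole
content of the braid relation; if the boxes do not all lie in one component, both sides vanish. -/
theorem dCoeff_cocycle {a b c : Box lam} (hab : a.β = b.β → a.ct ≠ b.ct)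
    (hbc : b.β = c.β → b.ct ≠ c.ct) (hac : a.β = c.β → a.ct ≠ c.ct) :
    dCoeff a b * dCoeff b c = dCoeff a c * (dCoeff a b + dCoeff b c) := by
  unfold dCoeff
  by_cases h1 : a.β = b.β <;> by_cases h2 : b.β = c.β
  · have h3 := h1.trans h2
    rw [if_pos h1, if_pos h2, if_pos h3]
    have e1 : ((b.ct - a.ct : ℤ) : ℝ) ≠ 0 := by
      exact_mod_cast sub_ne_zero.2 (Ne.symm (hab h1))
    have e2 : ((c.ct - b.ct : ℤ) : ℝ) ≠ 0 := by
      exact_mod_cast sub_ne_zero.2 (Ne.symm (hbc h2))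
    have e3 : ((c.ct - a.ct : ℤ) : ℝ) ≠ 0 := by
      exact_mod_cast sub_ne_zero.2 (Ne.symm (hac h3))
    field_simp
    push_cast
    ring
  · have h3 : a.β ≠ c.β := fun h => h2 (h1.symm.trans h)
    simp [h2, h3]
  · have h3 : a.β ≠ c.β := fun h => h1 (h.trans h2.symm)
    simp [h1, h3]
  · simp [h1, h2]

/-- For neighbouring boxes the content difference is `±1`, so the square root vanishes. The term
that is omitted in Young's form thus has coefficient zero in any case. -/
theorem eCoeff_eq_zero {T : Fin n ≃ Box lam} (hT : IsStandard T) {i j : Fin n}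
    (hij : (i : ℕ) + 1 = j) (h : ¬ IsStandard ((Equiv.swap i j).trans T)) :
    eCoeff (T i) (T j) = 0 := by
  obtain ⟨h1, h2⟩ := hT.adjacent hij h
  unfold eCoeff dCoeff
  rw [if_pos h1, if_pos h1]
  rcases h2 with h2 | h2 <;> simp [h2]

variable (F : Type) [Field F] [Algebra ℂ F]

/-- Real numbers as elements of `F`. -/
def realHom : ℝ →+* F := (algebraMap ℂ F).comp Complex.ofRealHom

theorem realHom_apply (x : ℝ) : realHom F x = algebraMap ℂ F (x : ℂ) := rfl

/-- `dCoeff` in `F`. -/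
def dF (b c : Box lam) : F := realHom F (dCoeff b c)

/-- `eCoeff` in `F`. -/
def eF (b c : Box lam) : F := realHom F (eCoeff b c)

theorem dF_swap (b c : Box lam) : dF F c b = -dF F b c := by
  rw [dF, dCoeff_swap, map_neg, dF]

theorem eF_swap (b c : Box lam) : eF F c b = eF F b c := by
  rw [eF, eCoeff_swap, eF]

theorem eF_mul_self (b c : Box lam) : eF F b c * eF F b c = 1 - dF F b c * dF F b c := by
  rw [eF, dF, ← map_mul, eCoeff_mul_self, map_sub, map_mul, map_one]

theorem dF_cocycle {a b c : Box lam} (hab : a.β = b.β → a.ct ≠ b.ct)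
    (hbc : b.β = c.β → b.ct ≠ c.ct) (hac : a.β = c.β → a.ct ≠ c.ct) :
    dF F a b * dF F b c = dF F a c * (dF F a b + dF F b c) := by
  simp only [dF, ← map_mul, ← map_add, dCoeff_cocycle hab hbc hac]

theorem eF_eq_zero {T : Fin n ≃ Box lam} (hT : IsStandard T) {i j : Fin n}
    (hij : (i : ℕ) + 1 = j) (h : ¬ IsStandard ((Equiv.swap i j).trans T)) :
    eF F (T i) (T j) = 0 := by
  rw [eF, eCoeff_eq_zero hT hij h, map_zero]

theorem dF_of_ne {b c : Box lam} (h : b.β ≠ c.β) : dF F b c = 0 := by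
  simp [dF, dCoeff, h]

theorem dF_mul_ct {b c : Box lam} (h : b.β = c.β) (h' : b.ct ≠ c.ct) :
    dF F b c * ((c.ct : F) - b.ct) = 1 := by
  have e : ((c.ct - b.ct : ℤ) : ℝ) ≠ 0 := by
    exact_mod_cast sub_ne_zero.2 (Ne.symm h')
  have : dCoeff b c * ((c.ct - b.ct : ℤ) : ℝ) = 1 := by
    rw [dCoeff, if_pos h, one_div, inv_mul_cancel₀ e]
  have := congrArg (realHom F) this
  rw [map_mul, map_intCast, map_one] at this
  rw [dF, ← this]
  push_cast
  rfl

/-- The underlying space of the representation `S^λ`, with basis the standard tableaux. -/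
abbrev Specht (lam : RPartition r n) : Type := SYT lam →₀ F

open Classical in
/-- The vector `v_T` for a filling `T`, which is zero if `T` is not standard. -/
def fillVec (T : Fin n ≃ Box lam) : Specht F lam :=
  if h : IsStandard T then Finsupp.single ⟨T, h⟩ 1 else 0

variable {F} in
theorem fillVec_of_standard {T : Fin n ≃ Box lam} (h : IsStandard T) :
    fillVec F T = (Finsupp.single ⟨T, h⟩ 1 : Specht F lam) := dif_pos h

variable {F} in
theorem fillVec_coe (T : SYT lam) : fillVec F T.1 = (Finsupp.single T 1 : Specht F lam) :=
  fillVec_of_standard T.2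

variable {F} in
theorem fillVec_of_not_standard {T : Fin n ≃ Box lam} (h : ¬ IsStandard T) :
    fillVec F T = (0 : Specht F lam) := dif_neg h

/-- The action of the transposition `(i, j)`, where `j = i + 1`, in Young's orthonormal form. -/
def youngOp (i j : Fin n) : Module.End F (Specht F lam) :=
  Finsupp.linearCombination F fun T : SYT lam =>
    dF F (T.1 i) (T.1 j) • fillVec F T.1 + eF F (T.1 i) (T.1 j) • fillVec F ((Equiv.swap i j).trans T.1)

variable {F}

theorem youngOp_fillVec {T : Fin n ≃ Box lam} (hT : IsStandard T) (i j : Fin n) :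
    youngOp F i j (fillVec F T) = dF F (T i) (T j) • fillVec F T +
      eF F (T i) (T j) • fillVec F ((Equiv.swap i j).trans T) := by
  have h : fillVec F T = Finsupp.single (⟨T, hT⟩ : SYT lam) 1 := fillVec_of_standard hT
  conv_lhs => rw [h]
  exact (Finsupp.linearCombination_single F (1 : F) (⟨T, hT⟩ : SYT lam)).trans (one_smul _ _)

/-- With the coefficient in front, the formula also holds for nonstandard `T'`, because then the
coefficient vanishes. This spares the relations below a case distinction for each filling. -/
theorem eF_smul_youngOp {T : Fin n ≃ Box lam} (hT : IsStandard T) {i j : Fin n}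
    (hij : (i : ℕ) + 1 = j) (k l : Fin n) {T' : Fin n ≃ Box lam}
    (hT' : T' = (Equiv.swap i j).trans T) :
    eF F (T i) (T j) • youngOp F k l (fillVec F T') =
      eF F (T i) (T j) • (dF F (T' k) (T' l) • fillVec F T' +
        eF F (T' k) (T' l) • fillVec F ((Equiv.swap k l).trans T')) := by
  by_cases h : IsStandard T'
  · rw [youngOp_fillVec h]
  · rw [eF_eq_zero F hT hij (hT' ▸ h), zero_smul, zero_smul]

theorem end_ext {f g : Module.End F (Specht F lam)}
    (h : ∀ T : Fin n ≃ Box lam, IsStandard T → f (fillVec F T) = g (fillVec F T)) : f = g := by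
  refine Finsupp.lhom_ext' fun T => LinearMap.ext_ring ?_
  have := h T.1 T.2
  rwa [fillVec_coe] at this

theorem swap_trans_swap (i j : Fin n) (T : Fin n ≃ Box lam) :
    (Equiv.swap i j).trans ((Equiv.swap i j).trans T) = T := by
  ext k; simp

theorem youngOp_mul_self {i j : Fin n} (hij : (i : ℕ) + 1 = j) :
    (youngOp F i j * youngOp F i j : Module.End F (Specht F lam)) = 1 := by
  refine end_ext fun T hT => ?_
  rw [Module.End.mul_apply, youngOp_fillVec hT, map_add, map_smul, map_smul, youngOp_fillVec hT,
    eF_smul_youngOp hT hij i j rfl, swap_trans_swap]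
  simp only [Equiv.trans_apply, Equiv.swap_apply_left, Equiv.swap_apply_right, Module.End.one_apply]
  rw [dF_swap F (T i) (T j), eF_swap F (T i) (T j)]
  have := eF_mul_self F (T i) (T j)
  linear_combination (norm := module) this • (fillVec F T : Specht F lam)

/-- Both sides are expanded in the six fillings obtained by permuting three consecutive entries. The
coefficients of the fillings `T12`, `T21` and of the common last one agree at once; those of `T`,
`T1` and `T2` agree by `dCoeff_cocycle` and the relation between squares. -/
theorem youngOp_braid {i j k : Fin n} (hij : (i : ℕ) + 1 = j) (hjk : (j : ℕ) + 1 = k) :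
    (youngOp F i j * youngOp F j k * youngOp F i j : Module.End F (Specht F lam)) =
      youngOp F j k * youngOp F i j * youngOp F j k := by
  refine end_ext fun T hT => ?_
  have nij : i ≠ j := by rintro rfl; omega
  have njk : j ≠ k := by rintro rfl; omega
  have nik : i ≠ k := by rintro rfl; omega
  simp only [Module.End.mul_apply]
  set T1 := (Equiv.swap i j).trans T with hT1
  set T2 := (Equiv.swap j k).trans T with hT2
  set T12 := (Equiv.swap j k).trans T1 with hT12
  set T21 := (Equiv.swap i j).trans T2 with hT21
  have a1 : T1 i = T j := by simp [hT1]
  have a2 : T1 j = T i := by simp [hT1]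
  have a3 : T1 k = T k := by simp [hT1, Equiv.swap_apply_of_ne_of_ne nik.symm njk.symm]
  have b1 : T2 i = T i := by simp [hT2, Equiv.swap_apply_of_ne_of_ne nij nik]
  have b2 : T2 j = T k := by simp [hT2]
  have b3 : T2 k = T j := by simp [hT2]
  have c1 : T12 i = T j := by simp [hT12, Equiv.swap_apply_of_ne_of_ne nij nik, a1]
  have c2 : T12 j = T k := by simp [hT12, a3]
  have c3 : T12 k = T i := by simp [hT12, a2]
  have d1 : T21 i = T k := by simp [hT21, b2]
  have d2 : T21 j = T i := by simp [hT21, b1]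
  have d3 : T21 k = T j := by simp [hT21, Equiv.swap_apply_of_ne_of_ne nik.symm njk.symm, b3]
  have hlast : (Equiv.swap i j).trans T12 = (Equiv.swap j k).trans T21 := by
    have := swap_braid nij nik njk
    ext x
    have := congrArg T (congrArg (fun σ => σ x) this)
    simpa [hT12, hT1, hT21, hT2] using this
  have e12 : ∀ a b : Fin n, eF F (T i) (T j) • youngOp F a b (fillVec F T1) =
      eF F (T i) (T j) • (dF F (T1 a) (T1 b) • fillVec F T1 +
        eF F (T1 a) (T1 b) • fillVec F ((Equiv.swap a b).trans T1)) := fun a b =>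
    eF_smul_youngOp hT hij a b hT1
  have e23 : ∀ a b : Fin n, eF F (T j) (T k) • youngOp F a b (fillVec F T2) =
      eF F (T j) (T k) • (dF F (T2 a) (T2 b) • fillVec F T2 +
        eF F (T2 a) (T2 b) • fillVec F ((Equiv.swap a b).trans T2)) := fun a b =>
    eF_smul_youngOp hT hjk a b hT2
  -- If `T1` is not standard the first coefficient vanishes, and if only `T12` is not standard the
  -- second one does. The formula therefore needs no standardness assumption.
  have e1213 : eF F (T i) (T j) • eF F (T i) (T k) • youngOp F i j (fillVec F T12) =
      eF F (T i) (T j) • eF F (T i) (T k) • (dF F (T j) (T k) • fillVec F T12 +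
        eF F (T j) (T k) • fillVec F ((Equiv.swap i j).trans T12)) := by
    by_cases h : IsStandard T1
    · have := eF_smul_youngOp (F := F) h hjk i j hT12
      rw [a2, a3, c1, c2] at this
      rw [this]
    · rw [eF_eq_zero F hT hij h, zero_smul, zero_smul]
  have e2313 : eF F (T j) (T k) • eF F (T i) (T k) • youngOp F j k (fillVec F T21) =
      eF F (T j) (T k) • eF F (T i) (T k) • (dF F (T i) (T j) • fillVec F T21 +
        eF F (T i) (T j) • fillVec F ((Equiv.swap j k).trans T21)) := by
    by_cases h : IsStandard T2
    · have := eF_smul_youngOp (F := F) h hij j k hT21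
      rw [b1, b2, d2, d3] at this
      rw [this]
    · rw [eF_eq_zero F hT hjk h, zero_smul, zero_smul]
  have l1 := e12 j k
  have l2 := e12 i j
  have l3 := e23 i j
  have l4 := e23 j k
  rw [a1, a2, hT1, swap_trans_swap, ← hT1] at l2
  rw [b2, b3, hT2, swap_trans_swap, ← hT2] at l4
  rw [a2, a3, ← hT12] at l1
  rw [b1, b2, ← hT21] at l3
  rw [hlast] at e1213
  rw [youngOp_fillVec hT, youngOp_fillVec hT, ← hT1, ← hT2]
  simp only [map_add, map_smul]
  rw [← map_smul (youngOp F i j) (eF F (T i) (T j)), ← map_smul (youngOp F j k) (eF F (T j) (T k)),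
    l1, l3]
  simp only [map_add, map_smul, youngOp_fillVec hT, ← hT1, ← hT2]
  have k12 : i < j := Fin.lt_def.2 (by omega)
  have k23 : j < k := Fin.lt_def.2 (by omega)
  have coc := dF_cocycle F (hT.ct_ne k12 (by omega)) (hT.ct_ne k23 (by omega))
    (hT.ct_ne (k12.trans k23) (by omega))
  have q12 := eF_mul_self F (T i) (T j)
  have q23 := eF_mul_self F (T j) (T k)
  rw [dF_swap F (T i) (T j), eF_swap F (T i) (T j)] at l2
  rw [dF_swap F (T j) (T k), eF_swap F (T j) (T k)] at l4
  simp only [smul_add, smul_comm (eF F (T i) (T j)) (dF F (T i) (T k)),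
    smul_comm (eF F (T j) (T k)) (dF F (T i) (T k))]
  simp only [smul_add] at l1 l2 l3 l4 e1213 e2313
  rw [l2, l4, e1213, e2313]
  generalize dF F (T i) (T j) = d12 at *
  generalize dF F (T j) (T k) = d23 at *
  generalize dF F (T i) (T k) = d13 at *
  generalize eF F (T i) (T j) = x12 at *
  generalize eF F (T j) (T k) = x23 at *
  have l3' := congrArg (fun x => d12 • x) l3
  have l1' := congrArg (fun x => d23 • x) l1
  simp only [smul_add] at l1' l3'
  rw [l3', l1']
  linear_combination (norm := module) (d12 * coc - d23 * coc + d13 * q12 - d13 * q23) • (fillVec F T : Specht F lam)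
    + (x12 * coc) • (fillVec F T1 : Specht F lam) - (x23 * coc) • (fillVec F T2 : Specht F lam)

theorem youngOp_comm {i j k l : Fin n} (hij : (i : ℕ) + 1 = j) (hkl : (k : ℕ) + 1 = l)
    (hjk : (j : ℕ) < k) :
    (youngOp F i j * youngOp F k l : Module.End F (Specht F lam)) = youngOp F k l * youngOp F i j := by
  refine end_ext fun T hT => ?_
  have h1 : i ≠ k := by rintro rfl; omega
  have h2 : i ≠ l := by rintro rfl; omega
  have h3 : j ≠ k := by rintro rfl; omega
  have h4 : j ≠ l := by rintro rfl; omega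
  rw [Module.End.mul_apply, Module.End.mul_apply, youngOp_fillVec hT, youngOp_fillVec hT]
  simp only [map_add, map_smul]
  rw [eF_smul_youngOp hT hij k l rfl, eF_smul_youngOp hT hkl i j rfl, youngOp_fillVec hT,
    youngOp_fillVec hT]
  have hc : (Equiv.swap i j).trans ((Equiv.swap k l).trans T) =
      (Equiv.swap k l).trans ((Equiv.swap i j).trans T) := by
    have hd : Equiv.swap k l * Equiv.swap i j = Equiv.swap i j * Equiv.swap k l := by
      apply Equiv.Perm.Disjoint.commute
      intro x
      by_cases hx : x = i ∨ x = j
      · left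
        apply Equiv.swap_apply_of_ne_of_ne <;> rcases hx with rfl | rfl <;> assumption
      · right
        push Not at hx
        exact Equiv.swap_apply_of_ne_of_ne hx.1 hx.2
    ext x
    exact congrArg T (congrArg (fun σ => σ x) hd)
  simp only [Equiv.trans_apply, Equiv.swap_apply_of_ne_of_ne h1 h2,
    Equiv.swap_apply_of_ne_of_ne h3 h4, Equiv.swap_apply_of_ne_of_ne h1.symm h3.symm,
    Equiv.swap_apply_of_ne_of_ne h2.symm h4.symm, hc]
  module

end Young

end

noncomputable section

/-! ### The representation of `G(r,1,n)` on `S^λ` -/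

section Rep

variable {r n : ℕ} [NeZero r] (F : Type) [Field F] [Algebra ℂ F] {lam : RPartition r n}

/-- The character `a ↦ ∏ a_k ^ η_k` of the group of diagonal matrices. -/
def weightChar (η : Fin n → ZMod r) : (Fin n → rootsOfUnity r ℂ) →* F where
  toFun a := ∏ k, chr F (η k) (a k)
  map_one' := by simp
  map_mul' a b := by simp [Finset.prod_mul_distrib]

theorem weightChar_apply (η : Fin n → ZMod r) (a : Fin n → rootsOfUnity r ℂ) :
    weightChar F η a = ∏ k, chr F (η k) (a k) := rfl

theorem weightChar_single (η : Fin n → ZMod r) (i : Fin n) (u : rootsOfUnity r ℂ) :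
    weightChar F η (Pi.mulSingle i u) = chr F (η i) u := by
  rw [weightChar_apply, Finset.prod_eq_single i]
  · simp
  · intro k _ hk
    simp [hk]
  · simp

theorem weightChar_add (η θ : Fin n → ZMod r) (a : Fin n → rootsOfUnity r ℂ) :
    weightChar F (η + θ) a = weightChar F η a * weightChar F θ a := by
  simp [weightChar_apply, chr_add, Finset.prod_mul_distrib]

theorem weightChar_zero (a : Fin n → rootsOfUnity r ℂ) : weightChar F 0 a = 1 := by
  simp [weightChar_apply]

theorem weightChar_comp (η : Fin n → ZMod r) (σ : Equiv.Perm (Fin n))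
    (a : Fin n → rootsOfUnity r ℂ) :
    weightChar F (η ∘ σ) (a ∘ σ) = weightChar F η a :=
  Fintype.prod_equiv σ _ _ fun _ => rfl

variable (lam) in
/-- The action of the diagonal matrices on `S^λ`. -/
def diagOp : (Fin n → rootsOfUnity r ℂ) →* Module.End F (Specht F lam) where
  toFun a := Finsupp.linearCombination F fun T : SYT lam =>
    weightChar F (fun k => (T.1 k).β) a • fillVec F T.1
  map_one' := by
    refine Finsupp.lhom_ext' fun T => LinearMap.ext_ring ?_
    simp [fillVec_coe]
  map_mul' a b := by
    refine Finsupp.lhom_ext' fun T => LinearMap.ext_ring ?_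
    simp [fillVec_coe, mul_comm]

theorem diagOp_fillVec (a : Fin n → rootsOfUnity r ℂ) (T : Fin n ≃ Box lam) :
    diagOp F lam a (fillVec F T) = weightChar F (fun k => (T k).β) a • fillVec F T := by
  by_cases hT : IsStandard T
  · have h : fillVec F T = Finsupp.single (⟨T, hT⟩ : SYT lam) 1 := fillVec_of_standard hT
    conv_lhs => rw [h]
    exact (Finsupp.linearCombination_single F (1 : F) (⟨T, hT⟩ : SYT lam)).trans (one_smul _ _)
  · rw [fillVec_of_not_standard hT, map_zero, smul_zero]

/-- If the two entries lie in one component, the weights of `T` and of the swapped filling coincide.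
Otherwise the diagonal coefficient is zero and only the swapped filling occurs. -/
theorem youngOp_mul_diagOp (i j : Fin n) (a : Fin n → rootsOfUnity r ℂ) :
    youngOp F i j * diagOp F lam a = diagOp F lam (a ∘ Equiv.swap i j) * youngOp F i j := by
  refine end_ext fun T hT => ?_
  rw [Module.End.mul_apply, Module.End.mul_apply, diagOp_fillVec, map_smul, youngOp_fillVec hT,
    map_add, map_smul, map_smul, diagOp_fillVec, diagOp_fillVec]
  have h1 : weightChar F (fun k => (((Equiv.swap i j).trans T) k).β) (a ∘ Equiv.swap i j) =
      weightChar F (fun k => (T k).β) a :=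
    weightChar_comp F (fun k => (T k).β) (Equiv.swap i j) a
  rw [h1]
  by_cases hβ : (T i).β = (T j).β
  · have h2 : (fun k => (T k).β) = (fun k => (T k).β) ∘ Equiv.swap i j := by
      funext k
      simp only [Function.comp, Equiv.swap_apply_def]
      split_ifs <;> simp_all
    have h3 : weightChar F (fun k => (T k).β) (a ∘ Equiv.swap i j) =
        weightChar F (fun k => (T k).β) a := by
      conv_lhs => rw [h2, weightChar_comp]
    rw [h3]
    module
  · rw [dF_of_ne F hβ]
    module

variable (lam) in
/-- The transposition of `i` and `i + 1` as an invertible operator on `S^λ`. -/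
def youngUnit (i : ℕ) : (Module.End F (Specht F lam))ˣ :=
  if h : i + 1 < n then
    ⟨youngOp F ⟨i, by omega⟩ ⟨i + 1, h⟩, youngOp F ⟨i, by omega⟩ ⟨i + 1, h⟩,
      youngOp_mul_self rfl, youngOp_mul_self rfl⟩
  else 1

theorem youngUnit_val {i : ℕ} (h : i + 1 < n) :
    (youngUnit F lam i : Module.End F (Specht F lam)) = youngOp F ⟨i, by omega⟩ ⟨i + 1, h⟩ := by
  rw [youngUnit, dif_pos h]

theorem exists_permRep : ∃ f : Equiv.Perm (Fin n) →* (Module.End F (Specht F lam))ˣ,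
    ∀ i, i + 1 < n → f (adjSwap n i) = youngUnit F lam i := by
  apply exists_permHom
  · intro i hi
    ext1
    rw [Units.val_mul, youngUnit_val F hi, youngOp_mul_self rfl, Units.val_one]
  · intro i hi
    ext1
    simp only [Units.val_mul]
    rw [youngUnit_val F (show i + 1 < n by omega), youngUnit_val F (show i + 1 + 1 < n by omega),
      youngOp_braid rfl rfl]
  · intro i j hij hj
    ext1
    simp only [Units.val_mul]
    rw [youngUnit_val F (show i + 1 < n by omega), youngUnit_val F hj,
      youngOp_comm rfl rfl (by simpa using hij)]

variable (lam) in
/-- The action of the symmetric group on `S^λ`. -/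
def permRep : Equiv.Perm (Fin n) →* (Module.End F (Specht F lam))ˣ :=
  Classical.choose (exists_permRep F)

theorem permRep_adjSwap {i : ℕ} (h : i + 1 < n) :
    permRep F lam (adjSwap n i) = youngUnit F lam i :=
  Classical.choose_spec (exists_permRep F) i h

theorem swap_eq_adjSwap {i j : Fin n} (hij : (i : ℕ) + 1 = j) :
    Equiv.swap i j = adjSwap n i := by
  obtain ⟨j, hj⟩ := j
  obtain rfl : (i : ℕ) + 1 = j := hij
  rw [adjSwap, dif_pos hj]

theorem permRep_swap {i j : Fin n} (hij : (i : ℕ) + 1 = j) :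
    (permRep F lam (Equiv.swap i j) : Module.End F (Specht F lam)) = youngOp F i j := by
  obtain ⟨j, hj⟩ := j
  obtain rfl : (i : ℕ) + 1 = j := hij
  rw [swap_eq_adjSwap rfl, permRep_adjSwap F hj, youngUnit_val F hj]

/-- Induction over products of adjacent transpositions. -/
theorem perm_induction {P : Equiv.Perm (Fin n) → Prop} (h1 : P 1)
    (hs : ∀ i j : Fin n, (i : ℕ) + 1 = j → P (Equiv.swap i j))
    (hmul : ∀ σ τ, P σ → P τ → P (σ * τ)) (σ : Equiv.Perm (Fin n)) : P σ := by
  rcases n with _ | n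
  · rwa [Subsingleton.elim σ 1]
  · have hσ : σ ∈ Submonoid.closure (Set.range fun i : Fin n => Equiv.swap i.castSucc i.succ) := by
      rw [Equiv.Perm.mclosure_swap_castSucc_succ]; trivial
    induction hσ using Submonoid.closure_induction with
    | mem x hx =>
      obtain ⟨i, rfl⟩ := hx
      exact hs _ _ rfl
    | one => exact h1
    | mul x y _ _ hx hy => exact hmul x y hx hy

theorem permRep_mul_diagOp (σ : Equiv.Perm (Fin n)) (a : Fin n → rootsOfUnity r ℂ) :
    (permRep F lam σ : Module.End F (Specht F lam)) * diagOp F lam a =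
      diagOp F lam (a ∘ ⇑σ⁻¹) * permRep F lam σ := by
  induction σ using perm_induction generalizing a with
  | h1 => simp
  | hs i j hij =>
    rw [permRep_swap F hij, youngOp_mul_diagOp, Equiv.swap_inv]
  | hmul σ τ hσ hτ =>
    rw [map_mul, Units.val_mul, mul_assoc, hτ, ← mul_assoc, hσ, mul_assoc, mul_inv_rev]
    rfl

variable (lam) in
/-- The action of `G(r,1,n)` on `S^λ` by invertible operators. -/
def spechtUnits : W r n →* (Module.End F (Specht F lam))ˣ :=
  SemidirectProduct.lift (diagOp F lam).toHomUnits (permRep F lam) fun σ => by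
    ext1 a
    ext1
    have := permRep_mul_diagOp F (lam := lam) σ a
    have h2 : (mulAutArrow σ a : Fin n → rootsOfUnity r ℂ) = a ∘ ⇑σ⁻¹ := rfl
    simp only [MonoidHom.comp_apply, MulEquiv.coe_toMonoidHom, MulAut.conj_apply, Units.val_mul,
      MonoidHom.coe_toHomUnits, h2]
    rw [this, mul_assoc, Units.mul_inv, mul_one]

variable (lam) in
/-- The action of `G(r,1,n)` on `S^λ`. -/
def spechtRep : W r n →* Module.End F (Specht F lam) :=
  (Units.coeHom _).comp (spechtUnits F lam)

theorem spechtRep_diag (a : Fin n → rootsOfUnity r ℂ) : spechtRep F lam (diag a) = diagOp F lam a := by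
  simp [spechtRep, spechtUnits, diag]

theorem spechtRep_perm (σ : Equiv.Perm (Fin n)) :
    spechtRep F lam (perm r σ) = permRep F lam σ := by
  simp [spechtRep, spechtUnits, perm]

theorem spechtRep_swap {i j : Fin n} (hij : (i : ℕ) + 1 = j) :
    spechtRep F lam (perm r (Equiv.swap i j)) = youngOp F i j := by
  rw [spechtRep_perm, permRep_swap F hij]

theorem spechtRep_inv_apply (w : W r n) (v : Specht F lam) :
    spechtRep F lam w⁻¹ (spechtRep F lam w v) = v := by
  rw [← Module.End.mul_apply, ← map_mul]; simp

theorem spechtRep_apply_inv (w : W r n) (v : Specht F lam) :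
    spechtRep F lam w (spechtRep F lam w⁻¹ v) = v := by
  rw [← Module.End.mul_apply, ← map_mul]; simp

/-- Averaging over the roots of unity projects onto the vectors for which `i` and `j` lie in the
same component, by `sum_chr`. On these every reflection acts like the plain transposition. -/
theorem reflSum_fillVec {T : Fin n ≃ Box lam} (hT : IsStandard T) {i j : Fin n}
    (hij : (i : ℕ) + 1 = j) :
    reflSum (F := F) (A := Module.End F (Specht F lam)) (spechtRep F lam) 0 j i (fillVec F T) =
      if (T i).β = (T j).β then (r : F) • youngOp F i j (fillVec F T) else 0 := by
  have hne : j ≠ i := by rintro rfl; omega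
  have h1 : ∀ T' : Fin n ≃ Box lam,
      (∑ u : rootsOfUnity r ℂ, diagOp F lam (Pi.mulSingle j u * Pi.mulSingle i u⁻¹) (fillVec F T')) =
        (if (T' i).β = (T' j).β then (r : F) else 0) • fillVec F T' := by
    intro T'
    have : ∀ u : rootsOfUnity r ℂ,
        diagOp F lam (Pi.mulSingle j u * Pi.mulSingle i u⁻¹) (fillVec F T') =
          chr F ((T' j).β - (T' i).β) u • fillVec F T' := by
      intro u
      rw [diagOp_fillVec, map_mul, weightChar_single, weightChar_single, chr_inv, ← chr_sub]
    simp only [this, ← Finset.sum_smul, sum_chr, sub_eq_zero, eq_comm (a := (T' j).β)]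
  have h2 : reflSum (F := F) (A := Module.End F (Specht F lam)) (spechtRep F lam) 0 j i (fillVec F T) =
      ∑ u : rootsOfUnity r ℂ, diagOp F lam (Pi.mulSingle j u * Pi.mulSingle i u⁻¹)
        (youngOp F i j (fillVec F T)) := by
    rw [reflSum, LinearMap.sum_apply]
    refine Finset.sum_congr rfl fun u _ => ?_
    rw [chr_zero, one_smul, reflAt_eq, map_mul, spechtRep_diag, Equiv.swap_comm,
      spechtRep_swap F hij]
    rfl
  rw [h2, youngOp_fillVec hT]
  simp only [map_add, map_smul, Finset.sum_add_distrib, ← Finset.smul_sum, h1, Equiv.trans_apply,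
    Equiv.swap_apply_left, Equiv.swap_apply_right, eq_comm (a := (T j).β)]
  split_ifs with h
  · module
  · simp

/-- The eigenvalues of the Jucys–Murphy elements on `S^λ`. -/
theorem sum_reflSum_fillVec {T : Fin n ≃ Box lam} (hT : IsStandard T) (i : Fin n) :
    ∑ j ∈ Finset.univ.filter (fun j : Fin n => j < i),
      reflSum (F := F) (A := Module.End F (Specht F lam)) (spechtRep F lam) 0 i j (fillVec F T) = ((r : F) * (T i).ct) • fillVec F T := by
  obtain ⟨i, hi⟩ := i
  induction i generalizing T with
  | zero =>
    rw [hT.ct_zero rfl, Finset.sum_eq_zero]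
    · simp
    · intro j hj
      simp [Fin.lt_def] at hj
  | succ i ih =>
    set a : Fin n := ⟨i, by omega⟩ with ha
    set b : Fin n := ⟨i + 1, hi⟩ with hb
    have hab : (a : ℕ) + 1 = b := rfl
    have hlt : a < b := Fin.lt_def.2 (by omega)
    have hset : Finset.univ.filter (fun j : Fin n => j < b) =
        insert a (Finset.univ.filter (fun j : Fin n => j < a)) := by
      ext j
      simp only [Finset.mem_filter, Finset.mem_univ, true_and, Finset.mem_insert, Fin.lt_def,
        Fin.ext_iff, ha, hb]
      omega
    -- The recursion of the Jucys–Murphy elements: the next one is the conjugate of the previous one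
    -- by the adjacent transposition, plus the reflections interchanging the two new neighbours.
    have hconj : ∀ v : Specht F lam, ∑ j ∈ Finset.univ.filter (fun j : Fin n => j < a),
        reflSum (F := F) (A := Module.End F (Specht F lam)) (spechtRep F lam) 0 b j v = youngOp F a b
          (∑ j ∈ Finset.univ.filter (fun j : Fin n => j < a),
            reflSum (F := F) (A := Module.End F (Specht F lam)) (spechtRep F lam) 0 a j (youngOp F a b v)) := by
      intro v
      rw [map_sum]
      refine Finset.sum_congr rfl fun j hj => ?_
      have hj' : j < a := by simpa using hj
      have h1 := map_mul_reflSum (F := F) (A := Module.End F (Specht F lam)) (τ := spechtRep F lam) (perm r (Equiv.swap a b)) 0 a j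
      rw [spechtRep_swap F hab, perm_right, Equiv.swap_apply_left,
        Equiv.swap_apply_of_ne_of_ne hj'.ne (hj'.trans hlt).ne] at h1
      simp only [neg_zero, chr_zero, mul_one, one_smul] at h1
      have h2 := congrArg (fun f => f (youngOp F a b v)) h1
      simp only [Module.End.mul_apply] at h2
      rw [h2, ← Module.End.mul_apply (youngOp F a b), youngOp_mul_self hab]
      rfl
    rw [hset, Finset.sum_insert (by simp), hconj, reflSum_fillVec F hT hab]
    have key : eF F (T a) (T b) • ∑ j ∈ Finset.univ.filter (fun j : Fin n => j < a),
        reflSum (F := F) (A := Module.End F (Specht F lam)) (spechtRep F lam) 0 a j (fillVec F ((Equiv.swap a b).trans T)) =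
        eF F (T a) (T b) • ((r : F) * (T b).ct) • fillVec F ((Equiv.swap a b).trans T) := by
      by_cases h : IsStandard ((Equiv.swap a b).trans T)
      · rw [ih h]
        simp [← ha]
      · rw [eF_eq_zero F hT hab h, zero_smul, zero_smul]
    have key1 := ih hT (by omega)
    rw [← ha] at key1
    have key2 : ∑ j ∈ Finset.univ.filter (fun j : Fin n => j < a),
        reflSum (F := F) (A := Module.End F (Specht F lam)) (spechtRep F lam) 0 a j (youngOp F a b (fillVec F T)) =
        dF F (T a) (T b) • ((r : F) * (T a).ct) • fillVec F T +
        eF F (T a) (T b) • ((r : F) * (T b).ct) • fillVec F ((Equiv.swap a b).trans T) := by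
      rw [youngOp_fillVec hT]
      simp only [map_add, map_smul, Finset.sum_add_distrib, ← Finset.smul_sum]
      rw [key, key1]
    have l2 := eF_smul_youngOp (F := F) hT hab a b rfl
    rw [swap_trans_swap, Equiv.trans_apply, Equiv.trans_apply, Equiv.swap_apply_left,
      Equiv.swap_apply_right, dF_swap F (T a) (T b), eF_swap F (T a) (T b)] at l2
    have q := eF_mul_self F (T a) (T b)
    rw [key2]
    simp only [map_add, map_smul]
    rw [smul_comm (eF F (T a) (T b)) ((r : F) * (T b).ct), l2, youngOp_fillVec hT]
    by_cases hβ : (T a).β = (T b).β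
    · rw [if_pos hβ]
      have h1 := dF_mul_ct F hβ (hT.ct_ne hlt (by omega) hβ)
      generalize dF F (T a) (T b) = d at *
      generalize eF F (T a) (T b) = e at *
      linear_combination (norm := module) ((r : F) * (T b).ct * q - r * d * h1) • fillVec F T
        - (r * e * h1) • fillVec F ((Equiv.swap a b).trans T)
    · rw [if_neg hβ]
      rw [dF_of_ne F hβ] at *
      generalize eF F (T a) (T b) = e at *
      linear_combination (norm := module) ((r : F) * (T b).ct * q) • fillVec F T

end Rep

end

noncomputable section

/-! ### The polynomial representation with values in `S^λ` -/

section Poly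

variable {r n : ℕ} [NeZero r] (F : Type) [Field F] [Algebra ℂ F] (lam : RPartition r n)

/-- Polynomials in `x_1, …, x_n` with coefficients in `S^λ`. -/
def PolyMod : Type := (Fin n → ℕ) →₀ Specht F lam

instance : AddCommGroup (PolyMod F lam) :=
  inferInstanceAs (AddCommGroup ((Fin n → ℕ) →₀ Specht F lam))

instance : Module F (PolyMod F lam) :=
  inferInstanceAs (Module F ((Fin n → ℕ) →₀ Specht F lam))

variable {F lam}

/-- The element `x^ν v`. -/
def mono (ν : Fin n → ℕ) : Specht F lam →ₗ[F] PolyMod F lam :=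
  Finsupp.lsingle (M := Specht F lam) (R := F) ν

/-- The coefficient of `x^ν`. -/
def coord (ν : Fin n → ℕ) : PolyMod F lam →ₗ[F] Specht F lam :=
  Finsupp.lapply (M := Specht F lam) (R := F) ν

theorem coord_mono_self (ν : Fin n → ℕ) (v : Specht F lam) : coord ν (mono ν v) = v :=
  Finsupp.single_eq_same

theorem coord_mono_of_ne {ν μ : Fin n → ℕ} (h : μ ≠ ν) (v : Specht F lam) :
    coord μ (mono ν v) = 0 :=
  Finsupp.single_eq_of_ne h

/-- Linear maps out of the polynomial representation. -/
def PolyMod.lift {M : Type*} [AddCommGroup M] [Module F M]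
    (f : (Fin n → ℕ) → Specht F lam →ₗ[F] M) : PolyMod F lam →ₗ[F] M :=
  Finsupp.lsum F f

theorem PolyMod.lift_mono {M : Type*} [AddCommGroup M] [Module F M]
    (f : (Fin n → ℕ) → Specht F lam →ₗ[F] M) (ν : Fin n → ℕ) (v : Specht F lam) :
    PolyMod.lift f (mono ν v) = f ν v :=
  (Finsupp.lsum_single (R := F) F f ν v :)

theorem PolyMod.hom_ext {M : Type*} [AddCommGroup M] [Module F M] {f g : PolyMod F lam →ₗ[F] M}
    (h : ∀ ν v, f (mono ν v) = g (mono ν v)) : f = g :=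
  Finsupp.lhom_ext' (R := F) fun ν => LinearMap.ext fun v => h ν v

theorem PolyMod.induction {P : PolyMod F lam → Prop} (f : PolyMod F lam) (h0 : P 0)
    (hadd : ∀ f g, P f → P g → P (f + g)) (hmono : ∀ ν v, P (mono ν v)) : P f :=
  Finsupp.induction_linear (motive := P) f h0 hadd hmono

/-- Raise the `j`-th exponent by one. -/
def inc (ν : Fin n → ℕ) (j : Fin n) : Fin n → ℕ := Function.update ν j (ν j + 1)

theorem inc_self (ν : Fin n → ℕ) (j : Fin n) : inc ν j j = ν j + 1 := by simp [inc]

theorem inc_of_ne (ν : Fin n → ℕ) {j k : Fin n} (h : k ≠ j) : inc ν j k = ν k := by simp [inc, h]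

theorem inc_apply (ν : Fin n → ℕ) (j k : Fin n) : inc ν j k = if k = j then ν k + 1 else ν k := by
  by_cases h : k = j
  · subst h; simp [inc]
  · simp [inc, h]

variable (F lam) in
/-- Multiplication by `x_j`. -/
def xOp (j : Fin n) : Module.End F (PolyMod F lam) := PolyMod.lift fun ν => mono (inc ν j)

theorem xOp_mono (j : Fin n) (ν : Fin n → ℕ) (v : Specht F lam) :
    xOp F lam j (mono ν v) = mono (inc ν j) v := PolyMod.lift_mono _ _ _

theorem inc_comm (ν : Fin n → ℕ) (i j : Fin n) : inc (inc ν i) j = inc (inc ν j) i := by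
  funext k
  simp only [inc_apply]
  split_ifs <;> rfl

theorem xOp_comm (i j : Fin n) : xOp F lam i * xOp F lam j = xOp F lam j * xOp F lam i :=
  PolyMod.hom_ext fun ν v => by
    simp only [Module.End.mul_apply, xOp_mono, inc_comm ν i j]

theorem exists_eq_inc {ν : Fin n → ℕ} {m : ℕ} (hm : ∑ k, ν k = m + 1) :
    ∃ k ν', ν = inc ν' k ∧ ∑ l, ν' l = m := by
  obtain ⟨k, -, hk⟩ : ∃ k ∈ Finset.univ, ν k ≠ 0 := by
    apply Finset.exists_ne_zero_of_sum_ne_zero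
    omega
  set ν' := Function.update ν k (ν k - 1) with hν'
  have h1 : ν = inc ν' k := by
    funext l
    rw [inc_apply, hν']
    by_cases hl : l = k
    · subst hl; simp; omega
    · simp [hl]
  refine ⟨k, ν', h1, ?_⟩
  have : ∑ l, ν l = (∑ l, ν' l) + 1 := by
    rw [h1, ← Finset.add_sum_erase _ _ (Finset.mem_univ k), inc_self,
      ← Finset.add_sum_erase _ ν' (Finset.mem_univ k)]
    rw [Finset.sum_congr rfl fun l hl => inc_of_ne ν' (Finset.ne_of_mem_erase hl)]
    ring
  omega

theorem PolyMod.induction_x {P : PolyMod F lam → Prop} (f : PolyMod F lam) (h0 : P 0)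
    (hadd : ∀ f g, P f → P g → P (f + g)) (hv : ∀ v, P (mono 0 v))
    (hx : ∀ j f, P f → P (xOp F lam j f)) : P f := by
  refine PolyMod.induction f h0 hadd fun ν v => ?_
  induction hm : ∑ k, ν k generalizing ν with
  | zero =>
    have : ν = 0 := by
      funext k
      exact (Finset.sum_eq_zero_iff.1 hm) k (Finset.mem_univ k)
    rw [this]
    exact hv v
  | succ m ih =>
    obtain ⟨k, ν', rfl, h2⟩ := exists_eq_inc hm
    rw [← xOp_mono]
    exact hx k _ (ih ν' h2)

/-- The device by which relations between Dunkl operators are checked: it is enough that the defect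
kills constants and that its kernel is stable under the `x_j`. -/
theorem PolyMod.hom_eq_zero {M : Type*} [AddCommGroup M] [Module F M] {E : PolyMod F lam →ₗ[F] M}
    (hv : ∀ v, E (mono 0 v) = 0) (hx : ∀ j f, E f = 0 → E (xOp F lam j f) = 0) : E = 0 :=
  LinearMap.ext fun f => PolyMod.induction_x (P := fun f => E f = 0) f (map_zero E)
    (fun f g hf hg => by rw [map_add, hf, hg, add_zero]) hv hx

/-! ### The action of `G(r,1,n)` on polynomials. -/

/-- The action of a permutation on exponents. -/
def permExp (σ : Equiv.Perm (Fin n)) (ν : Fin n → ℕ) : Fin n → ℕ := fun k => ν (σ⁻¹ k)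

theorem permExp_apply (σ : Equiv.Perm (Fin n)) (ν : Fin n → ℕ) (k : Fin n) :
    permExp σ ν (σ k) = ν k := by
  rw [permExp]; exact congrArg ν (σ.symm_apply_apply k)

/-- The weight of the monomial `x^ν` under the diagonal matrices. -/
def expWeight (r : ℕ) (ν : Fin n → ℕ) : Fin n → ZMod r := fun k => -(ν k : ZMod r)

theorem permExp_mul (σ τ : Equiv.Perm (Fin n)) (ν : Fin n → ℕ) :
    permExp (σ * τ) ν = permExp σ (permExp τ ν) := by
  funext k
  simp [permExp, mul_inv_rev]

theorem weightChar_permExp_mul (w w' : W r n) (ν : Fin n → ℕ) :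
    weightChar F (expWeight r (permExp (w * w').right ν)) (w * w').left =
      weightChar F (expWeight r (permExp w.right (permExp w'.right ν))) w.left *
        weightChar F (expWeight r (permExp w'.right ν)) w'.left := by
  have e : (w * w').left = w.left * (w'.left ∘ ⇑w.right⁻¹) := funext fun k => W_mul_left w w' k
  have e2 : expWeight r (permExp w.right (permExp w'.right ν)) =
      expWeight r (permExp w'.right ν) ∘ ⇑w.right⁻¹ := rfl
  rw [W_mul_right, permExp_mul, e, map_mul]
  congr 1
  rw [e2, weightChar_comp]

variable (F lam) in
/-- The action of an element of `G(r,1,n)` on the polynomial representation. -/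
def tAct (w : W r n) : Module.End F (PolyMod F lam) :=
  PolyMod.lift fun ν => weightChar F (expWeight r (permExp w.right ν)) w.left •
    (mono (permExp w.right ν)).comp (spechtRep F lam w)

theorem tAct_mono (w : W r n) (ν : Fin n → ℕ) (v : Specht F lam) :
    tAct F lam w (mono ν v) = weightChar F (expWeight r (permExp w.right ν)) w.left •
      mono (permExp w.right ν) (spechtRep F lam w v) :=
  PolyMod.lift_mono _ _ _

variable (F lam) in
/-- The action of `G(r,1,n)` on the polynomial representation. -/
def tOp : W r n →* Module.End F (PolyMod F lam) where
  toFun := tAct F lam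
  map_one' := by
    refine PolyMod.hom_ext fun ν v => ?_
    have h1 : ((1 : W r n).left : Fin n → rootsOfUnity r ℂ) = 1 := rfl
    have h2 : permExp (1 : W r n).right ν = ν := rfl
    rw [tAct_mono, map_one, h1, h2, map_one, one_smul, Module.End.one_apply, Module.End.one_apply]
  map_mul' w w' := by
    refine PolyMod.hom_ext fun ν v => ?_
    rw [Module.End.mul_apply, tAct_mono, tAct_mono, map_smul, tAct_mono, smul_smul,
      weightChar_permExp_mul, W_mul_right, permExp_mul, map_mul, Module.End.mul_apply, mul_comm]

theorem tOp_mono (w : W r n) (ν : Fin n → ℕ) (v : Specht F lam) :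
    tOp F lam w (mono ν v) = weightChar F (expWeight r (permExp w.right ν)) w.left •
      mono (permExp w.right ν) (spechtRep F lam w v) :=
  tAct_mono w ν v

theorem tOp_mono_zero (w : W r n) (v : Specht F lam) :
    tOp F lam w (mono 0 v) = mono 0 (spechtRep F lam w v) := by
  rw [tOp_mono]
  have h1 : permExp w.right (0 : Fin n → ℕ) = 0 := rfl
  have h2 : expWeight r (0 : Fin n → ℕ) = 0 := by funext k; simp [expWeight]
  rw [h1, h2, weightChar_zero, one_smul]

theorem permExp_inc (σ : Equiv.Perm (Fin n)) (ν : Fin n → ℕ) (j : Fin n) :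
    permExp σ (inc ν j) = inc (permExp σ ν) (σ j) := by
  funext k
  obtain ⟨k, rfl⟩ := σ.surjective k
  simp [inc_apply, permExp_apply]

theorem weightChar_inc (ν : Fin n → ℕ) (j : Fin n) (a : Fin n → rootsOfUnity r ℂ) :
    weightChar F (expWeight r (inc ν j)) a = chr F (-1) (a j) * weightChar F (expWeight r ν) a := by
  have h : expWeight r (inc ν j) = Pi.single j (-1) + expWeight r ν := by
    funext k
    by_cases hk : k = j
    · subst hk; simp [expWeight, inc_apply]
    · simp [expWeight, inc_apply, hk]
  rw [h, weightChar_add]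
  congr 1
  rw [weightChar_apply, Finset.prod_eq_single j]
  · simp
  · intro k _ hk; simp [hk]
  · simp

theorem tOp_mul_xOp (w : W r n) (j : Fin n) :
    tOp F lam w * xOp F lam j =
      chr F (-1) (w.left (w.right j)) • (xOp F lam (w.right j) * tOp F lam w) := by
  refine PolyMod.hom_ext fun ν v => ?_
  rw [Module.End.mul_apply, xOp_mono, tOp_mono, LinearMap.smul_apply, Module.End.mul_apply,
    tOp_mono, map_smul, xOp_mono, permExp_inc, weightChar_inc, smul_smul]

/-- The reflection with parameter `u` contributes the scalar `u ^ (ν_i - ν_j)` on the monomial,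
which shifts the character by which the reflections on `S^λ` are weighted. -/
theorem reflSum_tOp_mono (i j : Fin n) (k : ZMod r) (ν : Fin n → ℕ)
    (v : Specht F lam) :
    reflSum (F := F) (A := Module.End F (PolyMod F lam)) (tOp F lam) k i j (mono ν v) =
      mono (permExp (Equiv.swap i j) ν)
        (reflSum (F := F) (A := Module.End F (Specht F lam)) (spechtRep F lam)
          (k + (ν i : ZMod r) - (ν j : ZMod r)) i j v) := by
  unfold reflSum
  rw [LinearMap.sum_apply, LinearMap.sum_apply, map_sum]
  refine Finset.sum_congr rfl fun u _ => ?_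
  rw [LinearMap.smul_apply, LinearMap.smul_apply, tOp_mono, map_smul, smul_smul]
  congr 1
  rw [reflAt_left, reflAt_right, map_mul, weightChar_single, weightChar_single, chr_inv]
  simp only [expWeight, permExp, Equiv.swap_inv, Equiv.swap_apply_left, Equiv.swap_apply_right,
    neg_neg]
  rw [chr_sub, chr_add]
  ring

/-- The operator on `S^λ` which multiplies `v_T` by `d_{b} - d_{b-k}`, where `b = β (T i)`. -/
def dDiff (p : Params r F) (lam : RPartition r n) (i : Fin n) (k : ZMod r) :
    Module.End F (Specht F lam) :=
  Finsupp.linearCombination F fun T : SYT lam =>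
    (p.d (T.1 i).β - p.d ((T.1 i).β - k)) • Finsupp.single T 1

variable (p : Params r F)

theorem dDiff_single (i : Fin n) (k : ZMod r) (T : SYT lam) :
    dDiff p lam i k (Finsupp.single T 1) =
      (p.d (T.1 i).β - p.d ((T.1 i).β - k)) • Finsupp.single T 1 := by
  simp [dDiff]

theorem dDiff_zero (i : Fin n) : dDiff p lam i 0 = 0 := by
  refine Finsupp.lhom_ext' fun T => LinearMap.ext_ring ?_
  rw [LinearMap.comp_apply, Finsupp.lsingle_apply, dDiff_single]
  simp

theorem r_ne_zero : (r : F) ≠ 0 := by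
  have : CharZero F := charZero_of_injective_algebraMap (algebraMap ℂ F).injective
  exact_mod_cast NeZero.ne r

/-- On `x^ν v_T` only the idempotent with index `β (T i) - ν_i` survives. Its coefficient is a
difference of consecutive values of `d`, so that these terms telescope to `dDiff` when powers of
`x_i` are built up. -/
theorem dSum_tOp_mono (i : Fin n) (ν : Fin n → ℕ) (v : Specht F lam) :
    dSum (A := Module.End F (PolyMod F lam)) p (tOp F lam) i (mono ν v) =
      mono ν (dDiff p lam i ((ν i : ZMod r) + 1) v - dDiff p lam i (ν i) v) := by
  suffices h : (dSum (A := Module.End F (PolyMod F lam)) p (tOp F lam) i).comp (mono ν) =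
      (mono ν).comp (dDiff p lam i ((ν i : ZMod r) + 1) - dDiff p lam i (ν i)) from LinearMap.congr_fun h v
  refine Finsupp.lhom_ext' fun T => LinearMap.ext_ring ?_
  simp only [LinearMap.comp_apply, Finsupp.lsingle_apply, LinearMap.sub_apply, dDiff_single]
  rw [← sub_smul, map_smul]
  unfold dSum
  have h1 : ∀ u : rootsOfUnity r ℂ, tOp F lam (diag (Pi.mulSingle i u))
      (mono ν (Finsupp.single T 1)) = chr F ((T.1 i).β - (ν i : ZMod r)) u • mono ν (Finsupp.single T 1) := by
    intro u
    rw [tOp_mono, diag_left, diag_right, weightChar_single, spechtRep_diag, ← fillVec_coe,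
      diagOp_fillVec, weightChar_single, map_smul, smul_smul, ← chr_add]
    congr 2
    have e : permExp (1 : Equiv.Perm (Fin n)) ν = ν := rfl
    rw [e, expWeight]
    congr 1
    ring
  have h2 : ∀ k : ZMod r, ∑ u : rootsOfUnity r ℂ, chr F (-k) u •
      tOp F lam (diag (Pi.mulSingle i u)) (mono ν (Finsupp.single T 1)) =
      (if k = (T.1 i).β - (ν i : ZMod r) then (r : F) else 0) • mono ν (Finsupp.single T 1) := by
    intro k
    simp only [h1, smul_smul, ← chr_add, ← Finset.sum_smul, sum_chr]
    congr 2
    rw [neg_add_eq_zero]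
  simp only [LinearMap.sum_apply, LinearMap.smul_apply, h2, smul_smul, ← Finset.sum_smul]
  congr 1
  rw [Finset.sum_eq_single ((T.1 i).β - (ν i : ZMod r))]
  · rw [if_pos rfl, inv_mul_cancel_right₀ r_ne_zero]
    have : (T.1 i).β - (ν i : ZMod r) - 1 = (T.1 i).β - (ν i + 1) := by ring
    rw [this]
    ring
  · intro k _ hk
    rw [if_neg hk, mul_zero]
  · simp

/-! ### Divided differences and Dunkl operators. -/

/-- The exponents with `i`-th entry `a` and `j`-th entry `b`. -/
def set2 (ν : Fin n → ℕ) (i j : Fin n) (a b : ℕ) : Fin n → ℕ :=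
  Function.update (Function.update ν i a) j b

theorem set2_apply (ν : Fin n → ℕ) (i j : Fin n) (a b : ℕ) (k : Fin n) :
    set2 ν i j a b k = if k = j then b else if k = i then a else ν k := by
  simp [set2, Function.update_apply]

theorem set2_swap {i j : Fin n} (h : i ≠ j) (ν : Fin n → ℕ) :
    set2 ν i j (ν j) (ν i) = permExp (Equiv.swap i j) ν := by
  funext k
  rw [set2_apply, permExp, Equiv.swap_inv, Equiv.swap_apply_def]
  split_ifs <;> simp_all

variable (F lam) in
/-- A term of the divided difference `∑_u (x^ν - s x^ν) / (x_i - u x_j) ⊗ s v`, where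
`s = reflAt i j u`. -/
def pairTerm (i j : Fin n) (ν : Fin n → ℕ) (m : ℕ) : Specht F lam →ₗ[F] PolyMod F lam :=
  (mono (set2 ν i j (ν i + ν j - 1 - m) m)).comp
    (reflSum (F := F) (A := Module.End F (Specht F lam)) (spechtRep F lam) ((m : ZMod r) - (ν j : ZMod r)) i j)

variable (F lam) in
/-- The divided difference `∑_u (x^ν - s x^ν) / (x_i - u x_j) ⊗ s v`, where `s = reflAt i j u`. -/
def pairOp (i j : Fin n) (ν : Fin n → ℕ) : Specht F lam →ₗ[F] PolyMod F lam :=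
  ∑ m ∈ Finset.range (ν i), pairTerm F lam i j ν m -
    ∑ m ∈ Finset.range (ν j), pairTerm F lam i j ν m

theorem pairTerm_inc_of_ne {i j k : Fin n} (hi : k ≠ i) (hj : k ≠ j) (ν : Fin n → ℕ) (m : ℕ) :
    pairTerm F lam i j (inc ν k) m = (xOp F lam k).comp (pairTerm F lam i j ν m) := by
  refine LinearMap.ext fun v => ?_
  simp only [pairTerm, LinearMap.comp_apply, xOp_mono, inc_of_ne ν hi.symm, inc_of_ne ν hj.symm]
  congr 2
  funext l
  simp only [inc_apply, set2_apply]
  split_ifs <;> simp_all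

theorem pairOp_inc_of_ne {i j k : Fin n} (hi : k ≠ i) (hj : k ≠ j) (ν : Fin n → ℕ) :
    pairOp F lam i j (inc ν k) = (xOp F lam k).comp (pairOp F lam i j ν) := by
  refine LinearMap.ext fun v => ?_
  simp only [pairOp, pairTerm_inc_of_ne hi hj, inc_of_ne ν hi.symm, inc_of_ne ν hj.symm,
    LinearMap.sub_apply, LinearMap.sum_apply, LinearMap.comp_apply, map_sub, map_sum]

/-- The twisted Leibniz rule. All earlier terms are multiplied by `x_i`, and the one new term, with
`m = ν_i`, is the reflected monomial. -/
theorem pairOp_inc_left {i j : Fin n} (h : i ≠ j) (ν : Fin n → ℕ) (v : Specht F lam) :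
    pairOp F lam i j (inc ν i) v = xOp F lam i (pairOp F lam i j ν v) +
      reflSum (F := F) (A := Module.End F (PolyMod F lam)) (tOp F lam) 0 i j (mono ν v) := by
  -- The restriction on `m` keeps the subtraction `ν i + ν j - 1 - m` from being truncated.
  have h1 : ∀ m, m < ν i ∨ m < ν j →
      pairTerm F lam i j (inc ν i) m v = xOp F lam i (pairTerm F lam i j ν m v) := by
    intro m hm
    simp only [pairTerm, LinearMap.comp_apply, xOp_mono, inc_of_ne ν h.symm, inc_self]
    congr 2
    funext l
    simp only [inc_apply, set2_apply]
    split_ifs <;> simp_all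
    omega
  have h2 : pairTerm F lam i j (inc ν i) (ν i) v =
      reflSum (F := F) (A := Module.End F (PolyMod F lam)) (tOp F lam) 0 i j (mono ν v) := by
    rw [reflSum_tOp_mono, ← set2_swap h]
    simp only [pairTerm, LinearMap.comp_apply, inc_of_ne ν h.symm, inc_self]
    have e1 : set2 (inc ν i) i j (ν i + 1 + ν j - 1 - ν i) (ν i) = set2 ν i j (ν j) (ν i) := by
      funext l
      simp only [inc_apply, set2_apply]
      split_ifs <;> simp_all
    rw [e1, zero_add]
  simp only [pairOp, LinearMap.sub_apply, LinearMap.sum_apply, inc_self, inc_of_ne ν h.symm, map_sub,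
    map_sum]
  rw [Finset.sum_range_succ, h2, Finset.sum_congr rfl fun m hm => h1 m (Or.inl (Finset.mem_range.1 hm)),
    Finset.sum_congr rfl fun m hm => h1 m (Or.inr (Finset.mem_range.1 hm))]
  abel

/-- Multiplication by `x_j` shifts the index `m` by one. The boundary terms with `m = 0` cancel
between the two sums, and the one with `m = ν_i` is the reflected monomial. -/
theorem pairOp_inc_right {i j : Fin n} (h : i ≠ j) (ν : Fin n → ℕ) (v : Specht F lam) :
    pairOp F lam i j (inc ν j) v = xOp F lam j (pairOp F lam i j ν v) -
      reflSum (F := F) (A := Module.End F (PolyMod F lam)) (tOp F lam) (-1) i j (mono ν v) := by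
  have h1 : ∀ m, pairTerm F lam i j (inc ν j) (m + 1) v = xOp F lam j (pairTerm F lam i j ν m v) := by
    intro m
    simp only [pairTerm, LinearMap.comp_apply, xOp_mono, inc_of_ne ν h, inc_self]
    have e : ((m + 1 : ℕ) : ZMod r) - ((ν j + 1 : ℕ) : ZMod r) = m - ν j := by push_cast; ring
    rw [e]
    congr 2
    funext l
    simp only [inc_apply, set2_apply]
    split_ifs <;> simp_all
    omega
  have h2 : pairTerm F lam i j (inc ν j) (ν i) v =
      reflSum (F := F) (A := Module.End F (PolyMod F lam)) (tOp F lam) (-1) i j (mono ν v) := by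
    rw [reflSum_tOp_mono, ← set2_swap h]
    simp only [pairTerm, LinearMap.comp_apply, inc_of_ne ν h, inc_self]
    have e1 : set2 (inc ν j) i j (ν i + (ν j + 1) - 1 - ν i) (ν i) = set2 ν i j (ν j) (ν i) := by
      funext l
      simp only [inc_apply, set2_apply]
      split_ifs <;> simp_all
    have e2 : (ν i : ZMod r) - ((ν j + 1 : ℕ) : ZMod r) = -1 + ν i - ν j := by push_cast; ring
    rw [e1, e2]
  have h3 : ∑ m ∈ Finset.range (ν i), pairTerm F lam i j (inc ν j) m v =
      ∑ m ∈ Finset.range (ν i), pairTerm F lam i j (inc ν j) (m + 1) v +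
        pairTerm F lam i j (inc ν j) 0 v - pairTerm F lam i j (inc ν j) (ν i) v := by
    rw [← Finset.sum_range_succ' (fun m => pairTerm F lam i j (inc ν j) m v),
      Finset.sum_range_succ, add_sub_cancel_right]
  simp only [pairOp, LinearMap.sub_apply, LinearMap.sum_apply, inc_self, inc_of_ne ν h, map_sub,
    map_sum]
  rw [h3, h2, Finset.sum_range_succ', Finset.sum_congr rfl fun m _ => h1 m,
    Finset.sum_congr rfl fun m _ => h1 m]
  abel

variable (lam) in
/-- The Dunkl operator `y_i`. -/
def yOp (i : Fin n) : Module.End F (PolyMod F lam) :=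
  PolyMod.lift fun ν =>
    (mono (Function.update ν i (ν i - 1))).comp ((p.κ * ν i) • 1 - dDiff p lam i (ν i)) -
      p.c₀ • ∑ j ∈ Finset.univ.filter (fun j : Fin n => j ≠ i), pairOp F lam i j ν

theorem yOp_mono (i : Fin n) (ν : Fin n → ℕ) (v : Specht F lam) :
    yOp lam p i (mono ν v) =
      mono (Function.update ν i (ν i - 1)) ((p.κ * ν i) • v - dDiff p lam i (ν i) v) -
      p.c₀ • ∑ j ∈ Finset.univ.filter (fun j : Fin n => j ≠ i), pairOp F lam i j ν v := by
  rw [yOp, PolyMod.lift_mono]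
  simp [LinearMap.sum_apply]

theorem yOp_mono_zero (i : Fin n) (v : Specht F lam) : yOp lam p i (mono 0 v) = 0 := by
  rw [yOp_mono]
  simp [pairOp, dDiff_zero]

theorem yOp_mul_xOp (i j : Fin n) :
    yOp lam p i * xOp F lam j = xOp F lam j * yOp lam p i +
      bracket (A := Module.End F (PolyMod F lam)) p (tOp F lam) i j := by
  refine PolyMod.hom_ext fun ν v => ?_
  rw [LinearMap.add_apply, Module.End.mul_apply, Module.End.mul_apply, xOp_mono, yOp_mono, yOp_mono]
  by_cases h : i = j
  · subst h
    rw [bracket, if_pos rfl]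
    have e1 : Function.update (inc ν i) i (inc ν i i - 1) = ν := by
      funext l
      by_cases hl : l = i
      · subst hl; simp [inc_self]
      · simp [hl, inc_of_ne]
    have e2 : xOp F lam i (mono (Function.update ν i (ν i - 1))
        ((p.κ * ν i) • v - dDiff p lam i (ν i) v)) =
        mono ν ((p.κ * ν i) • v - dDiff p lam i (ν i) v) := by
      by_cases h0 : ν i = 0
      · simp [h0, dDiff_zero]
      · rw [xOp_mono]
        congr 2
        funext l
        by_cases hl : l = i
        · subst hl; simp [inc_self]; omega
        · simp [hl, inc_of_ne]
    rw [e1, map_sub (xOp F lam i), e2, LinearMap.sub_apply, LinearMap.sub_apply, dSum_tOp_mono,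
      LinearMap.smul_apply, LinearMap.sum_apply, Module.algebraMap_end_apply, map_smul,
      Finset.sum_congr rfl fun j hj => pairOp_inc_left (Ne.symm (Finset.mem_filter.1 hj).2) ν v,
      Finset.sum_add_distrib, map_sum, inc_self]
    simp only [map_sub, map_smul]
    push_cast
    module
  · rw [bracket, if_neg h]
    have e1 : xOp F lam j (mono (Function.update ν i (ν i - 1))
        ((p.κ * ν i) • v - dDiff p lam i (ν i) v)) =
        mono (Function.update (inc ν j) i (ν i - 1)) ((p.κ * ν i) • v - dDiff p lam i (ν i) v) := by
      rw [xOp_mono]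
      congr 2
      funext l
      simp only [inc_apply, Function.update_apply]
      split_ifs <;> simp_all
    have e2 : ∀ ν, ∑ k ∈ Finset.univ.filter (fun k : Fin n => k ≠ i), pairOp F lam i k ν v =
        pairOp F lam i j ν v + ∑ k ∈ (Finset.univ.filter (fun k : Fin n => k ≠ i)).erase j,
          pairOp F lam i k ν v := fun ν => by
      rw [Finset.add_sum_erase _ (fun k => pairOp F lam i k ν v) (by simpa [eq_comm] using h)]
    have e3 : ∑ k ∈ (Finset.univ.filter (fun k : Fin n => k ≠ i)).erase j,
          pairOp F lam i k (inc ν j) v =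
        ∑ k ∈ (Finset.univ.filter (fun k : Fin n => k ≠ i)).erase j,
          xOp F lam j (pairOp F lam i k ν v) := by
      refine Finset.sum_congr rfl fun k hk => ?_
      rw [pairOp_inc_of_ne (Ne.symm h) (Ne.symm (Finset.ne_of_mem_erase hk))]
      rfl
    rw [inc_of_ne ν h, map_sub (xOp F lam j), e1, e2 ν, e2 (inc ν j), e3, pairOp_inc_right h,
      LinearMap.smul_apply]
    simp only [map_smul, map_add, map_sum]
    module

/-- By `map_mul_bracket` the defect of this relation commutes with the `x_k` up to a scalar and a
permutation of indices; it kills the constants, so it vanishes. -/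
theorem tOp_mul_yOp (w : W r n) (j : Fin n) :
    tOp F lam w * yOp lam p j =
      chr F 1 (w.left (w.right j)) • (yOp lam p (w.right j) * tOp F lam w) := by
  rw [← sub_eq_zero]
  refine PolyMod.hom_eq_zero (fun v => ?_) fun k f hf => ?_
  · rw [LinearMap.sub_apply, LinearMap.smul_apply, Module.End.mul_apply, Module.End.mul_apply,
      tOp_mono_zero, yOp_mono_zero, yOp_mono_zero, map_zero, smul_zero, sub_zero]
  · set E := tOp F lam w * yOp lam p j -
      chr F 1 (w.left (w.right j)) • (yOp lam p (w.right j) * tOp F lam w) with hE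
    have key : E * xOp F lam k = chr F (-1) (w.left (w.right k)) • (xOp F lam (w.right k) * E) := by
      rw [hE, sub_mul, mul_assoc, yOp_mul_xOp, mul_add, ← mul_assoc, tOp_mul_xOp, smul_mul_assoc,
        mul_assoc, smul_mul_assoc, mul_assoc, tOp_mul_xOp, mul_smul_comm, ← mul_assoc (yOp lam p _),
        yOp_mul_xOp, map_mul_bracket, mul_sub, mul_smul_comm, ← mul_assoc (xOp F lam (w.right k))]
      simp only [add_mul, mul_assoc]
      module
    have := LinearMap.congr_fun key f
    rw [Module.End.mul_apply] at this
    rw [this, LinearMap.smul_apply, Module.End.mul_apply, hf, map_zero, smul_zero]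

/-- The commutator of two Dunkl operators kills the constants, and by `bracket_jacobi` it commutes
with every `x_k`. -/
theorem yOp_comm (i j : Fin n) : yOp lam p i * yOp lam p j = yOp lam p j * yOp lam p i := by
  rw [← sub_eq_zero]
  refine PolyMod.hom_eq_zero (fun v => ?_) fun k f hf => ?_
  · rw [LinearMap.sub_apply, Module.End.mul_apply, Module.End.mul_apply]
    simp [yOp_mono_zero]
  · set E := yOp lam p i * yOp lam p j - yOp lam p j * yOp lam p i with hE
    have key : E * xOp F lam k = xOp F lam k * E := by
      have h1 := yOp_mul_xOp (lam := lam) p i k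
      have h2 := yOp_mul_xOp (lam := lam) p j k
      have h3 := bracket_jacobi (A := Module.End F (PolyMod F lam)) (p := p) (tOp_mul_yOp p) i j k
      rw [hE, sub_mul, mul_assoc, h2, mul_assoc, h1, mul_add, mul_add, ← mul_assoc, ← mul_assoc,
        h1, h2, mul_sub]
      rw [sub_eq_sub_iff_add_eq_add] at h3
      rw [add_mul, add_mul, ← sub_eq_zero]
      have h4 : bracket (A := Module.End F (PolyMod F lam)) p (tOp F lam) i k * yOp lam p j =
        bracket (A := Module.End F (PolyMod F lam)) p (tOp F lam) j k * yOp lam p i +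
        yOp lam p j * bracket (A := Module.End F (PolyMod F lam)) p (tOp F lam) i k -
        yOp lam p i * bracket (A := Module.End F (PolyMod F lam)) p (tOp F lam) j k :=
        eq_sub_of_add_eq h3
      rw [h4]
      simp only [mul_assoc]
      abel
    have := LinearMap.congr_fun key f
    rw [Module.End.mul_apply] at this
    rw [this, Module.End.mul_apply, hf, map_zero]

/-! ### The polynomial representation as a module over the Cherednik algebra. -/

variable (lam) in
/-- The action of the Cherednik algebra on the polynomial representation. -/
def polyAction : RCA n p →ₐ[F] Module.End F (PolyMod F lam) :=
  RCA.lift (xOp F lam) (yOp lam p) (tOp F lam) xOp_comm (yOp_comm p) tOp_mul_xOp (tOp_mul_yOp p)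
    (yOp_mul_xOp p)

variable {p}

instance : Module (RCA n p) (PolyMod F lam) :=
  Module.compHom (PolyMod F lam) (polyAction lam p).toRingHom

theorem smul_polyMod_def (h : RCA n p) (f : PolyMod F lam) : h • f = polyAction lam p h f := rfl

instance : IsScalarTower F (RCA n p) (PolyMod F lam) where
  smul_assoc c h f := by
    rw [smul_polyMod_def, smul_polyMod_def, map_smul, LinearMap.smul_apply]

theorem X_smul (i : Fin n) (f : PolyMod F lam) : X p i • f = xOp F lam i f := by
  rw [smul_polyMod_def, polyAction, RCA.lift_X]

theorem Y_smul (i : Fin n) (f : PolyMod F lam) : Y p i • f = yOp lam p i f := by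
  rw [smul_polyMod_def, polyAction, RCA.lift_Y]

theorem t_smul (w : W r n) (f : PolyMod F lam) : t p w • f = tOp F lam w f := by
  rw [smul_polyMod_def, polyAction, RCA.lift_t]

end Poly

end

noncomputable section

/-! ### Comparison of the standard module with the polynomial representation -/

section Comparison

/-- Formulated for commuting elements of a monoid because it is needed both for the `x_i` and for
the Dunkl operators, which live in noncommutative rings. -/
theorem mul_prod_map_pow {M ι : Type*} [Monoid M] [DecidableEq ι] {E : ι → M}
    (hE : ∀ i j, E i * E j = E j * E i) (ν : ι → ℕ) {j : ι} {L : List ι} (hL : L.Nodup)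
    (hj : j ∈ L) :
    E j * (L.map fun i => E i ^ ν i).prod =
      (L.map fun i => E i ^ Function.update ν j (ν j + 1) i).prod := by
  induction L with
  | nil => simp at hj
  | cons a L ih =>
    rw [List.nodup_cons] at hL
    rw [List.map_cons, List.map_cons, List.prod_cons, List.prod_cons]
    by_cases h : a = j
    · subst h
      rw [Function.update_self, pow_succ', mul_assoc]
      congr 3
      refine List.map_congr_left fun i hi => ?_
      rw [Function.update_of_ne]
      rintro rfl
      exact hL.1 hi
    · have hj' : j ∈ L := by
        rcases List.mem_cons.1 hj with h' | h'
        · exact absurd h'.symm h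
        · exact h'
      rw [Function.update_of_ne h, ← ih hL.2 hj', ← mul_assoc, ← mul_assoc]
      congr 1
      exact (Commute.pow_right (hE j a) _)

variable {r n : ℕ} [NeZero r] {F : Type} [Field F] [Algebra ℂ F] {p : Params r F}
  {lam : RPartition r n}

variable (p) in
theorem X_mul_xPow (j : Fin n) (ν : Fin n → ℕ) : X p j * xPow p ν = xPow p (inc ν j) := by
  unfold xPow
  rw [List.ofFn_eq_map, List.ofFn_eq_map]
  exact mul_prod_map_pow (X_mul_X p) ν (List.nodup_finRange n) (List.mem_finRange j)

variable (p) in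
theorem xPow_zero : xPow p (0 : Fin n → ℕ) = 1 := by
  simp [xPow]

theorem map_smul_of_generators {M N : Type*} [AddCommGroup M] [Module F M] [Module (RCA n p) M]
    [IsScalarTower F (RCA n p) M] [AddCommGroup N] [Module F N] [Module (RCA n p) N]
    [IsScalarTower F (RCA n p) N] (f : M →ₗ[F] N) (hX : ∀ (i : Fin n) m, f (X p i • m) = X p i • f m)
    (hY : ∀ (i : Fin n) m, f (Y p i • m) = Y p i • f m)
    (ht : ∀ (w : W r n) m, f (t p w • m) = t p w • f m)
    (h : RCA n p) (m : M) : f (h • m) = h • f m := by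
  have hh : h ∈ Algebra.adjoin F
      (Set.range (X p) ∪ Set.range (Y p) ∪ Set.range (t p) : Set (RCA n p)) := by
    rw [RCA.adjoin_eq_top]; trivial
  induction hh using Algebra.adjoin_induction generalizing m with
  | mem x hx =>
    rcases hx with (⟨i, rfl⟩ | ⟨i, rfl⟩) | ⟨w, rfl⟩
    · exact hX i m
    · exact hY i m
    · exact ht w m
  | algebraMap c => rw [algebraMap_smul, algebraMap_smul, map_smul]
  | add x y _ _ hx hy => rw [add_smul, add_smul, map_add, hx, hy]
  | mul x y _ _ hx hy => rw [mul_smul, mul_smul, hx, hy]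

theorem map_reflSum_smul {M N : Type*} [AddCommGroup M] [Module F M] [Module (RCA n p) M]
    [IsScalarTower F (RCA n p) M] [AddCommGroup N] [Module F N] {τ : W r n →* Module.End F N}
    {f : N →ₗ[F] M} {g : N} (h : ∀ w, f (τ w g) = t p w • f g) (k : ZMod r) (i j : Fin n) :
    f (reflSum (F := F) τ k i j g) = reflSum (F := F) (tHom p) k i j • f g := by
  simp only [reflSum, LinearMap.sum_apply, LinearMap.smul_apply, map_sum, map_smul, h,
    Finset.sum_smul, smul_assoc, tHom_apply]

theorem map_bracket_smul {M N : Type*} [AddCommGroup M] [Module F M] [Module (RCA n p) M]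
    [IsScalarTower F (RCA n p) M] [AddCommGroup N] [Module F N] {τ : W r n →* Module.End F N}
    {f : N →ₗ[F] M} {g : N} (h : ∀ w, f (τ w g) = t p w • f g) (i j : Fin n) :
    f (bracket p τ i j g) = bracket p (tHom p) i j • f g := by
  unfold bracket
  split_ifs
  · simp only [dSum, LinearMap.sub_apply, LinearMap.sum_apply, LinearMap.smul_apply, map_sub,
      map_sum, map_smul, h, sub_smul, Finset.sum_smul, smul_assoc, tHom_apply,
      Module.algebraMap_end_apply, algebraMap_smul, map_reflSum_smul h]
  · rw [LinearMap.smul_apply, map_smul, map_reflSum_smul h, smul_assoc]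

theorem specht_induction {P : Specht F lam → Prop} (v : Specht F lam) (h0 : P 0)
    (hadd : ∀ v w, P v → P w → P (v + w)) (hT : ∀ (c : F) (T : SYT lam), P (c • fillVec F T.1)) :
    P v := by
  refine Finsupp.induction_linear (motive := P) v h0 hadd fun T c => ?_
  have := hT c T
  rwa [fillVec_coe, Finsupp.smul_single, smul_eq_mul, mul_one] at this

theorem map_single {M : Type*} [AddCommGroup M] [Module (RCA n p) M]
    (f : (SYT lam →₀ RCA n p) →ₗ[RCA n p] M) (T : SYT lam) (h : RCA n p) :
    f (Finsupp.single T h) = h • f (Finsupp.single T 1) := by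
  rw [← map_smul, Finsupp.smul_single, smul_eq_mul, mul_one]

/-- The relations of the standard module carry coefficients in the Cherednik algebra, those of `S^λ`
coefficients in `F`. This translation is used for both maps between the two modules. -/
theorem map_youngVec {M : Type*} [AddCommGroup M] [Module F M] [Module (RCA n p) M]
    [IsScalarTower F (RCA n p) M] (f : (SYT lam →₀ RCA n p) →ₗ[RCA n p] M)
    (g : Specht F lam →ₗ[F] M) (hfg : ∀ T : SYT lam, f (Finsupp.single T 1) = g (fillVec F T.1))
    (T : SYT lam) (i j : Fin n) : f (youngVec p T i j) = g (youngOp F i j (fillVec F T.1)) := by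
  have h1 : dF F (T.1 i) (T.1 j) = algebraMap ℂ F (diagCoeff T i j : ℂ) := rfl
  have h2 : eF F (T.1 i) (T.1 j) = algebraMap ℂ F (offCoeff T i j : ℂ) := by
    rw [eF, realHom_apply, eCoeff, offCoeff, dCoeff, invDist]
    split_ifs <;> rfl
  rw [youngOp_fillVec T.2, h1, h2, map_add g, map_smul g, map_smul g, youngVec, map_add f,
    map_single, hfg, algebraMap_smul (RCA n p)]
  congr 1
  by_cases h : IsStandard (T.swap i j)
  · rw [dif_pos h]
    refine (map_single f _ _).trans ?_
    rw [algebraMap_smul (RCA n p)]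
    exact congrArg (_ • ·) (hfg (⟨T.swap i j, h⟩ : SYT lam))
  · rw [dif_neg h, map_zero]
    have h3 : fillVec F ((Equiv.swap i j).trans T.1) = 0 := fillVec_of_not_standard h
    rw [h3, map_zero, smul_zero]

variable (p lam) in
/-- The map from the standard module to the polynomial representation. -/
def toPoly : StdModule p lam →ₗ[RCA n p] PolyMod F lam :=
  Submodule.liftQ _ (Finsupp.linearCombination (RCA n p) fun T : SYT lam =>
    (mono 0 (fillVec F T.1) : PolyMod F lam)) <| by
  rw [Submodule.span_le]
  rintro v hv
  rw [SetLike.mem_coe, LinearMap.mem_ker]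
  have hs : ∀ (T : SYT lam) (h : RCA n p), Finsupp.linearCombination (RCA n p)
      (fun T : SYT lam => (mono 0 (fillVec F T.1) : PolyMod F lam)) (Finsupp.single T h) =
      h • mono 0 (fillVec F T.1) := fun T h => Finsupp.linearCombination_single _ _ _
  induction hv with
  | y T i => rw [hs, Y_smul, yOp_mono_zero]
  | zeta T i =>
    rw [map_sub, hs, hs, t_smul, tOp_mono_zero, zetaElt_eq, spechtRep_diag,
      diagOp_fillVec, weightChar_single, chr_zetaRoot, map_smul, algebraMap_smul (RCA n p), sub_self]
  | s T i j hij =>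
    rw [map_sub, hs, t_smul, tOp_mono_zero, spechtRep_swap F hij,
      map_youngVec _ (mono 0) (fun T => by rw [hs, one_smul]), sub_self]

theorem toPoly_vec (T : SYT lam) : toPoly p lam (vec p T) = mono 0 (fillVec F T.1) := by
  refine (Finsupp.linearCombination_single (RCA n p) (1 : RCA n p) T).trans (one_smul _ _)

variable (p lam) in
/-- The map from the polynomial representation to the standard module. -/
def ofPoly : PolyMod F lam →ₗ[F] StdModule p lam :=
  PolyMod.lift fun ν => Finsupp.linearCombination F fun T : SYT lam => xPow p ν • vec p T

theorem ofPoly_mono_single (ν : Fin n → ℕ) (T : SYT lam) :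
    ofPoly p lam (mono ν (Finsupp.single T 1)) = xPow p ν • vec p T := by
  rw [ofPoly, PolyMod.lift_mono, Finsupp.linearCombination_single, one_smul]

theorem ofPoly_fillVec (T : SYT lam) : ofPoly p lam (mono 0 (fillVec F T.1)) = vec p T := by
  rw [fillVec_coe, ofPoly_mono_single, xPow_zero, one_smul]

theorem vec_rel {x : SYT lam →₀ RCA n p} (h : ModRel p lam x) :
    (Submodule.Quotient.mk x : StdModule p lam) = 0 :=
  (Submodule.Quotient.mk_eq_zero _).2 (Submodule.subset_span h)

theorem mk_single (T : SYT lam) (h : RCA n p) :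
    (Submodule.Quotient.mk (Finsupp.single T h) : StdModule p lam) = h • vec p T := by
  change _ = Submodule.Quotient.mk (h • Finsupp.single T 1)
  rw [Finsupp.smul_single, smul_eq_mul, mul_one]

theorem Y_smul_vec (i : Fin n) (T : SYT lam) : Y p i • vec p T = 0 := by
  rw [← mk_single]
  exact vec_rel (ModRel.y T i)

theorem zetaElt_smul_vec (i : Fin n) (T : SYT lam) :
    t p (zetaElt r i) • vec p T = chr F (T.1 i).β (zetaRoot r) • vec p T := by
  have h := vec_rel (ModRel.zeta (p := p) T i)
  have h2 : t p (zetaElt r i) • vec p T - algebraMap F (RCA n p)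
      (algebraMap ℂ F (zeta r ^ ((T.1 i).β).val)) • vec p T = 0 := by
    rw [← mk_single, ← mk_single]
    exact h
  rw [chr_zetaRoot, sub_eq_zero.1 h2, algebraMap_smul (RCA n p)]

theorem swap_smul_vec {i j : Fin n} (hij : (i : ℕ) + 1 = j) (T : SYT lam) :
    t p (perm r (Equiv.swap i j)) • vec p T =
      ofPoly p lam (mono 0 (youngOp F i j (fillVec F T.1))) := by
  have h := vec_rel (ModRel.s (p := p) T i j hij)
  let f : (SYT lam →₀ RCA n p) →ₗ[RCA n p] StdModule p lam := Submodule.mkQ _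
  have h2 : f (Finsupp.single T (t p (perm r (Equiv.swap i j))) - youngVec p T i j) = 0 := h
  rw [map_sub, sub_eq_zero, map_youngVec f ((ofPoly p lam).comp (mono 0))
    (fun T => (ofPoly_fillVec T).symm)] at h2
  rw [← mk_single]
  exact h2

/-- Induction over the generators of `G(r,1,n)`. -/
theorem W_induction {P : W r n → Prop} (h1 : P 1) (hz : ∀ i, P (zetaElt r i))
    (hs : ∀ i j : Fin n, (i : ℕ) + 1 = j → P (perm r (Equiv.swap i j)))
    (hmul : ∀ v w, P v → P w → P (v * w)) (w : W r n) : P w := by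
  rw [W_eq_diag_mul_perm w]
  apply hmul
  · generalize w.left = a
    have hsingle : ∀ i (u : rootsOfUnity r ℂ), P (diag (Pi.mulSingle i u)) := by
      intro i u
      have hu : u ∈ Set.range fun l : ℕ => zetaRoot r ^ l := by
        have hp : IsPrimitiveRoot (zetaRoot r : ℂˣ) r := by
          rw [← IsPrimitiveRoot.coe_units_iff]
          exact isPrimitiveRoot_zeta r
        obtain ⟨l, -, h⟩ := hp.eq_pow_of_mem_rootsOfUnity u.2
        exact ⟨l, Subtype.ext (by simpa using h)⟩
      obtain ⟨l, rfl⟩ := hu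
      simp only
      rw [← zetaElt_pow]
      induction l with
      | zero => rwa [pow_zero]
      | succ l ih => rw [pow_succ]; exact hmul _ _ ih (hz i)
    have hprod : ∀ s : Finset (Fin n), P (diag (∏ i ∈ s, Pi.mulSingle i (a i))) := by
      intro s
      induction s using Finset.induction_on with
      | empty =>
        rw [Finset.prod_empty]
        have : diag (1 : Fin n → rootsOfUnity r ℂ) = 1 := map_one SemidirectProduct.inl
        rwa [this]
      | insert i s hi ih =>
        rw [Finset.prod_insert hi, diag_mul]
        exact hmul _ _ (hsingle i _) ih
    have := hprod Finset.univ
    rwa [Finset.univ_prod_mulSingle] at this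
  · generalize w.right = σ
    induction σ using perm_induction with
    | h1 =>
      have : perm r (1 : Equiv.Perm (Fin n)) = 1 := map_one SemidirectProduct.inr
      rwa [this]
    | hs i j hij => exact hs i j hij
    | hmul σ τ hσ hτ => rw [perm_mul]; exact hmul _ _ hσ hτ

/-- The standard module prescribes only how the generators of `G(r,1,n)` act on the `v_T`. Both
sides are multiplicative in `w`, so agreement on generators suffices. -/
theorem t_smul_ofPoly_mono_zero (w : W r n) (v : Specht F lam) :
    t p w • ofPoly p lam (mono 0 v) = ofPoly p lam (mono 0 (spechtRep F lam w v)) := by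
  have hext : ∀ w : W r n, (∀ T : SYT lam, t p w • ofPoly p lam (mono 0 (fillVec F T.1)) =
      ofPoly p lam (mono 0 (spechtRep F lam w (fillVec F T.1)))) → ∀ v,
      t p w • ofPoly p lam (mono 0 v) = ofPoly p lam (mono 0 (spechtRep F lam w v)) := by
    intro w hw v
    induction v using specht_induction with
    | h0 =>
      simp only [map_zero, smul_zero]
    | hadd v v' h h' =>
      simp only [map_add, smul_add, h, h']
    | hT c T =>
      simp only [map_smul]
      rw [smul_comm, hw]
  induction w using W_induction generalizing v with
  | h1 => rw [t_one, one_smul, map_one, Module.End.one_apply]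
  | hz i =>
    refine hext _ (fun T => ?_) v
    rw [ofPoly_fillVec, zetaElt_smul_vec, zetaElt_eq, spechtRep_diag, diagOp_fillVec,
      weightChar_single, map_smul, map_smul, ofPoly_fillVec]
  | hs i j hij =>
    refine hext _ (fun T => ?_) v
    rw [ofPoly_fillVec, swap_smul_vec hij, spechtRep_swap F hij]
  | hmul w w' h h' => rw [t_mul, mul_smul, h', h, map_mul, Module.End.mul_apply]

theorem ofPoly_xOp (j : Fin n) (f : PolyMod F lam) :
    ofPoly p lam (xOp F lam j f) = X p j • ofPoly p lam f := by
  induction f using PolyMod.induction with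
  | h0 =>
    simp only [map_zero, smul_zero]
  | hadd f g hf hg =>
    simp only [map_add, smul_add, hf, hg]
  | hmono ν v =>
    rw [xOp_mono]
    induction v using specht_induction with
    | h0 =>
      simp only [map_zero, smul_zero]
    | hadd v v' h h' =>
      simp only [map_add, smul_add, h, h']
    | hT c T =>
      simp only [map_smul, fillVec_coe, ofPoly_mono_single]
      rw [smul_comm (X p j), ← mul_smul, X_mul_xPow]

theorem ofPoly_tOp (w : W r n) (f : PolyMod F lam) :
    ofPoly p lam (tOp F lam w f) = t p w • ofPoly p lam f := by
  induction f using PolyMod.induction_x with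
  | h0 =>
    simp only [map_zero, smul_zero]
  | hadd f g hf hg =>
    simp only [map_add, smul_add, hf, hg]
  | hv v =>
    rw [tOp_mono_zero, t_smul_ofPoly_mono_zero]
  | hx j f hf =>
    rw [← Module.End.mul_apply, tOp_mul_xOp, LinearMap.smul_apply, map_smul, Module.End.mul_apply,
      ofPoly_xOp, ofPoly_xOp, hf, ← mul_smul, ← mul_smul, t_mul_X, smul_assoc]

/-- Induction on the degree: `y_i` is moved past each `x_j` by the same commutator in both modules,
until it reaches `S^λ` and acts there by zero. -/
theorem ofPoly_yOp (i : Fin n) (f : PolyMod F lam) :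
    ofPoly p lam (yOp lam p i f) = Y p i • ofPoly p lam f := by
  induction f using PolyMod.induction_x with
  | h0 =>
    simp only [map_zero, smul_zero]
  | hadd f g hf hg =>
    simp only [map_add, smul_add, hf, hg]
  | hv v =>
    rw [yOp_mono_zero, map_zero]
    induction v using specht_induction with
    | h0 =>
      simp only [map_zero, smul_zero]
    | hadd v v' h h' =>
      simp only [map_add, smul_add, ← h, ← h', add_zero]
    | hT c T =>
      rw [map_smul, map_smul, smul_comm, ofPoly_fillVec, Y_smul_vec, smul_zero]
  | hx j f hf =>
    rw [← Module.End.mul_apply, yOp_mul_xOp, LinearMap.add_apply, map_add, Module.End.mul_apply,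
      ofPoly_xOp, ofPoly_xOp, hf, map_bracket_smul fun w => ofPoly_tOp w f, ← mul_smul, ← mul_smul,
      ← add_smul, Y_mul_X]

theorem ofPoly_smul (h : RCA n p) (f : PolyMod F lam) : ofPoly p lam (h • f) = h • ofPoly p lam f := by
  refine map_smul_of_generators (ofPoly p lam) (fun i f => ?_) (fun i f => ?_) (fun w f => ?_) h f
  · rw [X_smul, ofPoly_xOp]
  · rw [Y_smul, ofPoly_yOp]
  · rw [t_smul, ofPoly_tOp]

/-- Both maps are linear over the Cherednik algebra and match on the generating vectors `v_T`. Since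
the model was constructed independently, no basis theorem for the algebra enters. -/
theorem ofPoly_toPoly (m : StdModule p lam) : ofPoly p lam (toPoly p lam m) = m := by
  let f : (SYT lam →₀ RCA n p) →ₗ[RCA n p] StdModule p lam := Submodule.mkQ _
  obtain ⟨x, rfl⟩ : ∃ x, f x = m := Submodule.Quotient.mk_surjective _ m
  induction x using Finsupp.induction_linear with
  | zero => simp only [map_zero]
  | add x y hx hy => simp only [map_add, hx, hy]
  | single T h =>
    have e : f (Finsupp.single T h) = h • vec p T := mk_single T h
    rw [e, map_smul, ofPoly_smul, toPoly_vec, ofPoly_fillVec]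

theorem xPow_smul_mono_zero (ν : Fin n → ℕ) (v : Specht F lam) :
    xPow p ν • (mono 0 v : PolyMod F lam) = mono ν v := by
  induction hm : ∑ k, ν k generalizing ν with
  | zero =>
    have : ν = 0 := by
      funext k
      exact (Finset.sum_eq_zero_iff.1 hm) k (Finset.mem_univ k)
    rw [this, xPow_zero, one_smul]
  | succ m ih =>
    obtain ⟨k, ν', rfl, h2⟩ := exists_eq_inc hm
    rw [← X_mul_xPow, mul_smul, ih ν' h2, X_smul, xOp_mono]

theorem toPoly_ofPoly (f : PolyMod F lam) : toPoly p lam (ofPoly p lam f) = f := by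
  induction f using PolyMod.induction with
  | h0 =>
    simp only [map_zero]
  | hadd f g hf hg =>
    simp only [map_add, hf, hg]
  | hmono ν v =>
    rw [← xPow_smul_mono_zero (p := p), ofPoly_smul, map_smul]
    congr 1
    induction v using specht_induction with
    | h0 =>
      simp only [map_zero]
    | hadd v v' h h' =>
      simp only [map_add, h, h']
    | hT c T =>
      rw [map_smul, map_smul, ofPoly_fillVec, LinearMap.map_smul_of_tower, toPoly_vec]

variable (p lam) in
/-- The standard module is the polynomial representation. -/
def stdEquiv : StdModule p lam ≃ₗ[RCA n p] PolyMod F lam :=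
  { toPoly p lam with
    invFun := ofPoly p lam
    left_inv := ofPoly_toPoly
    right_inv := toPoly_ofPoly }

theorem stdEquiv_vec (T : SYT lam) : stdEquiv p lam (vec p T) = mono 0 (fillVec F T.1) :=
  toPoly_vec T

end Comparison

end

noncomputable section

/-! ### The order on exponents -/

section Order

variable {n : ℕ}

theorem wPerm_val (μ : Fin n → ℕ) (i : Fin n) : ((wPerm μ i : Fin n) : ℕ) = wFun μ i := rfl

theorem wPerm_lt_of {μ : Fin n → ℕ} {p q : Fin n} (h : μ p < μ q ∨ μ p = μ q ∧ q < p) :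
    wPerm μ p < wPerm μ q := by
  rw [Fin.lt_def, wPerm_val, wPerm_val]
  exact wFun_lt_wFun μ h

theorem wPerm_lt_iff {μ : Fin n → ℕ} {p q : Fin n} :
    wPerm μ p < wPerm μ q ↔ μ p < μ q ∨ μ p = μ q ∧ q < p := by
  refine ⟨fun h => ?_, wPerm_lt_of⟩
  by_contra hn
  have hpq : p ≠ q := by rintro rfl; exact lt_irrefl _ h
  refine lt_asymm h (wPerm_lt_of ?_)
  rcases lt_trichotomy (μ p) (μ q) with h1 | h1 | h1
  · exact absurd (Or.inl h1) hn
  · right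
    refine ⟨h1.symm, lt_of_le_of_ne (not_lt.1 fun h2 => hn (Or.inr ⟨h1, h2⟩)) hpq⟩
  · exact Or.inl h1

/-- The condition says that `w` composed with the inverse of `wPerm μ` is strictly increasing, and a
strictly increasing permutation is the identity. -/
theorem eq_wPerm {μ : Fin n → ℕ} {w : Equiv.Perm (Fin n)}
    (h : ∀ p q, (μ p < μ q ∨ μ p = μ q ∧ q < p) → w p < w q) : w = wPerm μ := by
  have h1 : StrictMono fun k => w ((wPerm μ)⁻¹ k) := by
    intro a b hab
    refine h _ _ (wPerm_lt_iff.1 ?_)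
    simpa using hab
  have h2 := (h1.range_inj (strictMono_id (α := Fin n))).1 (by
    rw [Set.range_id, Set.range_eq_univ]
    exact w.surjective.comp (wPerm μ)⁻¹.surjective)
  ext k
  have := congrFun h2 (wPerm μ k)
  simpa using congrArg Fin.val this

/-! Lengths and transpositions -/

theorem swap_order {i j p q : Fin n} (hij : i < j) (hpq : p < q)
    (h : ¬ Equiv.swap i j p < Equiv.swap i j q) :
    (p = i ∧ q = j) ∨ (p = i ∧ i < q ∧ q < j) ∨ (q = j ∧ i < p ∧ p < j) := by
  rw [Equiv.swap_apply_def, Equiv.swap_apply_def] at h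
  split_ifs at h <;> grind

/-- An injection from the inversions of `w` to those of `w * swap i j` that misses the inversion
`(i, j)`: transport a pair by the transposition if this keeps its order, and leave it in place
otherwise. -/
theorem len_lt_mul_swap {w : Equiv.Perm (Fin n)} {i j : Fin n} (hij : i < j) (hw : w i < w j) :
    len w < len (w * Equiv.swap i j) := by
  classical
  set s := Equiv.swap i j with hs
  unfold len
  set A := Finset.univ.filter fun q : Fin n × Fin n => q.1 < q.2 ∧ w q.2 < w q.1
  set B := Finset.univ.filter fun q : Fin n × Fin n => q.1 < q.2 ∧ (w * s) q.2 < (w * s) q.1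
  have hA : ∀ p q, (p, q) ∈ A ↔ p < q ∧ w q < w p := fun p q => by simp [A]
  have hB : ∀ p q, (p, q) ∈ B ↔ p < q ∧ w (s q) < w (s p) := fun p q =>
    Finset.mem_filter.trans (by simp)
  have hsi : s i = j := Equiv.swap_apply_left i j
  have hsj : s j = i := Equiv.swap_apply_right i j
  have hss : ∀ k, s (s k) = k := fun k => Equiv.swap_apply_self i j k
  let f : Fin n × Fin n → Fin n × Fin n := fun q => if s q.1 < s q.2 then (s q.1, s q.2) else q
  have hfB : ∀ q ∈ A, f q ∈ B.erase (i, j) := by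
    rintro ⟨p, q⟩ hq
    rw [hA] at hq
    simp only [f]
    split_ifs with h
    · rw [Finset.mem_erase, hB]
      refine ⟨?_, h, by simpa only [hss] using hq.2⟩
      rintro he
      rw [Prod.mk.injEq] at he
      have h1 : p = j := by rw [← hss p, he.1, hsi]
      have h2 : q = i := by rw [← hss q, he.2, hsj]
      exact lt_asymm hij (by rw [← h1, ← h2]; exact hq.1)
    · rw [Finset.mem_erase, hB]
      rcases swap_order hij hq.1 h with ⟨rfl, rfl⟩ | ⟨rfl, h1, h2⟩ | ⟨rfl, h1, h2⟩
      · exact absurd hw (lt_asymm hq.2)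
      · refine ⟨fun he => h2.ne (Prod.mk.inj he).2, hq.1, ?_⟩
        have h3 : s q = q := Equiv.swap_apply_of_ne_of_ne h1.ne' h2.ne
        rw [h3, hsi]
        exact hq.2.trans hw
      · refine ⟨fun he => h1.ne' (Prod.mk.inj he).1, hq.1, ?_⟩
        have h3 : s p = p := Equiv.swap_apply_of_ne_of_ne h1.ne' h2.ne
        rw [h3, hsj]
        exact hw.trans hq.2
  have hfinj : Set.InjOn f A := by
    rintro ⟨p, q⟩ hq ⟨p', q'⟩ hq' he
    rw [Finset.mem_coe, hA] at hq hq'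
    simp only [f] at he
    split_ifs at he with h h' h'
    · rw [Prod.mk.injEq] at he
      exact Prod.ext (s.injective he.1) (s.injective he.2)
    · rw [Prod.mk.injEq] at he
      rw [← he.1, ← he.2, hss, hss] at h'
      exact absurd hq.1 h'
    · rw [Prod.mk.injEq] at he
      rw [he.1, he.2, hss, hss] at h
      exact absurd hq'.1 h
    · exact he
  have hmem : (i, j) ∈ B := by
    rw [hB, hsi, hsj]
    exact ⟨hij, hw⟩
  calc A.card ≤ (B.erase (i, j)).card := Finset.card_le_card_of_injOn f hfB hfinj
    _ < B.card := Finset.card_erase_lt_of_mem hmem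

/-! Rearrangements and dominance -/

/-- The permutation which sorts `μ` into non-increasing order. -/
def plusPerm (μ : Fin n → ℕ) : Equiv.Perm (Fin n) := Fin.revPerm.trans (Tuple.sort μ)

theorem plus_eq (μ : Fin n → ℕ) (i : Fin n) : plus μ i = μ (plusPerm μ i) := rfl

theorem plus_antitone (μ : Fin n → ℕ) : Antitone (plus μ) := fun _ _ h =>
  Tuple.monotone_sort μ (Fin.rev_le_rev.2 h)

theorem plus_comp_perm (μ : Fin n → ℕ) (σ : Equiv.Perm (Fin n)) : plus (μ ∘ σ) = plus μ := by
  funext i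
  exact congrFun (Tuple.comp_perm_comp_sort_eq_comp_sort (f := μ) (σ := σ)) i.rev

theorem sum_plus {M : Type*} [AddCommMonoid M] (μ : Fin n → ℕ) (g : ℕ → M) :
    ∑ i, g (plus μ i) = ∑ i, g (μ i) :=
  Equiv.sum_comp (plusPerm μ) (fun i => g (μ i))

/-- After removal of the common part, every term on the left is at most `f m` and every term on the
right at least `f m`, with equally many terms on both sides. -/
theorem sum_le_of_antitone {f : Fin n → ℕ} (hf : Antitone f) (m : Fin n) {A : Finset (Fin n)}
    (hA : A.card = (Finset.univ.filter fun i => i ≤ m).card) :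
    ∑ i ∈ A, f i ≤ ∑ i ∈ Finset.univ.filter (fun i => i ≤ m), f i := by
  classical
  set B := Finset.univ.filter fun i : Fin n => i ≤ m with hB
  rw [← Finset.sum_sdiff (Finset.inter_subset_left (s₁ := A) (s₂ := B)),
    ← Finset.sum_sdiff (Finset.inter_subset_right (s₁ := A) (s₂ := B))]
  have hc : (A \ (A ∩ B)).card = (B \ (A ∩ B)).card := by
    rw [Finset.card_sdiff_of_subset Finset.inter_subset_left,
      Finset.card_sdiff_of_subset Finset.inter_subset_right, hA]
  refine Nat.add_le_add_right ?_ _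
  calc ∑ i ∈ A \ (A ∩ B), f i ≤ (A \ (A ∩ B)).card • f m := by
        refine Finset.sum_le_card_nsmul _ _ _ fun i hi => hf ?_
        simp only [hB, Finset.mem_sdiff, Finset.mem_inter, Finset.mem_filter, Finset.mem_univ,
          true_and, not_and, not_le] at hi
        exact (hi.2 hi.1).le
    _ = (B \ (A ∩ B)).card • f m := by rw [hc]
    _ ≤ _ := by
        refine Finset.card_nsmul_le_sum _ _ _ fun i hi => hf ?_
        simp only [hB, Finset.mem_sdiff, Finset.mem_filter, Finset.mem_univ, true_and] at hi
        exact hi.1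

theorem sum_le_sum_plus (μ : Fin n → ℕ) (m : Fin n) {A : Finset (Fin n)}
    (hA : A.card = (Finset.univ.filter fun i => i ≤ m).card) :
    ∑ i ∈ A, μ i ≤ ∑ i ∈ Finset.univ.filter (fun i => i ≤ m), plus μ i := by
  classical
  refine le_trans (le_of_eq ?_) (sum_le_of_antitone (plus_antitone μ) m
    (A := A.map (plusPerm μ).symm.toEmbedding) (by rw [Finset.card_map, hA]))
  rw [Finset.sum_map]
  refine Finset.sum_congr rfl fun i _ => ?_
  rw [plus_eq]
  simp

theorem DomLE.trans {f g h : Fin n → ℕ} (h1 : DomLE f g) (h2 : DomLE g h) : DomLE f h :=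
  ⟨h1.1.trans h2.1, fun m => (h1.2 m).trans (h2.2 m)⟩

theorem DomLE.antisymm {f g : Fin n → ℕ} (h1 : DomLE f g) (h2 : DomLE g f) : f = g := by
  funext m
  induction m using WellFoundedLT.induction with
  | _ m ih =>
    have h : ∀ u : Fin n → ℕ, ∑ i ∈ Finset.univ.filter (fun i => i ≤ m), u i =
        u m + ∑ i ∈ Finset.univ.filter (fun i => i < m), u i := by
      intro u
      rw [← Finset.sum_insert (by simp)]
      refine Finset.sum_congr ?_ fun _ _ => rfl
      ext k
      simp [le_iff_eq_or_lt]
    have h3 := le_antisymm (h1.2 m) (h2.2 m)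
    rw [h f, h g, Finset.sum_congr rfl fun i hi => ih i (Finset.mem_filter.1 hi).2] at h3
    exact Nat.add_right_cancel h3

/-- A criterion for dominance in which nothing is sorted: partial sums of the rearrangement are the
maximal sums over subsets of a given size. -/
theorem DomLE.plus_of_exists {μ ν : Fin n → ℕ} (hs : ∑ i, ν i = ∑ i, μ i)
    (h : ∀ A : Finset (Fin n), ∃ A' : Finset (Fin n), A'.card = A.card ∧
      ∑ i ∈ A, ν i ≤ ∑ i ∈ A', μ i) : DomLE (plus ν) (plus μ) := by
  refine ⟨(sum_plus ν id).trans (hs.trans (sum_plus μ id).symm), fun m => ?_⟩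
  obtain ⟨A', h1, h2⟩ := h ((Finset.univ.filter fun i => i ≤ m).map (plusPerm ν).toEmbedding)
  rw [Finset.card_map] at h1
  rw [Finset.sum_map] at h2
  exact h2.trans (sum_le_sum_plus μ m h1)

/-- Moving two entries towards each other lowers the rearrangement. A subset that meets the pair in
one index is compared with the one that contains the index of the larger entry of `μ` instead. -/
theorem weightLT_of_max_lt {μ ν : Fin n → ℕ} {i j : Fin n} (hij : i ≠ j)
    (hoff : ∀ k, k ≠ i → k ≠ j → ν k = μ k) (hsum : ν i + ν j = μ i + μ j)
    (hmax : max (ν i) (ν j) < max (μ i) (μ j)) : WeightLT ν μ := by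
  classical
  have split : ∀ g : ℕ → ℕ, ∀ ρ : Fin n → ℕ, ∑ k, g (ρ k) =
      (g (ρ i) + g (ρ j)) + ∑ k ∈ (Finset.univ.erase i).erase j, g (ρ k) := by
    intro g ρ
    rw [← Finset.add_sum_erase _ _ (Finset.mem_univ i), ← Finset.add_sum_erase (a := j),
      add_assoc]
    simp [hij.symm]
  have heq : ∀ g : ℕ → ℕ, ∑ k ∈ (Finset.univ.erase i).erase j, g (ν k) =
      ∑ k ∈ (Finset.univ.erase i).erase j, g (μ k) := fun g =>
    Finset.sum_congr rfl fun k hk => by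
      simp only [Finset.mem_erase, Finset.mem_univ, and_true] at hk
      rw [hoff k hk.2 hk.1]
  left
  constructor
  · refine DomLE.plus_of_exists ?_ fun A => ?_
    · have h1 := split id ν
      have h2 := split id μ
      have h3 := heq id
      simp only [id] at h1 h2 h3
      omega
    · have hsing : ∀ B : Finset (Fin n), i ∉ B → j ∉ B → ∑ k ∈ B, ν k = ∑ k ∈ B, μ k :=
        fun B hi hj => Finset.sum_congr rfl fun k hk =>
          hoff k (fun h => hi (h ▸ hk)) (fun h => hj (h ▸ hk))
      obtain ⟨m, hm, hmm⟩ : ∃ m, (m = i ∨ m = j) ∧ μ m = max (μ i) (μ j) := by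
        rcases le_total (μ i) (μ j) with h | h
        · exact ⟨j, Or.inr rfl, (max_eq_right h).symm⟩
        · exact ⟨i, Or.inl rfl, (max_eq_left h).symm⟩
      have hone : ∀ B : Finset (Fin n), ∀ k, i ∉ B → j ∉ B → (k = i ∨ k = j) →
          ∃ A' : Finset (Fin n), A'.card = (insert k B).card ∧
            ∑ l ∈ insert k B, ν l ≤ ∑ l ∈ A', μ l := by
        intro B k hi hj hk
        have hkB : k ∉ B := by rcases hk with rfl | rfl <;> assumption
        have hmB : m ∉ B := by rcases hm with rfl | rfl <;> assumption
        refine ⟨insert m B, ?_, ?_⟩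
        · rw [Finset.card_insert_of_notMem hkB, Finset.card_insert_of_notMem hmB]
        · rw [Finset.sum_insert hkB, Finset.sum_insert hmB, hsing B hi hj, hmm]
          have : ν k ≤ max (ν i) (ν j) := by rcases hk with rfl | rfl <;> simp
          omega
      by_cases hi : i ∈ A
      · by_cases hj : j ∈ A
        · refine ⟨A, rfl, le_of_eq ?_⟩
          rw [← Finset.add_sum_erase _ _ hi, ← Finset.add_sum_erase _ μ hi,
            ← Finset.add_sum_erase (A.erase i) _ (Finset.mem_erase.2 ⟨hij.symm, hj⟩),
            ← Finset.add_sum_erase (A.erase i) μ (Finset.mem_erase.2 ⟨hij.symm, hj⟩),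
            hsing ((A.erase i).erase j) (by simp) (by simp)]
          omega
        · have := hone (A.erase i) i (by simp) (by simp [hj]) (Or.inl rfl)
          rwa [Finset.insert_erase hi] at this
      · by_cases hj : j ∈ A
        · have := hone (A.erase j) j (by simp [hi]) (by simp) (Or.inr rfl)
          rwa [Finset.insert_erase hj] at this
        · exact ⟨A, rfl, (hsing A hi hj).le⟩
  · intro he
    -- Strictness comes from the sum of squares: it is invariant under rearrangement, but smaller
    -- for two numbers of equal sum that are closer together.
    have h1 : ∑ k, ν k ^ 2 = ∑ k, μ k ^ 2 := by
      rw [← sum_plus ν (· ^ 2), he, sum_plus μ (· ^ 2)]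
    rw [split (· ^ 2) ν, split (· ^ 2) μ, heq (· ^ 2)] at h1
    have h2 : ν i ^ 2 + ν j ^ 2 = μ i ^ 2 + μ j ^ 2 := Nat.add_right_cancel h1
    rcases le_total (ν i) (ν j) with h3 | h3 <;> rcases le_total (μ i) (μ j) with h4 | h4 <;>
      simp only [max_eq_left, max_eq_right, h3, h4] at hmax <;> nlinarith

theorem weightLT_trans {μ ν ρ : Fin n → ℕ} (h1 : WeightLT μ ν) (h2 : WeightLT ν ρ) :
    WeightLT μ ρ := by
  rcases h1 with ⟨h1, h1'⟩ | ⟨h1, h1'⟩ <;> rcases h2 with ⟨h2, h2'⟩ | ⟨h2, h2'⟩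
  · refine Or.inl ⟨h1.trans h2, fun h => h1' (h1.antisymm ?_)⟩
    rwa [h]
  · exact Or.inl ⟨h2 ▸ h1, h2 ▸ h1'⟩
  · exact Or.inl ⟨h1 ▸ h2, h1 ▸ h2'⟩
  · exact Or.inr ⟨h1.trans h2, h1'.trans h2'⟩

theorem BruhatLT.len_lt {v w : Equiv.Perm (Fin n)} (h : BruhatLT v w) : len v < len w := by
  induction h with
  | single h => exact h.2
  | tail _ h ih => exact ih.trans h.2

theorem weightLT_irrefl (μ : Fin n → ℕ) : ¬ WeightLT μ μ := by
  rintro (⟨-, h⟩ | ⟨-, h⟩)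
  · exact h rfl
  · exact lt_irrefl _ h.len_lt

theorem WeightLT.sum_eq {μ ν : Fin n → ℕ} (h : WeightLT ν μ) : ∑ i, ν i = ∑ i, μ i := by
  refine (sum_plus ν id).symm.trans (Eq.trans ?_ (sum_plus μ id))
  rcases h with ⟨h, -⟩ | ⟨h, -⟩
  · exact h.1
  · rw [h]

theorem finite_weightLT (μ : Fin n → ℕ) : {ν | WeightLT ν μ}.Finite := by
  refine (Set.finite_Iic (fun _ : Fin n => ∑ i, μ i)).subset fun ν hν i => ?_
  rw [← WeightLT.sum_eq hν]
  exact Finset.single_le_sum (f := ν) (fun _ _ => Nat.zero_le _) (Finset.mem_univ i)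

/-- An intermediate entry equal to one of the two swapped ones would change how ties are broken;
without such entries the sorting permutation simply absorbs the transposition. -/
theorem wPerm_comp_swap {μ : Fin n → ℕ} {i j : Fin n} (hij : i < j) (hne : μ i ≠ μ j)
    (hk : ∀ k, i < k → k < j → μ k ≠ μ i ∧ μ k ≠ μ j) :
    wPerm (μ ∘ Equiv.swap i j) = wPerm μ * Equiv.swap i j := by
  refine (eq_wPerm fun p q h => ?_).symm
  rw [Equiv.Perm.mul_apply, Equiv.Perm.mul_apply, wPerm_lt_iff]
  rcases h with h | ⟨h, hqp⟩
  · exact Or.inl h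
  · refine Or.inr ⟨h, ?_⟩
    by_contra hn
    have h' : μ (Equiv.swap i j p) = μ (Equiv.swap i j q) := h
    rcases swap_order hij hqp hn with ⟨rfl, rfl⟩ | ⟨rfl, h1, h2⟩ | ⟨rfl, h1, h2⟩
    · rw [Equiv.swap_apply_left, Equiv.swap_apply_right] at h'
      exact hne h'
    · rw [Equiv.swap_apply_left, Equiv.swap_apply_of_ne_of_ne h1.ne' h2.ne] at h'
      exact (hk p h1 h2).2 h'
    · rw [Equiv.swap_apply_right, Equiv.swap_apply_of_ne_of_ne h1.ne' h2.ne] at h'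
      exact (hk q h1 h2).1 h'.symm

/-- If no entry strictly between equals an end value, `wPerm` changes by one transposition and gets
shorter. If the entry at `k` does, the swap is a composite of two shorter ones through `k`, because
the third swap that would be needed exchanges equal entries. -/
theorem weightLT_comp_swap {μ : Fin n → ℕ} {i j : Fin n} (hij : i < j) (h : μ j < μ i) :
    WeightLT (μ ∘ Equiv.swap i j) μ := by
  induction hd : (j : ℕ) - i using Nat.strong_induction_on generalizing i j μ with
  | _ d ih =>
    by_cases hk : ∃ k, i < k ∧ k < j ∧ (μ k = μ i ∨ μ k = μ j)
    · obtain ⟨k, hik, hkj, hk⟩ := hk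
      have e1 : Equiv.swap i j k = k := Equiv.swap_apply_of_ne_of_ne hik.ne' hkj.ne
      rw [Fin.lt_def] at hik hkj
      rcases hk with hk | hk
      · have h1 := ih (j - k) (by omega) (i := k) (j := j) (μ := μ) hkj (by omega) rfl
        have h2 := ih (k - i) (by omega) (i := i) (j := k) (μ := μ ∘ Equiv.swap k j) hik (by
          have : Equiv.swap k j i = i := Equiv.swap_apply_of_ne_of_ne
            (Fin.ne_of_lt hik) (Fin.ne_of_lt hij)
          simp only [Function.comp_apply, this, Equiv.swap_apply_left]
          exact h) rfl
        convert weightLT_trans h2 h1 using 1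
        funext l
        simp only [Function.comp_apply, Equiv.swap_apply_def]
        split_ifs <;> grind
      · have h1 := ih (k - i) (by omega) (i := i) (j := k) (μ := μ) hik (by omega) rfl
        have h2 := ih (j - k) (by omega) (i := k) (j := j) (μ := μ ∘ Equiv.swap i k) hkj (by
          have : Equiv.swap i k j = j := Equiv.swap_apply_of_ne_of_ne
            (Fin.ne_of_gt hij) (Fin.ne_of_gt hkj)
          simp only [Function.comp_apply, this, Equiv.swap_apply_right]
          exact h) rfl
        convert weightLT_trans h2 h1 using 1
        funext l
        simp only [Function.comp_apply, Equiv.swap_apply_def]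
        split_ifs <;> grind
    · push Not at hk
      have e := wPerm_comp_swap hij h.ne' hk
      refine Or.inr ⟨plus_comp_perm μ _, Relation.TransGen.single ⟨⟨i, j, hij.ne, ?_⟩, ?_⟩⟩
      · rw [e, mul_assoc, Equiv.swap_mul_self, mul_one]
      · rw [e]
        have h1 : (wPerm μ * Equiv.swap i j) i < (wPerm μ * Equiv.swap i j) j := by
          simpa using wPerm_lt_of (Or.inl h)
        have h2 := len_lt_mul_swap hij h1
        rwa [mul_assoc, Equiv.swap_mul_self, mul_one] at h2

end Order

end

noncomputable section

/-! ### Simultaneous eigenvectors of commuting triangular operators -/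

section Triangular

variable {F M I K : Type*} [Field F] [AddCommGroup M] [Module F M] (b : Module.Basis I F M)
  (R : I → I → Prop) (L : K → Module.End F M) (χ : I → K → F)

/-- The span of the basis vectors strictly below `b i`. -/
def lower (i : I) : Submodule F M := Submodule.span F (b '' {j | R j i})

/-- The operators `L k` are triangular with respect to `R`, with diagonal entries `χ i k`. -/
def IsTriangular : Prop := ∀ i k, L k (b i) - χ i k • b i ∈ lower b R i

variable {b R L χ}

theorem lower_mono [IsTrans I R] {i j : I} (h : R j i) : lower b R j ≤ lower b R i :=
  Submodule.span_mono (Set.image_mono fun _ hl => _root_.trans (r := R) hl h)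

theorem mem_lower_of {i j : I} (h : R j i) : b j ∈ lower b R i :=
  Submodule.subset_span ⟨j, h, rfl⟩

theorem repr_eq_zero_of_mem_lower {i j : I} {x : M} (hx : x ∈ lower b R i) (h : ¬ R j i) :
    b.repr x j = 0 := by
  by_contra hn
  exact h ((b.mem_span_image.1 hx) (Finsupp.mem_support_iff.2 hn))

theorem IsTriangular.repr_apply (hL : IsTriangular b R L χ) (i j : I) (k : K) (h : ¬ R j i) :
    b.repr (L k (b i)) j = χ i k * b.repr (b i) j := by
  have := repr_eq_zero_of_mem_lower (hL i k) h
  rw [map_sub, Finsupp.sub_apply, map_smul, Finsupp.smul_apply, smul_eq_mul] at this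
  exact sub_eq_zero.1 this

theorem IsTriangular.lower_le (hL : IsTriangular b R L χ) [IsTrans I R] (i : I) (k : K) :
    lower b R i ≤ (lower b R i).comap (L k) := by
  refine Submodule.span_le.2 ?_
  rintro _ ⟨j, hj, rfl⟩
  have h1 := lower_mono hj (hL j k)
  have h2 := (lower b R i).add_mem h1 ((lower b R i).smul_mem (χ j k) (mem_lower_of hj))
  rwa [sub_add_cancel] at h2

/-- Compare the coefficients at an index that is maximal in the support: no other basis vector of
the support contributes there. -/
theorem IsTriangular.eigenvalue_eq (hL : IsTriangular b R L χ) {g : M} {c : K → F}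
    (hg : ∀ k, L k g = c k • g) {j : I} (hj : b.repr g j ≠ 0)
    (hmax : ∀ l, b.repr g l ≠ 0 → ¬ R j l) (k : K) : c k = χ j k := by
  have h1 : b.repr (L k g) j = χ j k * b.repr g j := by
    conv_lhs => rw [← b.linearCombination_repr g, Finsupp.linearCombination_apply, Finsupp.sum,
      map_sum, map_sum, Finsupp.finsetSum_apply]
    rw [Finset.sum_eq_single j]
    · rw [map_smul, map_smul, Finsupp.smul_apply, smul_eq_mul,
        hL.repr_apply _ _ _ (hmax j hj), b.repr_self, Finsupp.single_eq_same]
      ring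
    · intro l hl hne
      rw [map_smul, map_smul, Finsupp.smul_apply, smul_eq_mul,
        hL.repr_apply _ _ _ (hmax l (Finsupp.mem_support_iff.1 hl)), b.repr_self,
        Finsupp.single_eq_of_ne hne.symm, mul_zero, mul_zero]
    · intro h
      exact absurd (Finsupp.mem_support_iff.2 hj) h
  rw [hg, map_smul, Finsupp.smul_apply, smul_eq_mul] at h1
  exact mul_right_cancel₀ hj h1

/-- A nonzero eigenvector has a maximal index in its support, and its eigenvalues are those of that
index. By separation the index is `i`, whose coefficient vanishes. -/
theorem IsTriangular.eq_zero (hL : IsTriangular b R L χ) [IsTrans I R] [Std.Irrefl R]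
    (hχ : Function.Injective χ) {g : M} {i : I} (hg : ∀ k, L k g = χ i k • g)
    (hi : b.repr g i = 0) : g = 0 := by
  by_contra hne
  have hs : (b.repr g).support.Nonempty := by
    rw [Finsupp.support_nonempty_iff]
    exact fun h => hne (b.repr.map_eq_zero_iff.1 h)
  let Q : (b.repr g).support → (b.repr g).support → Prop := fun x y => R y x
  have : IsTrans _ Q := ⟨fun x y z h1 h2 => _root_.trans (r := R) h2 h1⟩
  have : Std.Irrefl Q := ⟨fun x => irrefl (r := R) x.1⟩
  obtain ⟨j, -, hj⟩ := (Finite.wellFounded_of_trans_of_irrefl Q).has_min Set.univ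
    ⟨⟨_, hs.choose_spec⟩, trivial⟩
  have hjs := Finsupp.mem_support_iff.1 j.2
  have h := hL.eigenvalue_eq hg hjs fun l hl hR =>
    hj ⟨l, Finsupp.mem_support_iff.2 hl⟩ trivial hR
  have : i = j.1 := hχ (funext h)
  exact hjs (this ▸ hi)

theorem IsTriangular.eq_smul (hL : IsTriangular b R L χ) [IsTrans I R] [Std.Irrefl R]
    (hχ : Function.Injective χ) {f g : M} {i : I} (hf : ∀ k, L k f = χ i k • f)
    (hg : ∀ k, L k g = χ i k • g) (hi : b.repr f i = 1) : g = b.repr g i • f := by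
  refine sub_eq_zero.1 (hL.eq_zero hχ (i := i) (fun k => ?_) ?_)
  · rw [map_sub, map_smul, hf, hg, smul_sub, smul_comm]
  · rw [map_sub, map_smul, Finsupp.sub_apply, Finsupp.smul_apply, hi, smul_eq_mul, mul_one,
      sub_self]

theorem repr_eq_one_of_sub_mem_lower [Std.Irrefl R] {f : M} {i : I}
    (hf : f - b i ∈ lower b R i) : b.repr f i = 1 := by
  have := repr_eq_zero_of_mem_lower hf (irrefl (r := R) i)
  rw [map_sub, Finsupp.sub_apply, b.repr_self, Finsupp.single_eq_same] at this
  exact sub_eq_zero.1 this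

theorem IsTriangular.eigenvalue_of_leading (hL : IsTriangular b R L χ) [IsTrans I R]
    [Std.Irrefl R] {f : M} {i : I} {c : K → F} (hf : f - b i ∈ lower b R i)
    (hc : ∀ k, L k f = c k • f) (k : K) : c k = χ i k := by
  refine hL.eigenvalue_eq hc (by rw [repr_eq_one_of_sub_mem_lower hf]; exact one_ne_zero)
    (fun l hl hR => hl ?_) k
  have h1 : ¬ R l i := fun h => irrefl (r := R) i (_root_.trans (r := R) hR h)
  have := repr_eq_zero_of_mem_lower hf h1
  rw [map_sub, Finsupp.sub_apply, b.repr_self, Finsupp.single_eq_of_ne, sub_zero] at this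
  · exact this
  · rintro rfl
    exact irrefl (r := R) l hR

/-- The eigenvector is the image of `b i` under the product over all `j` below `i` of the factors
`(L - χ_j) / (χ_i - χ_j)`, each formed with an operator that separates `i` from `j`. This product
preserves the leading term and annihilates everything lower. -/
theorem IsTriangular.exists_eigenvector [Nonempty K] (hL : IsTriangular b R L χ) [IsTrans I R]
    [Std.Irrefl R] (hfin : ∀ i, {j | R j i}.Finite) (hχ : Function.Injective χ)
    (hcomm : ∀ k l, Commute (L k) (L l)) (i : I) :
    ∃ f, f - b i ∈ lower b R i ∧ ∀ k, L k f = χ i k • f := by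
  classical
  -- The choice of operator matters only for `j` below `i`; an arbitrary one is taken elsewhere to
  -- make the choice total.
  have hsep : ∀ j : I, ∃ k, R j i → χ i k ≠ χ j k := by
    intro j
    by_cases h : R j i
    · have hne : χ i ≠ χ j := fun h' => irrefl (r := R) i (hχ h' ▸ h)
      obtain ⟨k, hk⟩ := Function.ne_iff.1 hne
      exact ⟨k, fun _ => hk⟩
    · exact ⟨Classical.arbitrary K, fun h' => absurd h' h⟩
  choose κ hκ using hsep
  let A : I → Module.End F M := fun j =>
    (χ i (κ j) - χ j (κ j))⁻¹ • (L (κ j) - algebraMap F _ (χ j (κ j)))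
  have hAL : ∀ j k, Commute (A j) (L k) := fun j k =>
    Commute.smul_left ((hcomm _ _).sub_left (Algebra.commutes _ _)) _
  have hAA : ∀ j l, Commute (A j) (A l) := fun j l =>
    Commute.smul_right ((hAL _ _).sub_right (Algebra.commutes _ _).symm) _
  have hAb : ∀ j, A j (b j) ∈ lower b R j := by
    intro j
    simp only [A, LinearMap.smul_apply, LinearMap.sub_apply, Module.algebraMap_end_apply]
    exact Submodule.smul_mem _ _ (hL j _)
  have hAlow : ∀ j, ∀ x ∈ lower b R i, A j x ∈ lower b R i := by
    intro j x hx
    simp only [A, LinearMap.smul_apply, LinearMap.sub_apply, Module.algebraMap_end_apply]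
    exact Submodule.smul_mem _ _ (Submodule.sub_mem _ (hL.lower_le i _ hx)
      (Submodule.smul_mem _ _ hx))
  have hAi : ∀ j, R j i → A j (b i) - b i ∈ lower b R i := by
    intro j hj
    have hne : χ i (κ j) - χ j (κ j) ≠ 0 := sub_ne_zero.2 (hκ j hj)
    have e : A j (b i) - b i =
        (χ i (κ j) - χ j (κ j))⁻¹ • (L (κ j) (b i) - χ i (κ j) • b i) := by
      simp only [A, LinearMap.smul_apply, LinearMap.sub_apply, Module.algebraMap_end_apply]
      have e' : b i = (χ i (κ j) - χ j (κ j))⁻¹ • (χ i (κ j) - χ j (κ j)) • b i := by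
        rw [smul_smul, inv_mul_cancel₀ hne, one_smul]
      rw [sub_eq_iff_eq_add]
      conv_rhs => rhs; rw [e']
      rw [← smul_add]
      congr 1
      module
    rw [e]
    exact Submodule.smul_mem _ _ (hL i _)
  have hPcomm : ∀ S : Finset I, (S : Set I).Pairwise (Function.onFun Commute A) :=
    fun S x _ y _ _ => hAA x y
  let P : Finset I → Module.End F M := fun S => S.noncommProd A (hPcomm S)
  have hPL : ∀ S k, Commute (L k) (P S) := fun S k =>
    Finset.noncommProd_commute S A (hPcomm S) (L k) fun j _ => (hAL j k).symm
  -- The set must contain everything below `j`: the factor of `j`, applied first, sends `b j` to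
  -- lower basis vectors, and the remaining factors kill these by induction.
  have hkill : ∀ m : ℕ, ∀ S : Finset I, S.card = m → ∀ j, j ∈ S → (∀ l, R l j → l ∈ S) →
      P S (b j) = 0 := by
    intro m
    induction m with
    | zero =>
      intro S hS j hj
      rw [Finset.card_eq_zero.1 hS] at hj
      simp at hj
    | succ m ih =>
      intro S hS j hj hl
      have e : P S = P (S.erase j) * A j :=
        (Finset.noncommProd_erase_mul S hj A (hPcomm S)).symm
      rw [e, Module.End.mul_apply]
      have hle : lower b R j ≤ LinearMap.ker (P (S.erase j)) := by
        refine Submodule.span_le.2 ?_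
        rintro _ ⟨l, hlj, rfl⟩
        refine ih _ ?_ l ?_ fun l' hl' => ?_
        · rw [Finset.card_erase_of_mem hj, hS, Nat.add_sub_cancel]
        · refine Finset.mem_erase.2 ⟨?_, hl l hlj⟩
          rintro rfl
          exact irrefl (r := R) l hlj
        · have h := _root_.trans (r := R) hl' hlj
          refine Finset.mem_erase.2 ⟨?_, hl l' h⟩
          rintro rfl
          exact irrefl (r := R) l' h
      exact hle (hAb j)
  have hPi : ∀ S : Finset I, (∀ j ∈ S, R j i) → P S (b i) - b i ∈ lower b R i := by
    intro S hS
    suffices h : (∀ x, x - b i ∈ lower b R i → P S x - b i ∈ lower b R i) from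
      h _ (by rw [sub_self]; exact Submodule.zero_mem _)
    refine Finset.noncommProd_induction S A (hPcomm S)
      (fun E => ∀ x, x - b i ∈ lower b R i → E x - b i ∈ lower b R i) ?_ ?_ ?_
    · intro E E' h h' x hx
      exact h _ (h' _ hx)
    · intro x hx
      exact hx
    · intro j hj x hx
      have e : A j x - b i = A j (x - b i) + (A j (b i) - b i) := by
        rw [map_sub]
        abel
      rw [e]
      exact Submodule.add_mem _ (hAlow j _ hx) (hAi j (hS j hj))
  set S := (hfin i).toFinset with hS
  have hmem : ∀ j, j ∈ S ↔ R j i := fun j => (hfin i).mem_toFinset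
  refine ⟨P S (b i), hPi S fun j hj => (hmem j).1 hj, fun k => ?_⟩
  have hle : lower b R i ≤ LinearMap.ker (P S) := by
    refine Submodule.span_le.2 ?_
    rintro _ ⟨l, hl, rfl⟩
    exact hkill _ S rfl l ((hmem l).2 hl) fun l' hl' =>
      (hmem l').2 (_root_.trans (r := R) hl' hl)
  -- Triangularity places this vector in the lower span, on which `P S` vanishes. As `P S` commutes
  -- with `L k`, this is the eigenvalue equation.
  have h : P S (L k (b i) - χ i k • b i) = 0 := hle (hL i k)
  rw [map_sub, map_smul, sub_eq_zero] at h
  rw [← h, ← Module.End.mul_apply, ← Module.End.mul_apply, (hPL S k).eq]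

end Triangular

end

noncomputable section

/-! ### The Dunkl–Opdam subalgebra -/

section DunklOpdam

variable {r n : ℕ} [NeZero r] {F : Type} [Field F] [Algebra ℂ F] {p : Params r F}

variable (p) in
/-- The sum of the reflections in `G(r,1,n)` which interchange the `i`-th and `j`-th coordinate. -/
def transSum (i j : Fin n) : RCA n p := reflSum (F := F) (tHom p) 0 i j

theorem transSum_comm (i j : Fin n) : transSum p i j = transSum p j i := by
  rw [transSum, reflSum_comm, neg_zero, transSum]

theorem t_mul_transSum (w : W r n) (i j : Fin n) :
    t p w * transSum p i j = transSum p (w.right i) (w.right j) * t p w := by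
  have := map_mul_reflSum (F := F) (τ := tHom p) w 0 i j
  rwa [neg_zero, chr_zero, chr_zero, one_mul, one_smul] at this

theorem t_mul_YX (w : W r n) (i : Fin n) :
    t p w * (Y p i * X p i) = Y p (w.right i) * X p (w.right i) * t p w := by
  rw [← mul_assoc, t_mul_Y, smul_mul_assoc, mul_assoc, t_mul_X, mul_smul_comm, smul_smul,
    chr_mul_neg, one_smul, mul_assoc]

/-- Reduces an identity that is additive in the sum of reflections to a single reflection. -/
theorem transSum_induction {C : RCA n p → Prop} (h0 : C 0) (hadd : ∀ a b, C a → C b → C (a + b))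
    {i j : Fin n} (ht : ∀ u, C (t p (reflAt i j u))) : C (transSum p i j) := by
  unfold transSum reflSum
  refine Finset.sum_induction _ C hadd h0 fun u _ => ?_
  rw [chr_zero, one_smul]
  exact ht u

theorem transSum_mul_YX (i j k : Fin n) :
    transSum p i j * (Y p k * X p k) =
      Y p (Equiv.swap i j k) * X p (Equiv.swap i j k) * transSum p i j := by
  refine transSum_induction (C := fun a => a * (Y p k * X p k) =
    Y p (Equiv.swap i j k) * X p (Equiv.swap i j k) * a) ?_ ?_ fun u => ?_
  · rw [zero_mul, mul_zero]
  · intro a b ha hb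
    rw [add_mul, mul_add, ha, hb]
  · rw [t_mul_YX, reflAt_right]

theorem jm_eq (i : Fin n) :
    jm p i = ∑ j ∈ Finset.univ.filter (fun j : Fin n => j < i), transSum p i j := by
  unfold jm
  refine Finset.sum_congr rfl fun j hj => ?_
  have hne : i ≠ j := (Finset.mem_filter.1 hj).2.ne'
  rw [transSum, reflSum, ← sum_range_zetaRoot]
  refine Finset.sum_congr rfl fun l _ => ?_
  rw [chr_zero, one_smul, refl_eq hne, tHom_apply]

theorem t_mul_jm (w : W r n) {i : Fin n} (hw : ∀ j, j < i ↔ w.right j < w.right i) :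
    t p w * jm p i = jm p (w.right i) * t p w := by
  rw [jm_eq, jm_eq, Finset.mul_sum, Finset.sum_mul]
  exact Finset.sum_equiv w.right (by simpa using hw) fun j _ => t_mul_transSum w i j

theorem t_mul_z (w : W r n) {i : Fin n} (hw : ∀ j, j < i ↔ w.right j < w.right i) :
    t p w * z p i = z p (w.right i) * t p w := by
  rw [z, z, mul_add, add_mul, t_mul_YX, mul_smul_comm, smul_mul_assoc, t_mul_jm w hw]

theorem t_diag_mul_z (a : Fin n → rootsOfUnity r ℂ) (i : Fin n) :
    t p (diag a) * z p i = z p i * t p (diag a) :=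
  t_mul_z (diag a) fun _ => Iff.rfl

theorem transSum_mul_jm {i j k : Fin n} (hi : i < k) (hj : j < k) :
    transSum p i j * jm p k = jm p k * transSum p i j := by
  refine transSum_induction (C := fun a => a * jm p k = jm p k * a) ?_ ?_ fun u => ?_
  · rw [zero_mul, mul_zero]
  · intro a b ha hb
    rw [add_mul, mul_add, ha, hb]
  · have hk : (reflAt i j u : W r n).right k = k := Equiv.swap_apply_of_ne_of_ne hi.ne' hj.ne'
    have h := t_mul_jm (p := p) (reflAt i j u) (i := k) fun l => by
      rw [hk, reflAt_right, Equiv.swap_apply_def]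
      split_ifs with h1 h2
      · subst h1; exact iff_of_true hi hj
      · subst h2; exact iff_of_true hj hi
      · rfl
    rwa [hk] at h

theorem jm_comm {i j : Fin n} (h : i < j) : jm p i * jm p j = jm p j * jm p i := by
  rw [jm_eq i, Finset.sum_mul, Finset.mul_sum]
  exact Finset.sum_congr rfl fun k hk => transSum_mul_jm h ((Finset.mem_filter.1 hk).2.trans h)

theorem jm_mul_YX {i j : Fin n} (h : i < j) :
    jm p i * (Y p j * X p j) = Y p j * X p j * jm p i := by
  rw [jm_eq i, Finset.sum_mul, Finset.mul_sum]
  refine Finset.sum_congr rfl fun k hk => ?_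
  rw [transSum_mul_YX, Equiv.swap_apply_of_ne_of_ne h.ne'
    ((Finset.mem_filter.1 hk).2.trans h).ne']

/-- Of the reflections in `jm p j`, only those which interchange `i` and `j` fail to commute with
`y_i x_i`. -/
theorem YX_mul_jm {i j : Fin n} (h : i < j) :
    Y p i * X p i * jm p j - jm p j * (Y p i * X p i) =
      (Y p i * X p i - Y p j * X p j) * transSum p i j := by
  have hmem : i ∈ Finset.univ.filter (fun k : Fin n => k < j) := by simpa using h
  have e : (∑ k ∈ (Finset.univ.filter (fun k : Fin n => k < j)).erase i, transSum p j k) *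
      (Y p i * X p i) = Y p i * X p i *
        ∑ k ∈ (Finset.univ.filter (fun k : Fin n => k < j)).erase i, transSum p j k := by
    rw [Finset.sum_mul, Finset.mul_sum]
    refine Finset.sum_congr rfl fun k hk => ?_
    rw [transSum_mul_YX, Equiv.swap_apply_of_ne_of_ne h.ne (Finset.ne_of_mem_erase hk).symm]
  rw [jm_eq j, ← Finset.add_sum_erase _ _ hmem, mul_add, add_mul, e, transSum_comm j i,
    transSum_mul_YX, Equiv.swap_apply_left, sub_mul]
  abel

theorem bracket_mul_X {i j : Fin n} (h : i ≠ j) :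
    bracket p (tHom p) i j * X p i = p.c₀ • (X p j * transSum p i j) := by
  rw [bracket, if_neg h, smul_mul_assoc]
  congr 1
  unfold transSum reflSum
  rw [Finset.sum_mul, Finset.mul_sum]
  refine Finset.sum_congr rfl fun u _ => ?_
  rw [smul_mul_assoc, tHom_apply, t_mul_X, mul_smul_comm, reflAt_right, Equiv.swap_apply_left,
    smul_smul, chr_zero, one_smul]
  have e : (reflAt i j u : W r n).left j = u⁻¹ := by simp [h.symm]
  rw [e, chr_inv, chr_mul_neg, one_smul]

/-- Bring both products to the form with the two `y` in front of the two `x`. These leading parts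
agree and only the commutator terms survive. -/
theorem YX_comm {i j : Fin n} (h : i ≠ j) :
    Y p i * X p i * (Y p j * X p j) - Y p j * X p j * (Y p i * X p i) =
      -(p.c₀ • ((Y p i * X p i - Y p j * X p j) * transSum p i j)) := by
  have h1 : X p i * Y p j = Y p j * X p i - bracket p (tHom p) j i := by
    rw [Y_mul_X]; abel
  have h2 : X p j * Y p i = Y p i * X p j - bracket p (tHom p) i j := by
    rw [Y_mul_X]; abel
  have h3 : Y p i * X p i * (Y p j * X p j) =
      Y p i * Y p j * (X p i * X p j) - p.c₀ • (Y p i * X p i * transSum p i j) := by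
    rw [mul_assoc, ← mul_assoc (X p i), h1, sub_mul, bracket_mul_X h.symm, mul_sub,
      mul_smul_comm, transSum_comm j i]
    simp only [mul_assoc]
  have h4 : Y p j * X p j * (Y p i * X p i) =
      Y p j * Y p i * (X p j * X p i) - p.c₀ • (Y p j * X p j * transSum p i j) := by
    rw [mul_assoc, ← mul_assoc (X p j), h2, sub_mul, bracket_mul_X h, mul_sub, mul_smul_comm]
    simp only [mul_assoc]
  rw [h3, h4, Y_mul_Y p j i, X_mul_X p j i, sub_mul, smul_sub]
  abel

/-- The Jucys–Murphy correction in `z` is there for this purpose: the defect in `YX_comm` is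
cancelled by that in `YX_mul_jm`, and the two other commutators are zero. -/
theorem z_comm_of_lt {i j : Fin n} (h : i < j) : z p i * z p j = z p j * z p i := by
  have h1 := YX_comm (p := p) h.ne
  have h2 := YX_mul_jm (p := p) h
  have h3 := jm_mul_YX (p := p) h
  have h4 := jm_comm (p := p) h
  rw [← sub_eq_zero]
  have e : z p i * z p j - z p j * z p i =
      (Y p i * X p i * (Y p j * X p j) - Y p j * X p j * (Y p i * X p i)) +
      p.c₀ • (Y p i * X p i * jm p j - jm p j * (Y p i * X p i)) +
      p.c₀ • (jm p i * (Y p j * X p j) - Y p j * X p j * jm p i) +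
      p.c₀ • p.c₀ • (jm p i * jm p j - jm p j * jm p i) := by
    unfold z
    simp only [add_mul, mul_add, mul_smul_comm, smul_mul_assoc, smul_sub, smul_add]
    abel
  rw [e, h1, h2, h3, h4]
  simp

theorem z_comm (i j : Fin n) : z p i * z p j = z p j * z p i := by
  rcases lt_trichotomy i j with h | rfl | h
  · exact z_comm_of_lt h
  · rfl
  · exact (z_comm_of_lt h).symm

/-! Intertwiners -/

/-- A relation of degenerate affine Hecke type. Conjugation by the transposition carries `jm p i` to
`jm p j` without the reflections interchanging `i` and `j`, which form the correction. -/
theorem t_swap_mul_z {i j : Fin n} (hij : (i : ℕ) + 1 = j) :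
    t p (perm r (Equiv.swap i j)) * z p i =
      z p j * t p (perm r (Equiv.swap i j)) -
        p.c₀ • (transSum p i j * t p (perm r (Equiv.swap i j))) := by
  have hlt : i < j := Fin.lt_def.2 (by omega)
  set s := perm r (Equiv.swap i j) with hs
  have e1 : t p s * jm p i = (∑ k ∈ Finset.univ.filter (fun k : Fin n => k < i),
      transSum p j k) * t p s := by
    rw [jm_eq, Finset.mul_sum, Finset.sum_mul]
    refine Finset.sum_congr rfl fun k hk => ?_
    have hk' := (Finset.mem_filter.1 hk).2
    rw [t_mul_transSum, hs, perm_right, Equiv.swap_apply_left,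
      Equiv.swap_apply_of_ne_of_ne hk'.ne (hk'.trans hlt).ne]
  have e2 : jm p j = transSum p i j + ∑ k ∈ Finset.univ.filter (fun k : Fin n => k < i),
      transSum p j k := by
    rw [jm_eq, transSum_comm i j, ← Finset.sum_insert (by simp)]
    refine Finset.sum_congr ?_ fun _ _ => rfl
    ext k
    simp only [Finset.mem_filter, Finset.mem_univ, true_and, Finset.mem_insert, Fin.lt_def,
      Fin.ext_iff]
    omega
  rw [z, z, mul_add, t_mul_YX, mul_smul_comm, e1, e2, add_mul, smul_mul_assoc, add_mul, smul_add]
  have e3 : s.right i = j := by rw [hs, perm_right, Equiv.swap_apply_left]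
  rw [e3]
  abel

theorem t_swap_mul_z_of_ne {i j k : Fin n} (hij : (i : ℕ) + 1 = j) (hi : k ≠ i) (hj : k ≠ j) :
    t p (perm r (Equiv.swap i j)) * z p k = z p k * t p (perm r (Equiv.swap i j)) := by
  have hk : Equiv.swap i j k = k := Equiv.swap_apply_of_ne_of_ne hi hj
  have h := t_mul_z (p := p) (perm r (Equiv.swap i j)) (i := k) fun l => by
    rw [perm_right, hk, Equiv.swap_apply_def]
    simp only [Fin.lt_def, Fin.ext_iff, ne_eq] at *
    split_ifs <;> omega
  rwa [perm_right, hk] at h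

theorem z_mul_X_of_ne {i j : Fin n} (h : i ≠ j) (hj : ∀ k, k < i → k ≠ j) :
    z p i * X p j = X p j * (z p i + p.c₀ • transSum p i j) := by
  have e : jm p i * X p j = X p j * jm p i := by
    rw [jm_eq, Finset.sum_mul, Finset.mul_sum]
    refine Finset.sum_congr rfl fun k hk => ?_
    have hk' := hj k (Finset.mem_filter.1 hk).2
    refine transSum_induction (C := fun a => a * X p j = X p j * a) ?_ ?_ fun u => ?_
    · rw [zero_mul, mul_zero]
    · intro a b ha hb
      rw [add_mul, mul_add, ha, hb]
    · rw [t_mul_X, reflAt_right, Equiv.swap_apply_of_ne_of_ne h.symm hk'.symm]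
      simp [h.symm, hk'.symm]
  rw [z, add_mul, smul_mul_assoc, e, mul_assoc, X_mul_X, ← mul_assoc, Y_mul_X, add_mul,
    bracket_mul_X h, mul_add, mul_add, mul_smul_comm, mul_smul_comm, mul_assoc]
  abel

/-- `c` is the cyclic permutation which decreases all indices but `o = 0` by one, and moves `o` to
the last index `l`. -/
structure IsRotation (c : Equiv.Perm (Fin n)) (o l : Fin n) : Prop where
  val_fst : (o : ℕ) = 0
  val_lst : (l : ℕ) + 1 = n
  map_fst : c o = l
  map_succ : ∀ i j : Fin n, (i : ℕ) + 1 = j → c j = i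

theorem exists_isRotation (hn : 0 < n) :
    ∃ (c : Equiv.Perm (Fin n)) (o l : Fin n), IsRotation c o l := by
  obtain ⟨m, rfl⟩ : ∃ m, n = m + 1 := ⟨n - 1, by omega⟩
  refine ⟨(finRotate (m + 1))⁻¹, 0, Fin.last m, rfl, rfl, ?_, fun i j h => ?_⟩
  · rw [Equiv.Perm.inv_eq_iff_eq, finRotate_last]
  · rw [Equiv.Perm.inv_eq_iff_eq]
    ext
    rw [coe_finRotate_of_ne_last, h]
    intro h'
    have := j.2
    rw [h', Fin.val_last] at h
    omega

variable (p) in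
/-- The affine intertwiner. -/
def affine (c : Equiv.Perm (Fin n)) (l : Fin n) : RCA n p := X p l * t p (perm r c)

section Rotation

variable {c : Equiv.Perm (Fin n)} {o l : Fin n} (hc : IsRotation c o l)
include hc

theorem IsRotation.map_eq_of_ne {k : Fin n} (h : k ≠ o) : (c k : ℕ) + 1 = k := by
  have hk : (k : ℕ) ≠ 0 := fun h' => h (Fin.ext (h'.trans hc.val_fst.symm))
  rw [hc.map_succ ⟨k - 1, by omega⟩ k (by simp; omega)]
  simp; omega

/-- Conjugation by `c` turns `jm p j` into `jm p i` plus the reflections interchanging `i` and `l`.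
Precisely these also arise when `z_i` is moved past `x_l`. -/
theorem z_mul_affine {i j : Fin n} (hij : (i : ℕ) + 1 = j) :
    z p i * affine p c l = affine p c l * z p j := by
  have hil : i ≠ l := by
    rintro rfl
    have := hc.val_lst
    omega
  have hcj := hc.map_succ i j hij
  have e : t p (perm r c) * jm p j = (transSum p i l + jm p i) * t p (perm r c) := by
    have e1 : transSum p i l + jm p i =
        ∑ k ∈ Finset.univ.filter (fun k : Fin n => k < j), transSum p i (c k) := by
      have ho : o ∈ Finset.univ.filter (fun k : Fin n => k < j) := by
        have := hc.val_fst
        simp only [Finset.mem_filter, Finset.mem_univ, true_and, Fin.lt_def]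
        omega
      rw [← Finset.add_sum_erase _ _ ho, hc.map_fst, jm_eq]
      congr 1
      refine (Finset.sum_equiv c (fun k => ?_) fun k _ => rfl).symm
      simp only [Finset.mem_erase, Finset.mem_filter, Finset.mem_univ, true_and, Fin.lt_def]
      constructor
      · rintro ⟨h1, h2⟩
        have := hc.map_eq_of_ne h1
        omega
      · intro h
        have h1 : k ≠ o := by
          rintro rfl
          rw [hc.map_fst] at h
          have := hc.val_lst
          omega
        have := hc.map_eq_of_ne h1
        exact ⟨h1, by omega⟩
    rw [e1, jm_eq, Finset.mul_sum, Finset.sum_mul]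
    refine Finset.sum_congr rfl fun k _ => ?_
    rw [t_mul_transSum, perm_right, hcj]
  rw [affine, ← mul_assoc, z_mul_X_of_ne hil, mul_assoc, mul_assoc]
  · congr 1
    rw [z, z, mul_add, t_mul_YX, perm_right, hcj, mul_smul_comm, e, add_mul, add_mul, add_mul,
      smul_add, smul_mul_assoc, smul_mul_assoc]
    abel
  · rintro k hk rfl
    have := hc.val_lst
    rw [Fin.lt_def] at hk
    omega

/-- At the last index the Jucys–Murphy element contains all reflections that move it and cancels the
reflection part of the commutator; at the first index it is zero, so `z` is just `y x` there. -/
theorem z_last_mul_affine :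
    z p l * affine p c l = affine p c l * z p o +
      (algebraMap F _ p.κ - dSum p (tHom p) l) * affine p c l := by
  have h0 : z p o = Y p o * X p o := by
    rw [z, jm_eq, Finset.sum_eq_zero, smul_zero, add_zero]
    intro k hk
    have h := (Finset.mem_filter.1 hk).2
    rw [Fin.lt_def, hc.val_fst] at h
    omega
  have h1 : z p l = X p l * Y p l + (algebraMap F _ p.κ - dSum p (tHom p) l) := by
    have e : jm p l = ∑ k ∈ Finset.univ.filter (fun k : Fin n => k ≠ l),
        reflSum (F := F) (tHom p) 0 l k := by
      rw [jm_eq]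
      refine Finset.sum_congr (Finset.filter_congr fun k _ => ?_) fun _ _ => rfl
      have := hc.val_lst
      rw [Fin.lt_def, ne_eq, Fin.ext_iff]
      omega
    rw [z, Y_mul_X, bracket, if_pos rfl, e]
    abel
  rw [h0, affine, mul_assoc (X p l), t_mul_YX, perm_right, hc.map_fst, h1, add_mul]
  simp only [mul_assoc]

theorem t_diag_mul_affine (j : Fin n) (u : rootsOfUnity r ℂ) :
    t p (diag (Pi.mulSingle (c j) u)) * affine p c l =
      chr F (if j = o then -1 else 0) u • (affine p c l * t p (diag (Pi.mulSingle j u))) := by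
  have e : diag (Pi.mulSingle (c j) u) * perm r c = perm r c * diag (Pi.mulSingle j u) := by
    rw [mul_diag_single, perm_right]
  rw [affine, ← mul_assoc, t_mul_X, smul_mul_assoc, mul_assoc, mul_assoc, ← t_mul, e, t_mul]
  congr 1
  rw [diag_right, diag_left, Equiv.Perm.one_apply, Pi.mulSingle_apply, ← hc.map_fst]
  by_cases h : j = o
  · simp [h]
  · have h' : c o ≠ c j := fun h' => h (c.injective h').symm
    simp [h, h']

end Rotation

end DunklOpdam

end

noncomputable section

/-! ### Triangularity of the Dunkl–Opdam elements -/

section Triangularity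

variable {r n : ℕ} [NeZero r] {F : Type} [Field F] [Algebra ℂ F] {p : Params r F}
  {lam : RPartition r n}

variable (F lam) in
/-- The span of the elements `x^ν v` with `ν < μ`. -/
def below (μ : Fin n → ℕ) : Submodule F (PolyMod F lam) :=
  Submodule.span F {f | ∃ ν v, WeightLT ν μ ∧ f = mono ν v}

theorem mono_mem_below {μ ν : Fin n → ℕ} (h : WeightLT ν μ) (v : Specht F lam) :
    mono ν v ∈ below F lam μ :=
  Submodule.subset_span ⟨ν, v, h, rfl⟩

theorem set2_of_ne {i j : Fin n} (ν : Fin n → ℕ) (a b : ℕ) {k : Fin n} (hi : k ≠ i) (hj : k ≠ j) :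
    set2 ν i j a b k = ν k := by
  rw [set2_apply, if_neg hj, if_neg hi]

theorem weightLT_set2 {μ : Fin n → ℕ} {i j : Fin n} (h : i ≠ j) {m : ℕ}
    (h1 : min (μ i) (μ j) < m) (h2 : m < max (μ i) (μ j)) :
    WeightLT (set2 μ i j (μ i + μ j - m) m) μ := by
  refine weightLT_of_max_lt h (fun k hi hj => set2_of_ne _ _ _ hi hj) ?_ ?_
  · rw [set2_apply, set2_apply, if_pos rfl, if_neg h, if_pos rfl]
    omega
  · rw [set2_apply, set2_apply, if_pos rfl, if_neg h, if_pos rfl]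
    omega

theorem permExp_swap (i j : Fin n) (μ : Fin n → ℕ) :
    permExp (Equiv.swap i j) μ = μ ∘ Equiv.swap i j := by
  funext k
  rw [permExp, Equiv.swap_inv, Function.comp_apply]

theorem pairTerm_inc {i j : Fin n} (h : i ≠ j) (μ : Fin n → ℕ) (m : ℕ) (v : Specht F lam) :
    pairTerm F lam i j (inc μ i) m v =
      mono (set2 μ i j (μ i + μ j - m) m)
        (reflSum (F := F) (A := Module.End F (Specht F lam)) (spechtRep F lam)
          ((m : ZMod r) - (μ j : ZMod r)) i j v) := by
  rw [pairTerm, LinearMap.comp_apply, inc_self, inc_of_ne _ h.symm]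
  congr 2
  funext k
  rw [set2_apply, set2_apply]
  split_ifs with h1 h2
  · rfl
  · omega
  · rw [inc_of_ne _ h2]

theorem pairTerm_inc_left {i j : Fin n} (h : i ≠ j) (μ : Fin n → ℕ) (v : Specht F lam) :
    pairTerm F lam i j (inc μ i) (μ i) v =
      reflSum (F := F) (A := Module.End F (PolyMod F lam)) (tOp F lam) 0 i j (mono μ v) := by
  rw [pairTerm_inc h, reflSum_tOp_mono, zero_add, ← set2_swap h, Nat.add_sub_cancel_left]

theorem pairTerm_inc_right {i j : Fin n} (h : i ≠ j) (μ : Fin n → ℕ) (v : Specht F lam) :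
    pairTerm F lam i j (inc μ i) (μ j) v =
      mono μ (reflSum (F := F) (A := Module.End F (Specht F lam)) (spechtRep F lam) 0 i j v) := by
  rw [pairTerm_inc h, sub_self, Nat.add_sub_cancel]
  congr 2
  funext k
  rw [set2_apply]
  split_ifs with h1 h2
  · rw [h1]
  · rw [h2]
  · rfl

theorem pairTerm_inc_mem {i j : Fin n} (h : i ≠ j) {μ : Fin n → ℕ} {m : ℕ}
    (h1 : min (μ i) (μ j) < m) (h2 : m < max (μ i) (μ j)) (v : Specht F lam) :
    pairTerm F lam i j (inc μ i) m v ∈ below F lam μ := by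
  rw [pairTerm_inc h]
  exact mono_mem_below (weightLT_set2 h h1 h2) _

theorem reflSum_mono_mem {i j : Fin n} {μ : Fin n → ℕ} (h : i < j ∧ μ j < μ i ∨ j < i ∧ μ i < μ j)
    (v : Specht F lam) :
    reflSum (F := F) (A := Module.End F (PolyMod F lam)) (tOp F lam) 0 i j (mono μ v) ∈
      below F lam μ := by
  rw [reflSum_tOp_mono]
  refine mono_mem_below ?_ _
  rw [permExp_swap]
  rcases h with ⟨h, h'⟩ | ⟨h, h'⟩
  · exact weightLT_comp_swap h h'
  · rw [Equiv.swap_comm]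
    exact weightLT_comp_swap h h'

theorem pairOp_inc_of_le {i j : Fin n} {μ : Fin n → ℕ} (h : μ j ≤ μ i) (hij : i ≠ j)
    (v : Specht F lam) :
    pairOp F lam i j (inc μ i) v =
      ∑ m ∈ Finset.Ico (μ j) (μ i + 1), pairTerm F lam i j (inc μ i) m v := by
  rw [pairOp, LinearMap.sub_apply, LinearMap.sum_apply, LinearMap.sum_apply, inc_self,
    inc_of_ne _ hij.symm, Finset.sum_Ico_eq_sub _ (by omega)]

theorem pairOp_inc_of_lt {i j : Fin n} {μ : Fin n → ℕ} (h : μ i < μ j) (hij : i ≠ j)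
    (v : Specht F lam) :
    pairOp F lam i j (inc μ i) v =
      -∑ m ∈ Finset.Ico (μ i + 1) (μ j), pairTerm F lam i j (inc μ i) m v := by
  rw [pairOp, LinearMap.sub_apply, LinearMap.sum_apply, LinearMap.sum_apply, inc_self,
    inc_of_ne _ hij.symm, Finset.sum_Ico_eq_sub _ (by omega), neg_sub]

/-- The heart of triangularity. In the range of exponents between `μ i` and `μ j` the inner terms
are strictly dominated, while the end terms are `x^μ` and the reflected monomial. The latter is
lower when the larger entry moves to the right; otherwise it is what the Jucys–Murphy element
cancels. If `μ i = μ j` the two end terms coincide and are counted once, in agreement with the way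
`wPerm` breaks ties. -/
theorem pairOp_inc_sub_mem {i j : Fin n} (hij : i ≠ j) (μ : Fin n → ℕ) (v : Specht F lam) :
    pairOp F lam i j (inc μ i) v -
      (if wPerm μ j < wPerm μ i then
        mono μ (reflSum (F := F) (A := Module.End F (Specht F lam)) (spechtRep F lam) 0 i j v)
        else 0) -
      (if j < i then
        reflSum (F := F) (A := Module.End F (PolyMod F lam)) (tOp F lam) 0 i j (mono μ v)
        else 0) ∈ below F lam μ := by
  rcases lt_trichotomy (μ j) (μ i) with h | h | h
  · rw [if_pos (wPerm_lt_of (Or.inl h)), pairOp_inc_of_le h.le hij,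
      Finset.sum_Ico_succ_top h.le, Finset.sum_eq_sum_Ico_succ_bot h, pairTerm_inc_left hij,
      pairTerm_inc_right hij]
    have h1 : ∑ m ∈ Finset.Ico (μ j + 1) (μ i), pairTerm F lam i j (inc μ i) m v ∈
        below F lam μ := by
      refine Submodule.sum_mem _ fun m hm => ?_
      rw [Finset.mem_Ico] at hm
      exact pairTerm_inc_mem hij (by omega) (by omega) v
    by_cases hji : j < i
    · rw [if_pos hji]
      convert h1 using 1
      abel
    · rw [if_neg hji, sub_zero]
      have h2 := reflSum_mono_mem (F := F) (lam := lam) (i := i) (j := j) (μ := μ)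
        (Or.inl ⟨lt_of_le_of_ne (not_lt.1 hji) hij, h⟩) v
      convert Submodule.add_mem _ h1 h2 using 1
      abel
  · rw [pairOp_inc_of_le h.le hij, h, Nat.Ico_succ_singleton, Finset.sum_singleton]
    have e := pairTerm_inc_right (F := F) (lam := lam) hij μ v
    have e' := pairTerm_inc_left (F := F) (lam := lam) hij μ v
    rw [h] at e
    rw [← e, ← e']
    rcases lt_or_gt_of_ne hij with h1 | h1
    · rw [if_pos (wPerm_lt_of (Or.inr ⟨h, h1⟩)), if_neg h1.not_gt, sub_self, sub_zero]
      exact Submodule.zero_mem _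
    · rw [if_neg (wPerm_lt_of (Or.inr ⟨h.symm, h1⟩)).not_gt, if_pos h1, sub_zero, sub_self]
      exact Submodule.zero_mem _
  · rw [if_neg (wPerm_lt_of (Or.inl h)).not_gt, sub_zero, pairOp_inc_of_lt h hij]
    refine Submodule.sub_mem _ (Submodule.neg_mem _ (Submodule.sum_mem _ fun m hm => ?_)) ?_
    · rw [Finset.mem_Ico] at hm
      exact pairTerm_inc_mem hij (by omega) (by omega) v
    · split_ifs with hji
      · exact reflSum_mono_mem (Or.inr ⟨hji, h⟩) v
      · exact Submodule.zero_mem _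

theorem transSum_smul (i j : Fin n) (f : PolyMod F lam) :
    transSum p i j • f =
      reflSum (F := F) (A := Module.End F (PolyMod F lam)) (tOp F lam) 0 i j f := by
  simp only [transSum, reflSum, Finset.sum_smul, LinearMap.sum_apply, LinearMap.smul_apply,
    smul_assoc, tHom_apply, t_smul]

theorem z_smul_mono (i : Fin n) (μ : Fin n → ℕ) (v : Specht F lam) :
    z p i • mono μ v - mono μ ((p.κ * ((μ i + 1 : ℕ) : F)) • v - dDiff p lam i ((μ i + 1 : ℕ) : ZMod r) v -
      p.c₀ • ∑ j ∈ Finset.univ.filter (fun j : Fin n => wPerm μ j < wPerm μ i),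
        reflSum (F := F) (A := Module.End F (Specht F lam)) (spechtRep F lam) 0 i j v) ∈
      below F lam μ := by
  have e1 : z p i • mono μ v = yOp lam p i (mono (inc μ i) v) +
      p.c₀ • ∑ j ∈ Finset.univ.filter (fun j : Fin n => j < i),
        reflSum (F := F) (A := Module.End F (PolyMod F lam)) (tOp F lam) 0 i j (mono μ v) := by
    rw [z, add_smul, mul_smul, X_smul, Y_smul, xOp_mono, smul_assoc, jm_eq, Finset.sum_smul]
    simp only [transSum_smul]
  have e2 : Function.update (inc μ i) i (μ i + 1 - 1) = μ := by
    funext k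
    rw [Function.update_apply]
    split_ifs with h
    · rw [h]; rfl
    · exact inc_of_ne _ h
  have f1 : ∀ {N : Type} [AddCommGroup N] (P : Fin n → Prop) [DecidablePred P] (g : Fin n → N),
      ¬ P i → ∑ j ∈ Finset.univ.filter P, g j =
        ∑ j ∈ Finset.univ.filter (fun j : Fin n => j ≠ i), if P j then g j else 0 := by
    intro N _ P _ g hP
    rw [← Finset.sum_filter, Finset.filter_filter]
    refine Finset.sum_congr (Finset.filter_congr fun j _ => ?_) fun _ _ => rfl
    constructor
    · intro h
      refine ⟨?_, h⟩
      rintro rfl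
      exact hP h
    · exact fun h => h.2
  have h := Submodule.sum_mem (below F lam μ) (t := Finset.univ.filter (fun j : Fin n => j ≠ i))
    fun j hj => pairOp_inc_sub_mem (F := F) (lam := lam) (Finset.mem_filter.1 hj).2.symm μ v
  rw [Finset.sum_sub_distrib, Finset.sum_sub_distrib,
    ← f1 (fun j => wPerm μ j < wPerm μ i) _ (lt_irrefl _),
    ← f1 (fun j => j < i) _ (lt_irrefl _)] at h
  rw [e1, yOp_mono, inc_self, e2]
  convert Submodule.smul_mem _ (-p.c₀) h using 1
  simp only [map_sub, map_smul, map_sum]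
  module

/-! The eigenvalues -/

/-- Written through the group algebra, the operator can be conjugated by elements of `G(r,1,n)`; the
formula on tableaux would not show its equivariance. -/
theorem dDiff_eq (i : Fin n) (k : ZMod r) :
    dDiff p lam i k = ∑ b : ZMod r, (p.d b - p.d (b - k)) • ((r : F)⁻¹ •
      ∑ u, chr F (-b) u • spechtRep F lam (diag (Pi.mulSingle i u))) := by
  refine Finsupp.lhom_ext' fun T => LinearMap.ext_ring ?_
  rw [LinearMap.comp_apply, LinearMap.comp_apply, Finsupp.lsingle_apply, dDiff_single,
    LinearMap.sum_apply, Finset.sum_eq_single (T.1 i).β]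
  · rw [LinearMap.smul_apply, LinearMap.smul_apply, LinearMap.sum_apply]
    have h : ∀ u : rootsOfUnity r ℂ, (chr F (-(T.1 i).β) u •
        spechtRep F lam (diag (Pi.mulSingle i u))) (Finsupp.single T 1) = Finsupp.single T 1 := by
      intro u
      rw [LinearMap.smul_apply, spechtRep_diag, ← fillVec_coe, diagOp_fillVec, weightChar_single,
        smul_smul, mul_comm, chr_mul_neg, one_smul]
    have h2 := sum_chr (F := F) (r := r) 0
    simp only [chr_zero, if_true] at h2
    have h3 : ∑ _u : rootsOfUnity r ℂ, (Finsupp.single T 1 : Specht F lam) =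
        (r : F) • Finsupp.single T 1 := by
      rw [← h2, Finset.sum_smul]
      simp only [one_smul]
    rw [Finset.sum_congr rfl fun u _ => h u, h3, smul_smul (r : F)⁻¹, inv_mul_cancel₀ (r_ne_zero (F := F)),
      one_smul]
  · intro b _ hb
    rw [LinearMap.smul_apply, LinearMap.smul_apply, LinearMap.sum_apply]
    have h : ∀ u : rootsOfUnity r ℂ, (chr F (-b) u •
        spechtRep F lam (diag (Pi.mulSingle i u))) (Finsupp.single T 1) =
        chr F ((T.1 i).β - b) u • Finsupp.single T 1 := by
      intro u
      rw [LinearMap.smul_apply, spechtRep_diag, ← fillVec_coe, diagOp_fillVec, weightChar_single,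
        smul_smul, mul_comm, chr_sub]
    rw [Finset.sum_congr rfl fun u _ => h u, ← Finset.sum_smul, sum_chr,
      if_neg (sub_ne_zero.2 hb.symm), zero_smul, smul_zero, smul_zero]
  · simp

theorem dDiff_spechtRep (w : W r n) (i : Fin n) (k : ZMod r) (v : Specht F lam) :
    dDiff p lam (w.right i) k (spechtRep F lam w v) = spechtRep F lam w (dDiff p lam i k v) := by
  rw [← Module.End.mul_apply, ← Module.End.mul_apply]
  congr 1
  rw [dDiff_eq, dDiff_eq]
  simp only [Finset.mul_sum, Finset.sum_mul, mul_smul_comm, smul_mul_assoc, ← map_mul,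
    mul_diag_single]

theorem reflSum_spechtRep (w : W r n) (i j : Fin n) (v : Specht F lam) :
    reflSum (F := F) (A := Module.End F (Specht F lam)) (spechtRep F lam) 0 (w.right i) (w.right j)
      (spechtRep F lam w v) = spechtRep F lam w
        (reflSum (F := F) (A := Module.End F (Specht F lam)) (spechtRep F lam) 0 i j v) := by
  rw [← Module.End.mul_apply, ← Module.End.mul_apply,
    map_mul_reflSum (F := F) (A := Module.End F (Specht F lam)), neg_zero, chr_zero, chr_zero,
    one_mul, one_smul]

/-- The vector `v_T^μ`. -/
def rotVec (F : Type) [Field F] [Algebra ℂ F] (μ : Fin n → ℕ) (T : SYT lam) : Specht F lam :=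
  spechtRep F lam (perm r (wPerm μ))⁻¹ (fillVec F T.1)

theorem perm_inv_apply (σ : Equiv.Perm (Fin n)) (i : Fin n) : σ⁻¹ (σ i) = i :=
  σ.symm_apply_apply i

theorem perm_inv_right (σ : Equiv.Perm (Fin n)) : ((perm r σ)⁻¹ : W r n).right = σ⁻¹ := rfl

theorem dDiff_rotVec (μ : Fin n → ℕ) (T : SYT lam) (i : Fin n) (k : ZMod r) :
    dDiff p lam i k (rotVec F μ T) =
      (p.d (T.1 (wPerm μ i)).β - p.d ((T.1 (wPerm μ i)).β - k)) • rotVec F μ T := by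
  have h := dDiff_spechtRep (p := p) (perm r (wPerm μ))⁻¹ (wPerm μ i) k (fillVec F T.1)
  rw [perm_inv_right, perm_inv_apply] at h
  rw [rotVec, h, fillVec_coe, dDiff_single, map_smul]

/-- The reason for twisting `v_T` by `w_μ`: conjugation turns the reflections with `wPerm μ j <
wPerm μ i` into the Jucys–Murphy element with index `wPerm μ i`, for which `v_T` is an eigenvector.
-/
theorem sum_reflSum_rotVec (μ : Fin n → ℕ) (T : SYT lam) (i : Fin n) :
    ∑ j ∈ Finset.univ.filter (fun j : Fin n => wPerm μ j < wPerm μ i),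
      reflSum (F := F) (A := Module.End F (Specht F lam)) (spechtRep F lam) 0 i j (rotVec F μ T) =
      ((r : F) * (T.1 (wPerm μ i)).ct) • rotVec F μ T := by
  have h : ∀ j, reflSum (F := F) (A := Module.End F (Specht F lam)) (spechtRep F lam) 0 i j
      (rotVec F μ T) = spechtRep F lam (perm r (wPerm μ))⁻¹
        (reflSum (F := F) (A := Module.End F (Specht F lam)) (spechtRep F lam) 0
          (wPerm μ i) (wPerm μ j) (fillVec F T.1)) := by
    intro j
    have := reflSum_spechtRep (perm r (wPerm μ))⁻¹ (wPerm μ i) (wPerm μ j) (fillVec F T.1)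
    rw [perm_inv_right, perm_inv_apply, perm_inv_apply] at this
    exact this
  rw [Finset.sum_congr rfl fun j _ => h j, ← map_sum]
  rw [Finset.sum_equiv (wPerm μ) (t := Finset.univ.filter (fun j : Fin n => j < wPerm μ i))
    (g := fun j => reflSum (F := F) (A := Module.End F (Specht F lam)) (spechtRep F lam) 0
      (wPerm μ i) j (fillVec F T.1)) (by simp) (fun j _ => rfl),
    sum_reflSum_fillVec F T.2, map_smul]
  rfl

variable (p) in
/-- The eigenvalue of `z_i` on the eigenvector with leading term `x^μ v_T^μ`. -/
def zVal (μ : Fin n → ℕ) (T : SYT lam) (i : Fin n) : F :=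
  p.κ * ((μ i + 1 : ℕ) : F) -
    (p.d (T.1 (wPerm μ i)).β - p.d ((T.1 (wPerm μ i)).β - ((μ i + 1 : ℕ) : ZMod r))) -
    p.c₀ * r * (T.1 (wPerm μ i)).ct

/-- The weight of the eigenvector with leading term `x^μ v_T^μ` for the `i`-th diagonal matrix. -/
def tWt (μ : Fin n → ℕ) (T : SYT lam) (i : Fin n) : ZMod r :=
  (T.1 (wPerm μ i)).β - (μ i : ZMod r)

theorem z_smul_leading (μ : Fin n → ℕ) (T : SYT lam) (i : Fin n) :
    z p i • mono μ (rotVec F μ T) - zVal p μ T i • mono μ (rotVec F μ T) ∈ below F lam μ := by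
  have h := z_smul_mono (p := p) i μ (rotVec F μ T)
  rw [dDiff_rotVec, sum_reflSum_rotVec, smul_smul, ← sub_smul, ← sub_smul, map_smul,
    ← mul_assoc] at h
  exact h

theorem t_smul_leading (μ : Fin n → ℕ) (T : SYT lam) (i : Fin n) (u : rootsOfUnity r ℂ) :
    t p (diag (Pi.mulSingle i u)) • mono μ (rotVec F μ T) =
      chr F (tWt μ T i) u • mono μ (rotVec F μ T) := by
  have e : (diag (Pi.mulSingle i u) : W r n) * (perm r (wPerm μ))⁻¹ =
      (perm r (wPerm μ))⁻¹ * diag (Pi.mulSingle (wPerm μ i) u) := by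
    rw [mul_diag_single, perm_inv_right, perm_inv_apply]
  have e2 : permExp (1 : Equiv.Perm (Fin n)) μ = μ := rfl
  rw [t_smul, tOp_mono, diag_left, diag_right, weightChar_single, rotVec, ← Module.End.mul_apply,
    ← map_mul, e, map_mul, Module.End.mul_apply, spechtRep_diag, diagOp_fillVec, weightChar_single,
    map_smul, map_smul, smul_smul, e2, expWeight, mul_comm, ← chr_sub]
  rfl

end Triangularity

end

noncomputable section

/-! ### The eigenvectors `f_{μ,T}` -/

section Eigenvectors

variable {r n : ℕ} [NeZero r] {F : Type} [Field F] [Algebra ℂ F] {p : Params r F}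
  {lam : RPartition r n}

theorem rotVec_eq (μ : Fin n → ℕ) (T : SYT lam) :
    rotVec F μ T = spechtRep F lam (perm r (wPerm μ))⁻¹ (Finsupp.single T 1) := by
  rw [rotVec, fillVec_coe]

variable (F lam) in
/-- The automorphism which maps `x^μ v_T` to `x^μ v_T^μ`. -/
def rotEquiv : PolyMod F lam ≃ₗ[F] PolyMod F lam :=
  LinearEquiv.ofLinearMap
    (PolyMod.lift fun ν => (mono ν).comp (spechtRep F lam (perm r (wPerm ν))⁻¹))
    (PolyMod.lift fun ν => (mono ν).comp (spechtRep F lam (perm r (wPerm ν))))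
    (PolyMod.hom_ext fun ν v => by
      simp only [LinearMap.comp_apply, PolyMod.lift_mono, spechtRep_inv_apply, LinearMap.id_apply])
    (PolyMod.hom_ext fun ν v => by
      simp only [LinearMap.comp_apply, PolyMod.lift_mono, spechtRep_apply_inv, LinearMap.id_apply])

theorem rotEquiv_symm_mono (ν : Fin n → ℕ) (v : Specht F lam) :
    (rotEquiv F lam).symm (mono ν v) = mono ν (spechtRep F lam (perm r (wPerm ν)) v) :=
  PolyMod.lift_mono _ _ _

variable (F lam) in
/-- The isomorphism which maps `x^μ v_T^μ` to a basis vector of the free module. -/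
def leadRepr : PolyMod F lam ≃ₗ[F] ((Fin n → ℕ) × SYT lam →₀ F) :=
  (rotEquiv F lam).symm.trans
    ((Finsupp.curryLinearEquiv F : _ ≃ₗ[F] ((Fin n → ℕ) →₀ SYT lam →₀ F)).symm :
      PolyMod F lam ≃ₗ[F] ((Fin n → ℕ) × SYT lam →₀ F))

variable (F lam) in
/-- The basis of the vectors `x^μ v_T^μ`. -/
def leadBasis : Module.Basis ((Fin n → ℕ) × SYT lam) F (PolyMod F lam) :=
  Module.Basis.ofRepr (leadRepr F lam)

theorem leadBasis_repr_mono (ν : Fin n → ℕ) (v : Specht F lam) (i : (Fin n → ℕ) × SYT lam) :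
    (leadBasis F lam).repr (mono ν v) i =
      if ν = i.1 then spechtRep F lam (perm r (wPerm ν)) v i.2 else 0 := by
  have h : (leadBasis F lam).repr (mono ν v) i =
      coord i.1 ((rotEquiv F lam).symm (mono ν v)) i.2 := rfl
  rw [h, rotEquiv_symm_mono]
  split_ifs with hi
  · rw [← hi, coord_mono_self]
  · rw [coord_mono_of_ne (Ne.symm hi)]
    rfl

theorem leadBasis_apply (μ : Fin n → ℕ) (T : SYT lam) :
    leadBasis F lam (μ, T) = mono μ (rotVec F μ T) := by
  classical
  rw [← (leadBasis F lam).repr.injective.eq_iff, Module.Basis.repr_self]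
  ext ⟨ν, S⟩
  rw [leadBasis_repr_mono, rotVec_eq, spechtRep_apply_inv, Finsupp.single_apply]
  by_cases h : μ = ν
  · rw [if_pos h, Finsupp.single_apply]
    simp only [Prod.mk.injEq, h, true_and]
  · rw [if_neg h, if_neg fun h' => h (Prod.mk.inj h').1]

/-- The order on the basis vectors. -/
def LeadLT (i j : (Fin n → ℕ) × SYT lam) : Prop := WeightLT i.1 j.1

instance : IsTrans ((Fin n → ℕ) × SYT lam) LeadLT := ⟨fun _ _ _ => weightLT_trans⟩

instance : Std.Irrefl (LeadLT : (Fin n → ℕ) × SYT lam → (Fin n → ℕ) × SYT lam → Prop) :=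
  ⟨fun i => weightLT_irrefl i.1⟩

theorem lower_leadBasis (μ : Fin n → ℕ) (T : SYT lam) :
    lower (leadBasis F lam) LeadLT (μ, T) = below F lam μ := by
  refine le_antisymm (Submodule.span_le.2 ?_) (Submodule.span_le.2 ?_)
  · rintro _ ⟨⟨ν, S⟩, h, rfl⟩
    rw [leadBasis_apply]
    exact mono_mem_below h _
  · rintro _ ⟨ν, v, h, rfl⟩
    rw [← spechtRep_inv_apply F (perm r (wPerm ν)) v]
    generalize spechtRep F lam (perm r (wPerm ν)) v = v
    induction v using specht_induction with
    | h0 => simp only [map_zero]; exact Submodule.zero_mem _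
    | hadd v w hv hw => simp only [map_add]; exact Submodule.add_mem _ hv hw
    | hT c S =>
      simp only [map_smul]
      refine Submodule.smul_mem _ _ ?_
      have e := leadBasis_apply (F := F) ν S
      rw [rotVec] at e
      rw [← e]
      exact mem_lower_of (R := LeadLT) (i := (μ, T)) (j := (ν, S)) h

instance : Finite (SYT lam) := by
  by_cases h : Nonempty (Fin n ≃ Box lam)
  · have : Finite (Box lam) := Finite.of_equiv _ h.some
    exact Subtype.finite
  · have : IsEmpty (SYT lam) := ⟨fun T => h ⟨T.1⟩⟩
    infer_instance

theorem finite_leadLT (i : (Fin n → ℕ) × SYT lam) : {j | LeadLT j i}.Finite := by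
  have h : {j : (Fin n → ℕ) × SYT lam | LeadLT j i} ⊆ {ν | WeightLT ν i.1} ×ˢ Set.univ :=
    fun j hj => ⟨hj, trivial⟩
  exact ((finite_weightLT i.1).prod Set.finite_univ).subset h

variable (p lam) in
/-- The action of the generators of `𝔱`. -/
def tGen : Fin n ⊕ (Fin n × rootsOfUnity r ℂ) → RCA n p :=
  Sum.elim (z p) fun k => t p (diag (Pi.mulSingle k.1 k.2))

variable (p lam) in
/-- The generators of `𝔱` as operators on the polynomial representation. -/
def tGenOp (k : Fin n ⊕ (Fin n × rootsOfUnity r ℂ)) : Module.End F (PolyMod F lam) :=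
  polyAction lam p (tGen p k)

theorem tGenOp_apply (k : Fin n ⊕ (Fin n × rootsOfUnity r ℂ)) (f : PolyMod F lam) :
    tGenOp p lam k f = tGen p k • f := rfl

variable (p) in
/-- The eigenvalues of the generators of `𝔱`. -/
def tEig (i : (Fin n → ℕ) × SYT lam) : Fin n ⊕ (Fin n × rootsOfUnity r ℂ) → F :=
  Sum.elim (zVal p i.1 i.2) fun k => chr F (tWt i.1 i.2 k.1) k.2

theorem isTriangular_tGenOp : IsTriangular (leadBasis F lam) LeadLT (tGenOp p lam) (tEig p) := by
  rintro ⟨μ, T⟩ (i | ⟨i, u⟩)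
  · rw [lower_leadBasis, leadBasis_apply]
    exact z_smul_leading μ T i
  · rw [lower_leadBasis, leadBasis_apply]
    have h : tGenOp p lam (Sum.inr (i, u)) (mono μ (rotVec F μ T)) =
      tEig p (μ, T) (Sum.inr (i, u)) • mono μ (rotVec F μ T) := t_smul_leading μ T i u
    rw [h, sub_self]
    exact Submodule.zero_mem _

theorem commute_tGenOp (k l : Fin n ⊕ (Fin n × rootsOfUnity r ℂ)) :
    Commute (tGenOp p lam k) (tGenOp p lam l) := by
  refine Commute.map (?_ : Commute (tGen p k) (tGen p l)) (polyAction lam p)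
  rcases k with i | ⟨i, u⟩ <;> rcases l with j | ⟨j, v⟩
  · exact z_comm i j
  · exact (t_diag_mul_z _ i).symm
  · exact t_diag_mul_z _ j
  · change t p _ * t p _ = t p _ * t p _
    rw [← t_mul, ← t_mul, ← diag_mul, ← diag_mul, mul_comm]

/-- The parameters are generic if there is no linear relation of this kind between them. -/
def IsGeneric (p : Params r F) : Prop :=
  ∀ (m a : ℤ) (b₁ b₂ b₃ b₄ : ZMod r),
    p.κ * m - (p.d b₁ - p.d b₂) + (p.d b₃ - p.d b₄) - p.c₀ * r * a = 0 → m = 0 ∧ a = 0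

/-- Genericity reads off `μ` and all contents from the eigenvalues of the `z_i`. With `μ` known, the
weights of the diagonal matrices give the components, and a tableau is determined by its contents
and components. -/
theorem tEig_injective (hp : IsGeneric p) :
    Function.Injective (tEig p : (Fin n → ℕ) × SYT lam → _) := by
  rintro ⟨μ, T⟩ ⟨ν, S⟩ h
  have h1 : ∀ i, ((μ i : ℤ) - ν i = 0) ∧
      ((T.1 (wPerm μ i)).ct - (S.1 (wPerm ν i)).ct = 0) := by
    intro i
    have hz : zVal p μ T i = zVal p ν S i := congrFun h (Sum.inl i)
    refine hp _ _ (T.1 (wPerm μ i)).β ((T.1 (wPerm μ i)).β - ((μ i + 1 : ℕ) : ZMod r))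
      (S.1 (wPerm ν i)).β ((S.1 (wPerm ν i)).β - ((ν i + 1 : ℕ) : ZMod r)) ?_
    unfold zVal at hz
    push_cast at hz ⊢
    linear_combination hz
  have hμ : μ = ν := by
    funext i
    have := (h1 i).1
    omega
  subst hμ
  congr 1
  refine SYT.ext_content fun i => ?_
  obtain ⟨k, rfl⟩ := (wPerm μ).surjective i
  refine ⟨?_, by have := (h1 k).2; omega⟩
  have h2 : chr F (tWt μ T k) (zetaRoot r) = chr F (tWt μ S k) (zetaRoot r) :=
    congrFun h (Sum.inr (k, zetaRoot r))
  exact sub_left_injective (chr_zetaRoot_injective F h2)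

variable (p) in
/-- A simultaneous eigenvector of `𝔱` in the polynomial representation with leading term
`x^μ v_T^μ`. -/
structure IsEigenvector (μ : Fin n → ℕ) (T : SYT lam) (f : PolyMod F lam) : Prop where
  z_smul : ∀ i, z p i • f = zVal p μ T i • f
  t_smul : ∀ i u, t p (diag (Pi.mulSingle i u)) • f = chr F (tWt μ T i) u • f

theorem IsEigenvector.tGenOp {μ : Fin n → ℕ} {T : SYT lam} {f : PolyMod F lam}
    (h : IsEigenvector p μ T f) (k : Fin n ⊕ (Fin n × rootsOfUnity r ℂ)) :
    tGenOp p lam k f = tEig p (μ, T) k • f := by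
  rcases k with i | ⟨i, u⟩
  · exact h.z_smul i
  · exact h.t_smul i u

theorem IsEigenvector.of_tGenOp {μ : Fin n → ℕ} {T : SYT lam} {f : PolyMod F lam}
    (h : ∀ k, Cherednik.tGenOp p lam k f = tEig p (μ, T) k • f) : IsEigenvector p μ T f :=
  ⟨fun i => h (Sum.inl i), fun i u => h (Sum.inr (i, u))⟩

/-- The coefficient of `x^μ v_T^μ`. -/
def leadCoeff (μ : Fin n → ℕ) (T : SYT lam) : PolyMod F lam →ₗ[F] F :=
  (leadBasis F lam).coord (μ, T)

theorem leadCoeff_mono (μ ν : Fin n → ℕ) (T : SYT lam) (v : Specht F lam) :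
    leadCoeff μ T (mono ν v) = if ν = μ then spechtRep F lam (perm r (wPerm ν)) v T else 0 :=
  leadBasis_repr_mono ν v (μ, T)

theorem IsEigenvector.eq_smul (hp : IsGeneric p) {μ : Fin n → ℕ} {T : SYT lam}
    {f g : PolyMod F lam} (hf : IsEigenvector p μ T f) (h1 : leadCoeff μ T f = 1)
    (hg : IsEigenvector p μ T g) : g = leadCoeff μ T g • f :=
  isTriangular_tGenOp.eq_smul (tEig_injective hp) hf.tGenOp hg.tGenOp h1

theorem leadCoeff_eq_one {μ : Fin n → ℕ} {T : SYT lam} {f : PolyMod F lam}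
    (h : f - mono μ (rotVec F μ T) ∈ below F lam μ) : leadCoeff μ T f = 1 := by
  rw [← leadBasis_apply, ← lower_leadBasis μ T] at h
  exact repr_eq_one_of_sub_mem_lower h

theorem exists_isEigenvector (hn : 0 < n) (hp : IsGeneric p) (μ : Fin n → ℕ) (T : SYT lam) :
    ∃ f : PolyMod F lam, f - mono μ (rotVec F μ T) ∈ below F lam μ ∧ IsEigenvector p μ T f := by
  have : Nonempty (Fin n ⊕ (Fin n × rootsOfUnity r ℂ)) := ⟨Sum.inl ⟨0, hn⟩⟩
  obtain ⟨f, h1, h2⟩ := (isTriangular_tGenOp (p := p)).exists_eigenvector finite_leadLT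
    (tEig_injective hp) commute_tGenOp (μ, T)
  rw [lower_leadBasis, leadBasis_apply] at h1
  exact ⟨f, h1, .of_tGenOp h2⟩

/-! Transport to the standard module -/

theorem exists_zetaRoot_pow (u : rootsOfUnity r ℂ) : ∃ l : ℕ, zetaRoot r ^ l = u := by
  have hp : IsPrimitiveRoot (zetaRoot r : ℂˣ) r := by
    rw [← IsPrimitiveRoot.coe_units_iff]
    exact isPrimitiveRoot_zeta r
  obtain ⟨l, -, h⟩ := hp.eq_pow_of_mem_rootsOfUnity u.2
  exact ⟨l, Subtype.ext (by simpa using h)⟩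

theorem tGen_mem (k : Fin n ⊕ (Fin n × rootsOfUnity r ℂ)) : tGen p k ∈ tAlg n p := by
  rcases k with i | ⟨i, u⟩
  · exact Algebra.subset_adjoin (Or.inl ⟨i, rfl⟩)
  · obtain ⟨l, rfl⟩ := exists_zetaRoot_pow u
    have e : tGen p (Sum.inr (i, zetaRoot r ^ l)) = t p (zetaElt r i) ^ l := by
      rw [← tHom_apply, ← map_pow, zetaElt_pow]
      rfl
    rw [e]
    have h : t p (zetaElt r i) ∈ tAlg n p := Algebra.subset_adjoin (Or.inr ⟨i, rfl⟩)
    exact pow_mem h l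

theorem stdEquiv_leading (μ : Fin n → ℕ) (T : SYT lam) :
    stdEquiv p lam (leading p μ T) = mono μ (rotVec F μ T) := by
  rw [leading, map_smul, map_smul, stdEquiv_vec, t_smul, tOp_mono_zero, xPow_smul_mono_zero]
  rfl

variable (p lam) in
/-- The comparison isomorphism as a linear map over the base field. -/
def stdEquivF : StdModule p lam ≃ₗ[F] PolyMod F lam := (stdEquiv p lam).restrictScalars F

theorem stdEquivF_apply (f : StdModule p lam) : stdEquivF p lam f = stdEquiv p lam f := rfl

theorem mem_span_leading {μ : Fin n → ℕ} (T : SYT lam) (f : StdModule p lam) :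
    f ∈ Submodule.span F {g : StdModule p lam |
      ∃ (ν : Fin n → ℕ) (S : SYT lam), WeightLT ν μ ∧ g = leading p ν S} ↔
    stdEquivF p lam f ∈ below F lam μ := by
  rw [← lower_leadBasis μ T, lower]
  change _ ↔ f ∈ Submodule.comap (stdEquivF p lam).toLinearMap (Submodule.span F _)
  have e : (leadBasis F lam '' {j | LeadLT j (μ, T)}) = (stdEquivF p lam).toLinearMap ''
      {g : StdModule p lam | ∃ (ν : Fin n → ℕ) (S : SYT lam), WeightLT ν μ ∧ g = leading p ν S} := by
    ext x
    constructor
    · rintro ⟨⟨ν, S⟩, h, rfl⟩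
      exact ⟨_, ⟨ν, S, h, rfl⟩, by
        rw [leadBasis_apply]
        exact stdEquiv_leading ν S⟩
    · rintro ⟨_, ⟨ν, S, h, rfl⟩, rfl⟩
      exact ⟨(ν, S), h, by
        rw [leadBasis_apply]
        exact (stdEquiv_leading ν S).symm⟩
  rw [e, ← Submodule.map_span, Submodule.comap_map_eq_of_injective (stdEquivF p lam).injective]

/-- The definition leaves the eigenvalues open, but triangularity forces them to be those of the
leading term. The condition `f ≠ 0` is likewise automatic, since the leading coefficient is one. -/
theorem isEigenfunction_iff {μ : Fin n → ℕ} {T : SYT lam} {f : StdModule p lam} :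
    IsEigenfunction p μ T f ↔
      stdEquiv p lam f - mono μ (rotVec F μ T) ∈ below F lam μ ∧
        IsEigenvector p μ T (stdEquiv p lam f) := by
  unfold IsEigenfunction
  rw [mem_span_leading T, map_sub, stdEquivF_apply, stdEquivF_apply, stdEquiv_leading]
  constructor
  · rintro ⟨-, h1, h2⟩
    refine ⟨h2, .of_tGenOp fun k => ?_⟩
    choose c hc using fun k => h1 _ (tGen_mem (p := p) k)
    have hc' : ∀ k, tGenOp p lam k (stdEquiv p lam f) = c k • stdEquiv p lam f := by
      intro k
      rw [tGenOp_apply, ← map_smul, hc]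
      exact map_smul (stdEquivF p lam) _ _
    rw [← leadBasis_apply, ← lower_leadBasis μ T] at h2
    rw [hc', isTriangular_tGenOp.eigenvalue_of_leading h2 hc']
  · rintro ⟨h2, h1⟩
    refine ⟨?_, fun a ha => ?_, h2⟩
    · rintro rfl
      have := leadCoeff_eq_one h2
      rw [map_zero, map_zero] at this
      exact zero_ne_one this
    · have key : ∀ a ∈ tAlg n p, ∃ c : F, a • stdEquiv p lam f = c • stdEquiv p lam f := by
        intro a ha
        induction ha using Algebra.adjoin_induction with
        | mem x hx =>
          rcases hx with ⟨i, rfl⟩ | ⟨i, rfl⟩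
          · exact ⟨_, h1.z_smul i⟩
          · exact ⟨_, h1.t_smul i (zetaRoot r)⟩
        | algebraMap c => exact ⟨c, algebraMap_smul (RCA n p) c _⟩
        | add x y _ _ hx hy =>
          obtain ⟨c, hc⟩ := hx
          obtain ⟨c', hc'⟩ := hy
          exact ⟨c + c', by rw [add_smul, add_smul, hc, hc']⟩
        | mul x y _ _ hx hy =>
          obtain ⟨c, hc⟩ := hx
          obtain ⟨c', hc'⟩ := hy
          exact ⟨c' * c, by rw [mul_smul, hc', smul_comm, hc, smul_smul]⟩
      obtain ⟨c, hc⟩ := key a ha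
      refine ⟨c, (stdEquiv p lam).injective ?_⟩
      rw [map_smul, hc]
      exact (map_smul (stdEquivF p lam) _ _).symm

theorem existsUnique_isEigenfunction (hn : 0 < n) (hp : IsGeneric p) (μ : Fin n → ℕ)
    (T : SYT lam) : ∃! f, IsEigenfunction p μ T f := by
  obtain ⟨f, h1, h2⟩ := exists_isEigenvector hn hp μ T
  refine ⟨(stdEquiv p lam).symm f, ?_, fun g hg => ?_⟩
  · beta_reduce
    rw [isEigenfunction_iff, LinearEquiv.apply_symm_apply]
    exact ⟨h1, h2⟩
  · beta_reduce at hg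
    rw [isEigenfunction_iff] at hg
    rw [LinearEquiv.eq_symm_apply, h2.eq_smul hp (leadCoeff_eq_one h1) hg.2,
      leadCoeff_eq_one hg.1, one_smul]

end Eigenvectors

end

noncomputable section

/-! ### The contravariant form -/

section Form

variable {r n : ℕ} [NeZero r] {F : Type} [Field F] [Algebra ℂ F] {p : Params r F}
  {lam : RPartition r n} {σ : F →+* F}

/-- `σ` extends complex conjugation and fixes the parameters. -/
structure IsConj (p : Params r F) (σ : F →+* F) : Prop where
  invol : ∀ x, σ (σ x) = x
  map_algebraMap : ∀ x : ℂ, σ (algebraMap ℂ F x) = algebraMap ℂ F (starRingEnd ℂ x)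
  map_κ : σ p.κ = p.κ
  map_c₀ : σ p.c₀ = p.c₀
  map_d : ∀ j, σ (p.d j) = p.d j

/-- The contravariant forms on the polynomial representation. -/
structure IsContravariant (p : Params r F) (lam : RPartition r n)
    (B : PolyMod F lam →ₗ[F] PolyMod F lam →ₛₗ[σ] F) : Prop where
  hermitian : ∀ f g, B g f = σ (B f g)
  norm_vec : ∀ T : SYT lam, B (mono 0 (fillVec F T.1)) (mono 0 (fillVec F T.1)) = 1
  invariant : ∀ (w : W r n) (f g : PolyMod F lam), B (t p w • f) (t p w • g) = B f g
  adjoint_x : ∀ (i : Fin n) (f g : PolyMod F lam), B (X p i • f) g = B f (Y p i • g)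
  adjoint_y : ∀ (i : Fin n) (f g : PolyMod F lam), B (Y p i • f) g = B f (X p i • g)

section Conj

variable (hσ : IsConj p σ)
include hσ

theorem IsConj.map_realHom (x : ℝ) : σ (realHom F x) = realHom F x := by
  rw [realHom_apply, hσ.map_algebraMap, Complex.conj_ofReal]

theorem IsConj.map_emb (u : rootsOfUnity r ℂ) : σ (emb F u) = emb F u⁻¹ := by
  have h := Complex.conj_rootsOfUnity u.2
  change σ (algebraMap ℂ F ((u : ℂˣ) : ℂ)) = algebraMap ℂ F (((u⁻¹ : rootsOfUnity r ℂ) : ℂˣ) : ℂ)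
  rw [hσ.map_algebraMap, h]
  rfl

theorem IsConj.map_chr (k : ZMod r) (u : rootsOfUnity r ℂ) : σ (chr F k u) = chr F (-k) u := by
  rw [← chr_inv, chr_apply, hσ.map_emb, chr_apply, inv_pow]

end Conj

/-! ### The invariant Hermitian form on `S^λ`. -/

variable (σ) in
/-- `σ` as a semilinear map. -/
def conjLin : F →ₛₗ[σ] F where
  toFun := σ
  map_add' := map_add σ
  map_smul' a b := map_mul σ a b

variable (σ lam) in
/-- The Hermitian form on `S^λ` for which the `v_T` are orthonormal. -/
def spechtForm : Specht F lam →ₗ[F] Specht F lam →ₛₗ[σ] F :=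
  Finsupp.linearCombination F fun T : SYT lam =>
    (conjLin σ).comp (Finsupp.lapply T : Specht F lam →ₗ[F] F)

theorem spechtForm_single (T : SYT lam) (w : Specht F lam) :
    spechtForm lam σ (Finsupp.single T 1) w = σ (w T) := by
  rw [spechtForm, Finsupp.linearCombination_single, one_smul]
  rfl

theorem spechtForm_fillVec (T T' : Fin n ≃ Box lam) (hT : IsStandard T) :
    spechtForm lam σ (fillVec F T) (fillVec F T') = by
      classical exact if T = T' then 1 else 0 := by
  classical
  have e : spechtForm lam σ (fillVec F T) (fillVec F T') = σ (fillVec F T' (⟨T, hT⟩ : SYT lam)) := by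
    rw [fillVec_of_standard hT]
    exact spechtForm_single (⟨T, hT⟩ : SYT lam) _
  rw [e]
  have e2 : ∀ S S' : SYT lam, σ (fillVec F S.1 S') = if S'.1 = S.1 then 1 else 0 := by
    intro S S'
    rw [fillVec_coe, Finsupp.single_apply]
    split_ifs with h1 h2 h2
    · rw [map_one]
    · exact absurd (congrArg Subtype.val h1).symm h2
    · exact absurd (Subtype.ext h2).symm h1
    · rw [map_zero]
  by_cases hT' : IsStandard T'
  · exact e2 ⟨T', hT'⟩ ⟨T, hT⟩
  · rw [fillVec_of_not_standard hT', if_neg]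
    · exact map_zero σ
    · rintro rfl
      exact hT' hT

theorem spechtForm_fillVec' (T T' : Fin n ≃ Box lam) (hT' : IsStandard T') :
    spechtForm lam σ (fillVec F T) (fillVec F T') = by
      classical exact if T = T' then 1 else 0 := by
  by_cases hT : IsStandard T
  · exact spechtForm_fillVec T T' hT
  · rw [fillVec_of_not_standard hT, map_zero, LinearMap.zero_apply, if_neg]
    rintro rfl
    exact hT hT'

theorem specht_induction₂ {P : Specht F lam → Specht F lam → Prop} (h0 : ∀ w, P 0 w)
    (h0' : ∀ v, P v 0) (hadd : ∀ v v' w, P v w → P v' w → P (v + v') w)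
    (hadd' : ∀ v w w', P v w → P v w' → P v (w + w')) (hsmul : ∀ (c : F) v w, P v w → P (c • v) w)
    (hsmul' : ∀ (c : F) v w, P v w → P v (c • w))
    (hT : ∀ T T' : SYT lam, P (fillVec F T.1) (fillVec F T'.1)) (v w : Specht F lam) : P v w := by
  induction v using specht_induction with
  | h0 => exact h0 w
  | hadd v v' h h' => exact hadd v v' w h h'
  | hT c T =>
    refine hsmul c _ _ ?_
    induction w using specht_induction with
    | h0 => exact h0' _
    | hadd w w' h h' => exact hadd' _ w w' h h'
    | hT c T' => exact hsmul' c _ _ (hT T T')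

section Conj

variable (hσ : IsConj p σ)
include hσ

theorem spechtForm_hermitian (v w : Specht F lam) :
    spechtForm lam σ w v = σ (spechtForm lam σ v w) := by
  refine specht_induction₂ (P := fun v w => spechtForm lam σ w v = σ (spechtForm lam σ v w))
    ?_ ?_ ?_ ?_ ?_ ?_ ?_ v w
  · intro w; simp
  · intro w; simp
  · intro v v' w h h'
    rw [map_add, map_add, LinearMap.add_apply, map_add, h, h']
  · intro v w w' h h'
    rw [map_add, map_add, LinearMap.add_apply, map_add, h, h']
  · intro c v w h
    simp only [map_smul, LinearMap.smul_apply, map_smulₛₗ, smul_eq_mul, map_mul, h]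
  · intro c v w h
    simp only [map_smul, LinearMap.smul_apply, map_smulₛₗ, smul_eq_mul, map_mul, h, hσ.invol]
  · intro T T'
    rw [spechtForm_fillVec _ _ T.2, spechtForm_fillVec _ _ T'.2]
    split_ifs with h1 h2 h2
    · rw [map_one]
    · exact absurd h1.symm h2
    · exact absurd h2.symm h1
    · rw [map_zero]

/-- Young's matrices are real and symmetric: the off-diagonal coefficient does not depend on the
order of the two boxes. -/
theorem spechtForm_youngOp {i j : Fin n} (v w : Specht F lam) :
    spechtForm lam σ (youngOp F i j v) w = spechtForm lam σ v (youngOp F i j w) := by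
  refine specht_induction₂ (P := fun v w => spechtForm lam σ (youngOp F i j v) w =
    spechtForm lam σ v (youngOp F i j w)) ?_ ?_ ?_ ?_ ?_ ?_ ?_ v w
  · intro w; simp
  · intro w; simp
  · intro v v' w h h'
    simp only [map_add, LinearMap.add_apply, h, h']
  · intro v w w' h h'
    simp only [map_add, h, h']
  · intro c v w h
    simp only [map_smul, LinearMap.smul_apply, h]
  · intro c v w h
    simp only [map_smul, map_smulₛₗ, h]
  · intro T T'
    simp only [youngOp_fillVec T.2, youngOp_fillVec T'.2, map_add, map_smul, LinearMap.add_apply,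
      LinearMap.smul_apply, map_smulₛₗ, smul_eq_mul, spechtForm_fillVec _ _ T.2,
      spechtForm_fillVec' _ _ T'.2, dF, eF, hσ.map_realHom]
    congr 1
    · split_ifs with h
      · rw [h]
      · simp
    · by_cases h : (Equiv.swap i j).trans T.1 = T'.1
      · have h' : T.1 = (Equiv.swap i j).trans T'.1 := by rw [← h, swap_trans_swap]
        rw [if_pos h, if_pos h', ← h]
        have e := eF_swap (F := F) (T.1 i) (T.1 j)
        simp only [eF] at e
        simp only [Equiv.trans_apply, Equiv.swap_apply_left, Equiv.swap_apply_right, e]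
      · have h' : ¬ T.1 = (Equiv.swap i j).trans T'.1 := by
          intro h'
          apply h
          rw [h', swap_trans_swap]
        rw [if_neg h, if_neg h']
        simp

theorem spechtForm_diagOp (a : Fin n → rootsOfUnity r ℂ) (v w : Specht F lam) :
    spechtForm lam σ (diagOp F lam a v) (diagOp F lam a w) = spechtForm lam σ v w := by
  refine specht_induction₂ (P := fun v w => spechtForm lam σ (diagOp F lam a v)
    (diagOp F lam a w) = spechtForm lam σ v w) ?_ ?_ ?_ ?_ ?_ ?_ ?_ v w
  · intro w; simp
  · intro w; simp
  · intro v v' w h h'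
    simp only [map_add, LinearMap.add_apply, h, h']
  · intro v w w' h h'
    simp only [map_add, h, h']
  · intro c v w h
    simp only [map_smul, LinearMap.smul_apply, h]
  · intro c v w h
    simp only [map_smul, map_smulₛₗ, h]
  · intro T T'
    have e : ∀ η : Fin n → ZMod r, weightChar F η a * σ (weightChar F η a) = 1 := by
      intro η
      rw [weightChar_apply, map_prod, ← Finset.prod_mul_distrib]
      refine Finset.prod_eq_one fun k _ => ?_
      rw [hσ.map_chr, chr_mul_neg]
    simp only [diagOp_fillVec, map_smul, LinearMap.smul_apply, map_smulₛₗ, smul_eq_mul,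
      spechtForm_fillVec _ _ T.2]
    split_ifs with h
    · rw [h, mul_one, mul_comm]
      exact e _
    · simp

theorem spechtForm_spechtRep (w : W r n) (v v' : Specht F lam) :
    spechtForm lam σ (spechtRep F lam w v) (spechtRep F lam w v') = spechtForm lam σ v v' := by
  induction w using W_induction generalizing v v' with
  | h1 => rw [map_one, Module.End.one_apply, Module.End.one_apply]
  | hz i => rw [zetaElt_eq, spechtRep_diag, spechtForm_diagOp hσ]
  | hs i j hij =>
    rw [spechtRep_swap F hij, spechtForm_youngOp hσ, ← Module.End.mul_apply (youngOp F i j),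
      youngOp_mul_self hij, Module.End.one_apply]
  | hmul w w' h h' =>
    rw [map_mul, Module.End.mul_apply, Module.End.mul_apply, h, h']

end Conj

/-! ### The contravariant form on polynomials. -/

theorem form_smul_left (B : PolyMod F lam →ₗ[F] PolyMod F lam →ₛₗ[σ] F) (c : F)
    (f g : PolyMod F lam) : B (c • f) g = c * B f g := by
  rw [map_smul B, LinearMap.smul_apply, smul_eq_mul]

theorem form_smul_right (B : PolyMod F lam →ₗ[F] PolyMod F lam →ₛₗ[σ] F) (c : F)
    (f g : PolyMod F lam) : B f (c • g) = σ c * B f g := by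
  rw [map_smulₛₗ, smul_eq_mul]

variable (p lam) in
/-- The product of powers of Dunkl operators. -/
def yPow (ν : Fin n → ℕ) : Module.End F (PolyMod F lam) :=
  (List.ofFn fun i => yOp lam p i ^ ν i).prod

theorem yOp_mul_yPow (j : Fin n) (ν : Fin n → ℕ) :
    yOp lam p j * yPow p lam ν = yPow p lam (inc ν j) := by
  unfold yPow
  rw [List.ofFn_eq_map, List.ofFn_eq_map]
  exact mul_prod_map_pow (yOp_comm p) ν (List.nodup_finRange n) (List.mem_finRange j)

theorem yPow_mul_yOp (j : Fin n) (ν : Fin n → ℕ) :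
    yPow p lam ν * yOp lam p j = yPow p lam (inc ν j) := by
  rw [← yOp_mul_yPow]
  unfold yPow
  refine Commute.list_prod_left _ _ fun x hx => ?_
  rw [List.mem_ofFn] at hx
  obtain ⟨i, rfl⟩ := hx
  exact Commute.pow_left (yOp_comm p i j) _

theorem yPow_zero : yPow p lam (0 : Fin n → ℕ) = 1 := by
  simp [yPow]

variable (p lam σ) in
/-- The contravariant form. -/
def contraForm : PolyMod F lam →ₗ[F] PolyMod F lam →ₛₗ[σ] F :=
  PolyMod.lift fun ν =>
    { toFun := fun v => (spechtForm lam σ v).comp ((coord 0).comp (yPow p lam ν))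
      map_add' := fun v w => by
        rw [map_add, LinearMap.add_comp]
      map_smul' := fun c v => by
        rw [map_smul, LinearMap.smul_comp, RingHom.id_apply] }

/-- The only possible value: adjointness moves `x^ν` to the other side as a product of Dunkl
operators, and by adjointness `S^λ` is orthogonal to every multiple of an `x_j`. -/
theorem contraForm_mono (ν : Fin n → ℕ) (v : Specht F lam) (g : PolyMod F lam) :
    contraForm p lam σ (mono ν v) g = spechtForm lam σ v (coord 0 (yPow p lam ν g)) := by
  rw [contraForm, PolyMod.lift_mono]
  rfl

theorem contraForm_mono_zero (v : Specht F lam) (g : PolyMod F lam) :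
    contraForm p lam σ (mono 0 v) g = spechtForm lam σ v (coord 0 g) := by
  rw [contraForm_mono, yPow_zero, Module.End.one_apply]

theorem contraForm_X_smul (i : Fin n) (f g : PolyMod F lam) :
    contraForm p lam σ (X p i • f) g = contraForm p lam σ f (Y p i • g) := by
  rw [X_smul, Y_smul]
  induction f using PolyMod.induction with
  | h0 => simp only [map_zero, LinearMap.zero_apply]
  | hadd f f' h h' => simp only [map_add, LinearMap.add_apply, h, h']
  | hmono ν v =>
    rw [xOp_mono, contraForm_mono, contraForm_mono, ← yPow_mul_yOp, Module.End.mul_apply]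

theorem coord_zero_xOp (j : Fin n) (f : PolyMod F lam) : coord 0 (xOp F lam j f) = 0 := by
  induction f using PolyMod.induction with
  | h0 => simp only [map_zero]
  | hadd f f' h h' => simp only [map_add, h, h', add_zero]
  | hmono ν v =>
    rw [xOp_mono, coord_mono_of_ne]
    intro h
    have := congrFun h j
    rw [inc_self] at this
    simp at this

theorem coord_zero_tOp (w : W r n) (f : PolyMod F lam) :
    coord 0 (tOp F lam w f) = spechtRep F lam w (coord 0 f) := by
  induction f using PolyMod.induction_x with
  | h0 => simp only [map_zero]
  | hadd f f' h h' => simp only [map_add, h, h']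
  | hv v => rw [tOp_mono_zero, coord_mono_self, coord_mono_self]
  | hx j f _ =>
    rw [← Module.End.mul_apply, tOp_mul_xOp, LinearMap.smul_apply, Module.End.mul_apply, map_smul,
      coord_zero_xOp, coord_zero_xOp, smul_zero, map_zero]

section Adjoint

variable {B : PolyMod F lam →ₗ[F] PolyMod F lam →ₛₗ[σ] F}

theorem map_chr_mul (hσ : IsConj p σ) (k : ZMod r) (u : rootsOfUnity r ℂ) :
    chr F k u * σ (chr F k u) = 1 := by
  rw [hσ.map_chr, chr_mul_neg]

theorem t_smul_X_smul (w : W r n) (j : Fin n) (f : PolyMod F lam) :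
    t p w • X p j • f = chr F (-1) (w.left (w.right j)) • X p (w.right j) • t p w • f := by
  rw [← mul_smul, t_mul_X, smul_assoc, mul_smul]

theorem t_smul_Y_smul (w : W r n) (j : Fin n) (f : PolyMod F lam) :
    t p w • Y p j • f = chr F 1 (w.left (w.right j)) • Y p (w.right j) • t p w • f := by
  rw [← mul_smul, t_mul_Y, smul_assoc, mul_smul]

/-- Induction on the degree of `f`. Moving `x_j` to the other side produces a root of unity twice,
once conjugated, and `σ` inverts roots of unity. -/
theorem contraForm_t_smul (hσ : IsConj p σ) (w : W r n) (f g : PolyMod F lam) :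
    contraForm p lam σ (t p w • f) (t p w • g) = contraForm p lam σ f g := by
  induction f using PolyMod.induction_x generalizing g with
  | h0 => simp only [smul_zero, map_zero, LinearMap.zero_apply]
  | hadd f f' h h' => simp only [smul_add, map_add, LinearMap.add_apply, h, h']
  | hv v =>
    rw [t_smul, t_smul, tOp_mono_zero, contraForm_mono_zero, contraForm_mono_zero, coord_zero_tOp,
      spechtForm_spechtRep hσ]
  | hx j f ih =>
    have e : Y p (w.right j) • t p w • g =
        chr F (-1) (w.left (w.right j)) • t p w • Y p j • g := by
      rw [t_smul_Y_smul, ← mul_smul (chr F (-1) _) (chr F 1 _), mul_comm, chr_mul_neg, one_smul]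
    rw [← X_smul (p := p), t_smul_X_smul, form_smul_left, contraForm_X_smul, e,
      form_smul_right, ih, contraForm_X_smul, ← mul_assoc, map_chr_mul hσ, one_mul]

theorem t_adjoint (hB : ∀ (w : W r n) (f g : PolyMod F lam), B (t p w • f) (t p w • g) = B f g)
    (w : W r n) (f g : PolyMod F lam) : B (t p w • f) g = B f (t p w⁻¹ • g) := by
  rw [← hB w⁻¹ (t p w • f) g, ← mul_smul, ← t_mul, inv_mul_cancel, t_one, one_smul]

/-- Reflections are self-adjoint involutions, while `σ` inverts the character; interchanging `i` and
`j` inverts it as well. -/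
theorem reflSum_adjoint (hσ : IsConj p σ)
    (hB : ∀ (w : W r n) (f g : PolyMod F lam), B (t p w • f) (t p w • g) = B f g)
    (k : ZMod r) {i j : Fin n} (hij : i ≠ j) (f g : PolyMod F lam) :
    B (reflSum (F := F) (tHom p) k i j • f) g = B f (reflSum (F := F) (tHom p) k j i • g) := by
  rw [reflSum_comm k j i, reflSum, reflSum]
  simp only [Finset.sum_smul, map_sum, LinearMap.sum_apply, smul_assoc, map_smul,
    LinearMap.smul_apply, map_smulₛₗ, tHom_apply, t_adjoint hB, reflAt_inv hij, hσ.map_chr, neg_neg]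

theorem dSum_adjoint (hσ : IsConj p σ)
    (hB : ∀ (w : W r n) (f g : PolyMod F lam), B (t p w • f) (t p w • g) = B f g)
    (i : Fin n) (f g : PolyMod F lam) :
    B (dSum p (tHom p) i • f) g = B f (dSum p (tHom p) i • g) := by
  unfold dSum
  simp only [Finset.sum_smul, map_sum, LinearMap.sum_apply, smul_assoc, map_smul,
    LinearMap.smul_apply, map_smulₛₗ, tHom_apply, t_adjoint hB, map_sub, hσ.map_d, map_inv₀,
    map_natCast, hσ.map_chr, neg_neg]
  refine Finset.sum_congr rfl fun k _ => ?_
  congr 2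
  refine Fintype.sum_equiv (Equiv.inv _) _ _ fun u => ?_
  rw [Equiv.inv_apply, chr_inv, ← diag_inv, ← Pi.mulSingle_inv]

/-- This makes the defining relation for `y_i x_j` compatible with the anti-involution that
exchanges `x` and `y`. It needs only invariance of the form, so it can be used while adjointness of
the `y_i` is still open. -/
theorem bracket_adjoint (hσ : IsConj p σ)
    (hB : ∀ (w : W r n) (f g : PolyMod F lam), B (t p w • f) (t p w • g) = B f g)
    (i j : Fin n) (f g : PolyMod F lam) :
    B (bracket p (tHom p) i j • f) g = B f (bracket p (tHom p) j i • g) := by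
  unfold bracket
  by_cases h : i = j
  · subst h
    simp only [if_true, sub_smul, map_sub, LinearMap.sub_apply, algebraMap_smul, map_smul,
      LinearMap.smul_apply, map_smulₛₗ, hσ.map_κ, smul_assoc, hσ.map_c₀, dSum_adjoint hσ hB,
      Finset.sum_smul, map_sum, LinearMap.sum_apply]
    congr 2
    refine Finset.sum_congr rfl fun k hk => ?_
    rw [reflSum_adjoint hσ hB _ (Finset.mem_filter.1 hk).2.symm, reflSum_comm, neg_zero]
  · rw [if_neg h, if_neg (Ne.symm h), smul_assoc, smul_assoc, form_smul_left, form_smul_right,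
      hσ.map_c₀, reflSum_adjoint hσ hB _ h]

/-- By construction the form satisfies adjointness in one direction only. The other follows by
induction on the degree of `f`, with the commutators matched by `bracket_adjoint`. -/
theorem contraForm_Y_smul (hσ : IsConj p σ) (i : Fin n) (f g : PolyMod F lam) :
    contraForm p lam σ (Y p i • f) g = contraForm p lam σ f (X p i • g) := by
  induction f using PolyMod.induction_x generalizing g with
  | h0 => simp only [smul_zero, map_zero, LinearMap.zero_apply]
  | hadd f f' h h' => simp only [smul_add, map_add, LinearMap.add_apply, h, h']
  | hv v =>
    rw [Y_smul, yOp_mono_zero, map_zero, LinearMap.zero_apply, contraForm_mono_zero, X_smul,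
      coord_zero_xOp, map_zero]
  | hx j f ih =>
    rw [← X_smul (p := p), ← mul_smul, Y_mul_X, add_smul, mul_smul, map_add, LinearMap.add_apply,
      contraForm_X_smul, ih, bracket_adjoint hσ (contraForm_t_smul hσ), contraForm_X_smul,
      ← map_add, ← mul_smul (Y p j), Y_mul_X, add_smul, mul_smul]

theorem contraForm_hermitian (hσ : IsConj p σ) (f g : PolyMod F lam) :
    contraForm p lam σ g f = σ (contraForm p lam σ f g) := by
  induction f using PolyMod.induction_x generalizing g with
  | h0 => simp only [map_zero, LinearMap.zero_apply]
  | hadd f f' h h' => simp only [map_add, LinearMap.add_apply, h, h']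
  | hv v =>
    induction g using PolyMod.induction_x with
    | h0 => simp only [map_zero, LinearMap.zero_apply]
    | hadd g g' h h' => simp only [map_add, LinearMap.add_apply, h, h']
    | hv w =>
      rw [contraForm_mono_zero, contraForm_mono_zero, coord_mono_self, coord_mono_self,
        spechtForm_hermitian hσ]
    | hx j g _ =>
      rw [contraForm_mono_zero, coord_zero_xOp, map_zero, map_zero, ← X_smul (p := p),
        contraForm_X_smul, Y_smul, yOp_mono_zero, map_zero]
  | hx j f ih =>
    rw [← X_smul (p := p), ← contraForm_Y_smul hσ, contraForm_X_smul, ih]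

theorem contraForm_isContravariant (hσ : IsConj p σ) :
    IsContravariant p lam (contraForm p lam σ) where
  hermitian := contraForm_hermitian hσ
  norm_vec T := by
    rw [contraForm_mono_zero, coord_mono_self, spechtForm_fillVec _ _ T.2, if_pos rfl]
  invariant := contraForm_t_smul hσ
  adjoint_x := contraForm_X_smul
  adjoint_y := contraForm_Y_smul hσ

theorem IsContravariant.transSum (hB : IsContravariant p lam B) (hσ : IsConj p σ)
    {i j : Fin n} (hij : i ≠ j) (f g : PolyMod F lam) :
    B (transSum p i j • f) g = B f (Cherednik.transSum p i j • g) := by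
  rw [Cherednik.transSum, reflSum_adjoint hσ hB.invariant _ hij, reflSum_comm, neg_zero]

theorem IsContravariant.jm (hB : IsContravariant p lam B) (hσ : IsConj p σ)
    (i : Fin n) (f g : PolyMod F lam) : B (jm p i • f) g = B f (Cherednik.jm p i • g) := by
  rw [jm_eq, Finset.sum_smul, Finset.sum_smul, map_sum, map_sum, LinearMap.sum_apply]
  exact Finset.sum_congr rfl fun j hj => hB.transSum hσ (Finset.mem_filter.1 hj).2.ne' f g

theorem IsContravariant.z (hB : IsContravariant p lam B) (hσ : IsConj p σ)
    (i : Fin n) (f g : PolyMod F lam) : B (z p i • f) g = B f (Cherednik.z p i • g) := by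
  rw [Cherednik.z, add_smul, add_smul, map_add, LinearMap.add_apply, map_add, mul_smul, mul_smul,
    hB.adjoint_y, hB.adjoint_x, smul_assoc, smul_assoc, form_smul_left, form_smul_right,
    hB.jm hσ, hσ.map_c₀]

/-- Eigenvectors of `z_i` for different eigenvalues are orthogonal. -/
theorem IsContravariant.eq_zero_of_z (hB : IsContravariant p lam B) (hσ : IsConj p σ) {i : Fin n}
    {f g : PolyMod F lam} {a b : F} (hf : Cherednik.z p i • f = a • f)
    (hg : Cherednik.z p i • g = b • g) (hb : σ b = b) (hab : a ≠ b) : B f g = 0 := by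
  have h := hB.z hσ i f g
  rw [hf, hg, form_smul_left, form_smul_right, hb] at h
  by_contra hne
  exact hab (mul_right_cancel₀ hne h)

theorem IsContravariant.eq_zero_of_t (hB : IsContravariant p lam B) (hσ : IsConj p σ) {i : Fin n}
    {f g : PolyMod F lam} {a b : ZMod r}
    (hf : t p (diag (Pi.mulSingle i (zetaRoot r))) • f = chr F a (zetaRoot r) • f)
    (hg : t p (diag (Pi.mulSingle i (zetaRoot r))) • g = chr F b (zetaRoot r) • g)
    (hab : a ≠ b) : B f g = 0 := by
  have h := hB.invariant (diag (Pi.mulSingle i (zetaRoot r))) f g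
  rw [hf, hg, form_smul_left, form_smul_right, hσ.map_chr,
    ← mul_assoc] at h
  by_contra hne
  apply hab
  apply chr_zetaRoot_injective F
  have h2 : chr F a (zetaRoot r) * chr F (-b) (zetaRoot r) = 1 :=
    mul_right_cancel₀ hne (h.trans (one_mul _).symm)
  have h3 := chr_mul_neg F b (zetaRoot r)
  calc chr F a (zetaRoot r) = chr F a (zetaRoot r) * (chr F b (zetaRoot r) * chr F (-b) (zetaRoot r)) := by
        rw [h3, mul_one]
    _ = chr F b (zetaRoot r) := by rw [mul_left_comm, h2, mul_one]

theorem jm_smul_mono_zero (T : SYT lam) (i : Fin n) :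
    jm p i • (mono 0 (fillVec F T.1) : PolyMod F lam) =
      ((r : F) * (T.1 i).ct) • mono 0 (fillVec F T.1) := by
  rw [jm_eq, Finset.sum_smul, ← map_smul, ← sum_reflSum_fillVec F T.2, map_sum]
  refine Finset.sum_congr rfl fun j _ => ?_
  have h := map_reflSum_smul (p := p) (τ := spechtRep F lam) (f := (mono 0 : _ →ₗ[F] PolyMod F lam))
    (g := fillVec F T.1) (fun w => by rw [t_smul, tOp_mono_zero]) 0 i j
  exact h.symm

theorem diag_smul_mono_zero (T : SYT lam) (i : Fin n) (u : rootsOfUnity r ℂ) :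
    t p (diag (Pi.mulSingle i u)) • (mono 0 (fillVec F T.1) : PolyMod F lam) =
      chr F (T.1 i).β u • mono 0 (fillVec F T.1) := by
  rw [t_smul, tOp_mono_zero, spechtRep_diag, diagOp_fillVec, weightChar_single, map_smul]

/-- Distinct `v_T` differ in a component or a content, hence in an eigenvalue of a unitary diagonal
matrix or of a self-adjoint Jucys–Murphy element. So they are orthogonal for every contravariant
form, and irreducibility of `S^λ` is not needed. -/
theorem IsContravariant.vec_eq (hB : IsContravariant p lam B) (hσ : IsConj p σ) (T S : SYT lam) :
    B (mono 0 (fillVec F T.1)) (mono 0 (fillVec F S.1)) = by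
      classical exact if T = S then 1 else 0 := by
  split_ifs with h
  · rw [h, hB.norm_vec]
  · by_contra hne
    apply h
    refine SYT.ext_content fun i => ⟨?_, ?_⟩
    · by_contra hb
      exact hne (hB.eq_zero_of_t hσ (diag_smul_mono_zero T i _) (diag_smul_mono_zero S i _) hb)
    · have h1 := hB.jm hσ i (mono 0 (fillVec F T.1)) (mono 0 (fillVec F S.1))
      rw [jm_smul_mono_zero, jm_smul_mono_zero, form_smul_left, form_smul_right, map_mul,
        map_natCast, map_intCast] at h1
      have h2 := mul_left_cancel₀ (r_ne_zero (F := F)) (mul_right_cancel₀ hne h1)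
      have : CharZero F := charZero_of_injective_algebraMap (algebraMap ℂ F).injective
      exact_mod_cast h2

theorem IsContravariant.mono_zero_eq {B' : PolyMod F lam →ₗ[F] PolyMod F lam →ₛₗ[σ] F}
    (hB : IsContravariant p lam B) (hB' : IsContravariant p lam B') (hσ : IsConj p σ)
    (v w : Specht F lam) : B (mono 0 v) (mono 0 w) = B' (mono 0 v) (mono 0 w) := by
  refine specht_induction₂ (P := fun v w => B (mono 0 v) (mono 0 w) = B' (mono 0 v) (mono 0 w))
    ?_ ?_ ?_ ?_ ?_ ?_ ?_ v w
  · intro w; simp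
  · intro w; simp
  · intro v v' w h h'
    simp only [map_add, LinearMap.add_apply, h, h']
  · intro v w w' h h'
    simp only [map_add, h, h']
  · intro c v w h
    simp only [map_smul, LinearMap.smul_apply, h]
  · intro c v w h
    simp only [map_smul, map_smulₛₗ, h]
  · intro T S
    rw [hB.vec_eq hσ, hB'.vec_eq hσ]

theorem IsContravariant.unique {B' : PolyMod F lam →ₗ[F] PolyMod F lam →ₛₗ[σ] F}
    (hB : IsContravariant p lam B) (hB' : IsContravariant p lam B') (hσ : IsConj p σ) : B = B' := by
  ext f g
  induction f using PolyMod.induction_x generalizing g with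
  | h0 => simp only [map_zero, LinearMap.zero_apply]
  | hadd f f' h h' => simp only [map_add, LinearMap.add_apply, h, h']
  | hv v =>
    induction g using PolyMod.induction_x with
    | h0 => simp only [map_zero]
    | hadd g g' h h' => simp only [map_add, h, h']
    | hv w => exact hB.mono_zero_eq hB' hσ v w
    | hx j g _ =>
      rw [← X_smul (p := p), ← hB.adjoint_y, ← hB'.adjoint_y, Y_smul, yOp_mono_zero, map_zero,
        map_zero]
  | hx j f ih =>
    rw [← X_smul (p := p), hB.adjoint_x, hB'.adjoint_x, ih]

end Adjoint

end Form

end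

noncomputable section

/-! ### Intertwiners and norms -/

section Norms

variable {r n : ℕ} [NeZero r] {F : Type} [Field F] [Algebra ℂ F] {p : Params r F}
  {lam : RPartition r n} {σ : F →+* F}

variable (p) in
/-- The eigenvector of `𝔱` with leading term `x^μ v_T^μ`. -/
structure IsMonicEigenvector (μ : Fin n → ℕ) (T : SYT lam) (f : PolyMod F lam) : Prop
    extends IsEigenvector p μ T f where
  sub_mem : f - mono μ (rotVec F μ T) ∈ below F lam μ

theorem IsMonicEigenvector.leadCoeff_self {μ : Fin n → ℕ} {T : SYT lam} {f : PolyMod F lam}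
    (h : IsMonicEigenvector p μ T f) : leadCoeff μ T f = 1 := leadCoeff_eq_one h.sub_mem

theorem IsMonicEigenvector.leadCoeff_of_lt {μ ν : Fin n → ℕ} {T : SYT lam} {f : PolyMod F lam}
    (h : IsMonicEigenvector p μ T f) (hlt : WeightLT μ ν) : leadCoeff ν T f = 0 := by
  have h1 := h.sub_mem
  rw [← lower_leadBasis μ T] at h1
  have h2 : leadCoeff ν T (f - mono μ (rotVec F μ T)) = 0 := repr_eq_zero_of_mem_lower h1
    fun h' => weightLT_irrefl μ (weightLT_trans hlt h')
  rwa [map_sub, leadCoeff_mono, if_neg, sub_zero] at h2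
  rintro rfl
  exact weightLT_irrefl _ hlt

theorem IsMonicEigenvector.eq_of_leadCoeff (hp : IsGeneric p) {μ : Fin n → ℕ} {T : SYT lam}
    {f g : PolyMod F lam} (hf : IsMonicEigenvector p μ T f) (hg : IsEigenvector p μ T g)
    (h1 : leadCoeff μ T g = 1) : f = g := by
  rw [hf.toIsEigenvector.eq_smul hp hf.leadCoeff_self hg, h1, one_smul]

/-- The condition on `w` says that `A` maps `x^μ v_T^μ` to the vector of the same kind for `φ μ`. It
is applied to adjacent transpositions and to the affine intertwiner. -/
theorem leadCoeff_map {A : Module.End F (PolyMod F lam)} {φ : (Fin n → ℕ) → (Fin n → ℕ)}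
    {w : Equiv.Perm (Fin n)} (hA : ∀ ν v, A (mono ν v) = mono (φ ν) (spechtRep F lam (perm r w) v))
    (hφ : Function.Injective φ) {μ : Fin n → ℕ} (hw : wPerm (φ μ) * w = wPerm μ) (T : SYT lam)
    (f : PolyMod F lam) : leadCoeff (φ μ) T (A f) = leadCoeff μ T f := by
  induction f using PolyMod.induction with
  | h0 => simp only [map_zero]
  | hadd f g hf hg => simp only [map_add, hf, hg]
  | hmono ν v =>
    rw [hA, leadCoeff_mono, leadCoeff_mono]
    by_cases h : ν = μ
    · rw [h, if_pos rfl, if_pos rfl, ← Module.End.mul_apply, ← map_mul, ← perm_mul, hw]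
    · rw [if_neg h, if_neg (hφ.ne h)]

theorem tOp_perm_mono (w : Equiv.Perm (Fin n)) (ν : Fin n → ℕ) (v : Specht F lam) :
    tOp F lam (perm r w) (mono ν v) = mono (permExp w ν) (spechtRep F lam (perm r w) v) := by
  rw [tOp_mono]
  have : (perm r w : W r n).left = 1 := rfl
  rw [this, map_one, one_smul]
  rfl

theorem permExp_injective (w : Equiv.Perm (Fin n)) : Function.Injective (permExp w) := by
  intro ν ν' h
  funext k
  rw [← permExp_apply w ν, h, permExp_apply]

/-! Adjacent transpositions -/

theorem perm_swap_mul_self (i j : Fin n) :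
    perm r (Equiv.swap i j) * perm r (Equiv.swap i j) = 1 := by
  rw [← perm_mul, Equiv.swap_mul_self]
  exact map_one SemidirectProduct.inr

/-- After multiplication by the transposition only diagonal matrices remain, so the correction in
`t_swap_mul_z` acts on eigenvectors by a scalar. -/
theorem transSum_mul_t_swap (i j : Fin n) :
    transSum p i j * t p (perm r (Equiv.swap i j)) =
      ∑ u : rootsOfUnity r ℂ, t p (diag (Pi.mulSingle i u)) * t p (diag (Pi.mulSingle j u⁻¹)) := by
  rw [transSum, reflSum, Finset.sum_mul]
  refine Finset.sum_congr rfl fun u _ => ?_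
  rw [chr_zero, one_smul, tHom_apply, reflAt_eq, ← t_mul, mul_assoc, perm_swap_mul_self, mul_one,
    diag_mul, t_mul]

theorem t_swap_mul_z' {i j : Fin n} (hij : (i : ℕ) + 1 = j) :
    t p (perm r (Equiv.swap i j)) * z p j =
      z p i * t p (perm r (Equiv.swap i j)) +
        p.c₀ • (transSum p i j * t p (perm r (Equiv.swap i j))) := by
  have h := t_swap_mul_z (p := p) hij
  set s := t p (perm r (Equiv.swap i j)) with hs
  have hss : s * s = 1 := by rw [hs, ← t_mul, perm_swap_mul_self, t_one]
  have hS : s * transSum p i j = transSum p i j * s := by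
    rw [hs, t_mul_transSum, perm_right, Equiv.swap_apply_left, Equiv.swap_apply_right,
      transSum_comm]
  have h1 : s * (s * z p i) * s = s * (z p j * s - p.c₀ • (transSum p i j * s)) * s := by rw [h]
  rw [← mul_assoc, hss, one_mul] at h1
  rw [h1, mul_sub, sub_mul, mul_smul_comm, smul_mul_assoc, mul_assoc, mul_assoc, mul_assoc, hss,
    mul_one, mul_assoc, hss, mul_one, hS, sub_add_cancel]

section Swap

variable {μ : Fin n → ℕ} {T : SYT lam} {f : PolyMod F lam} {i j : Fin n}

theorem transSum_smul_t_swap (hf : IsEigenvector p μ T f) :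
    (transSum p i j * t p (perm r (Equiv.swap i j))) • f =
      (if tWt μ T i = tWt μ T j then (r : F) else 0) • f := by
  have h : ∀ u : rootsOfUnity r ℂ,
      (t p (diag (Pi.mulSingle i u)) * t p (diag (Pi.mulSingle j u⁻¹))) • f =
        chr F (tWt μ T i - tWt μ T j) u • f := by
    intro u
    rw [mul_smul, hf.t_smul, smul_comm, hf.t_smul, smul_smul, chr_inv, chr_sub, mul_comm]
  rw [transSum_mul_t_swap, Finset.sum_smul, Finset.sum_congr rfl fun u _ => h u, ← Finset.sum_smul,
    sum_chr]
  simp only [sub_eq_zero]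

variable (p) in
/-- The coefficient of the intertwiner for the transposition of `i` and `j`. -/
def swapCoeff (μ : Fin n → ℕ) (T : SYT lam) (i j : Fin n) : F :=
  p.c₀ * (if tWt μ T i = tWt μ T j then (r : F) else 0) / (zVal p μ T i - zVal p μ T j)

theorem zVal_comp_swap (hij : (i : ℕ) + 1 = j) (hne : μ i ≠ μ j) (k : Fin n) :
    zVal p (μ ∘ Equiv.swap i j) T k = zVal p μ T (Equiv.swap i j k) := by
  have h := wPerm_comp_swap (μ := μ) (i := i) (j := j) (Fin.lt_def.2 (by omega)) hne
    (fun k h1 h2 => by rw [Fin.lt_def] at h1 h2; omega)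
  rw [zVal, zVal, h]
  rfl

theorem tWt_comp_swap (hij : (i : ℕ) + 1 = j) (hne : μ i ≠ μ j) (k : Fin n) :
    tWt (μ ∘ Equiv.swap i j) T k = tWt μ T (Equiv.swap i j k) := by
  have h := wPerm_comp_swap (μ := μ) (i := i) (j := j) (Fin.lt_def.2 (by omega)) hne
    (fun k h1 h2 => by rw [Fin.lt_def] at h1 h2; omega)
  rw [tWt, tWt, h]
  rfl

theorem zVal_ne (hp : IsGeneric p) (hne : μ i ≠ μ j) : zVal p μ T i ≠ zVal p μ T j := by
  intro h
  have h1 := hp ((μ i : ℤ) - μ j) ((T.1 (wPerm μ i)).ct - (T.1 (wPerm μ j)).ct)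
    (T.1 (wPerm μ i)).β ((T.1 (wPerm μ i)).β - ((μ i + 1 : ℕ) : ZMod r))
    (T.1 (wPerm μ j)).β ((T.1 (wPerm μ j)).β - ((μ j + 1 : ℕ) : ZMod r)) (by
      unfold zVal at h
      push_cast at h ⊢
      linear_combination h)
  have := h1.1
  omega

/-- The transposition exchanges the eigenvalues of `z_i` and `z_j` up to a multiple of `f`. The
coefficient is chosen to absorb this multiple, which is possible because the two eigenvalues differ.
-/
theorem IsEigenvector.swap (hp : IsGeneric p) (hf : IsEigenvector p μ T f)
    (hij : (i : ℕ) + 1 = j) (hne : μ i ≠ μ j) :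
    IsEigenvector p (μ ∘ Equiv.swap i j) T
      (t p (perm r (Equiv.swap i j)) • f + swapCoeff p μ T i j • f) := by
  have hα : zVal p μ T i - zVal p μ T j ≠ 0 := sub_ne_zero.2 (zVal_ne hp hne)
  have hc : swapCoeff p μ T i j * (zVal p μ T i - zVal p μ T j) =
      p.c₀ * (if tWt μ T i = tWt μ T j then (r : F) else 0) := div_mul_cancel₀ _ hα
  have hS := transSum_smul_t_swap (i := i) (j := j) hf
  set s := t p (perm r (Equiv.swap i j)) with hs
  set π := (if tWt μ T i = tWt μ T j then (r : F) else 0) with hπ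
  set c := swapCoeff p μ T i j with hcdef
  have hij' : i ≠ j := by rintro rfl; omega
  constructor
  · intro k
    rw [zVal_comp_swap hij hne, smul_add, smul_comm (z p k) c, hf.z_smul]
    by_cases hi : k = i
    · subst hi
      have e : z p k • s • f = zVal p μ T j • s • f - (p.c₀ * π) • f := by
        have h := congrArg (fun a => a • f) (t_swap_mul_z' (p := p) hij)
        simp only [add_smul, mul_smul s, mul_smul (z p k), smul_assoc, ← hs, hS, hf.z_smul] at h
        rw [eq_sub_iff_add_eq, mul_smul, ← h, smul_comm]
      rw [e, Equiv.swap_apply_left, ← hc]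
      generalize s • f = g
      module
    · by_cases hj : k = j
      · subst hj
        have e : z p k • s • f = zVal p μ T i • s • f + (p.c₀ * π) • f := by
          have h := congrArg (fun a => a • f) (t_swap_mul_z (p := p) hij)
          simp only [sub_smul, mul_smul s, mul_smul (z p k), smul_assoc, ← hs, hS, hf.z_smul] at h
          rw [eq_sub_iff_add_eq] at h
          rw [← h, mul_smul, smul_comm]
        rw [e, Equiv.swap_apply_right, ← hc]
        generalize s • f = g
        module
      · rw [Equiv.swap_apply_of_ne_of_ne hi hj, ← mul_smul, ← t_swap_mul_z_of_ne hij hi hj,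
          mul_smul, hf.z_smul, smul_comm _ _ f, smul_add]
        congr 1
        rw [smul_comm]
  · intro k u
    have e : t p (diag (Pi.mulSingle k u)) • s • f =
        chr F (tWt μ T (Equiv.swap i j k)) u • s • f := by
      have e' : (diag (Pi.mulSingle k u) : W r n) * perm r (Equiv.swap i j) =
          perm r (Equiv.swap i j) * diag (Pi.mulSingle (Equiv.swap i j k) u) := by
        rw [mul_diag_single, perm_right, Equiv.swap_apply_self]
      rw [← mul_smul, hs, ← t_mul, e', t_mul, mul_smul, hf.t_smul, smul_comm]
    rw [tWt_comp_swap hij hne, smul_add, e, smul_comm _ c, hf.t_smul, smul_add]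
    congr 1
    -- The added multiple of `f` has the correct weight if the two weights agree, and its
    -- coefficient is zero if they do not.
    by_cases hk : tWt μ T i = tWt μ T j
    · have : tWt μ T (Equiv.swap i j k) = tWt μ T k := by
        rw [Equiv.swap_apply_def]
        split_ifs with h1 h2
        · rw [h1, hk]
        · rw [h2, hk]
        · rfl
      rw [this, smul_comm]
    · have : c = 0 := by rw [hcdef, swapCoeff, if_neg hk, mul_zero, zero_div]
      rw [this, zero_smul, zero_smul, smul_zero]

theorem IsConj.map_zVal (hσ : IsConj p σ) (k : Fin n) : σ (zVal p μ T k) = zVal p μ T k := by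
  unfold zVal
  simp only [map_sub, map_mul, hσ.map_κ, hσ.map_d, hσ.map_c₀, map_natCast, map_intCast]

theorem IsConj.map_swapCoeff (hσ : IsConj p σ) : σ (swapCoeff p μ T i j) = swapCoeff p μ T i j := by
  unfold swapCoeff
  rw [map_div₀, map_mul, map_sub, hσ.map_zVal, hσ.map_zVal, hσ.map_c₀, apply_ite σ, map_natCast,
    map_zero]

variable {B : PolyMod F lam →ₗ[F] PolyMod F lam →ₛₗ[σ] F}

/-- Pythagoras: the new eigenvector is orthogonal to `f`, because their eigenvalues for `z_i`
differ, and `t_{s_i} f` has the same norm as `f`. -/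
theorem IsContravariant.norm_swap (hB : IsContravariant p lam B) (hσ : IsConj p σ)
    (hp : IsGeneric p) (hf : IsMonicEigenvector p μ T f) (hij : (i : ℕ) + 1 = j)
    (hlt : μ i < μ j) {g : PolyMod F lam} (hg : IsMonicEigenvector p (μ ∘ Equiv.swap i j) T g) :
    B g g = (1 - swapCoeff p μ T i j ^ 2) * B f f := by
  have hlt' : i < j := Fin.lt_def.2 (by omega)
  have hE := hf.toIsEigenvector.swap hp hij hlt.ne
  have hw := wPerm_comp_swap (μ := μ) hlt' hlt.ne
    (fun k h1 h2 => by rw [Fin.lt_def] at h1 h2; omega)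
  have hμ : WeightLT μ (μ ∘ Equiv.swap i j) := by
    have h := weightLT_comp_swap (μ := μ ∘ Equiv.swap i j) hlt' (by simpa using hlt)
    have e : (μ ∘ Equiv.swap i j) ∘ Equiv.swap i j = μ := by
      funext k
      simp
    rwa [e] at h
  have hl : leadCoeff (μ ∘ Equiv.swap i j) T
      (t p (perm r (Equiv.swap i j)) • f + swapCoeff p μ T i j • f) = 1 := by
    have h := leadCoeff_map (tOp_perm_mono (F := F) (lam := lam) (Equiv.swap i j))
      (permExp_injective _) (μ := μ) (by
        rw [permExp_swap, hw, mul_assoc, Equiv.swap_mul_self, mul_one]) T f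
    rw [permExp_swap, hf.leadCoeff_self] at h
    rw [map_add, t_smul, map_smul, hf.leadCoeff_of_lt hμ, smul_zero, add_zero]
    exact h
  have hgE := hg.eq_of_leadCoeff hp hE hl
  have h0 : B g f = 0 := by
    refine hB.eq_zero_of_z hσ (i := i) (hg.z_smul i) (hf.z_smul i) (hσ.map_zVal i) ?_
    rw [zVal_comp_swap hij hlt.ne, Equiv.swap_apply_left]
    exact (zVal_ne hp hlt.ne).symm
  have h0' : B f g = 0 := by rw [hB.hermitian g f, h0, map_zero]
  set c := swapCoeff p μ T i j with hc
  have hσc : σ c = c := hσ.map_swapCoeff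
  have hinv := hB.invariant (perm r (Equiv.swap i j)) f f
  have hs : t p (perm r (Equiv.swap i j)) • f = g - c • f := by rw [hgE]; abel
  rw [hs] at hinv
  simp only [map_sub, LinearMap.sub_apply, form_smul_left, form_smul_right, h0, h0', hσc] at hinv
  linear_combination hinv

end Swap

/-! The affine intertwiner -/

section Affine

variable {μ : Fin n → ℕ} {T : SYT lam} {f : PolyMod F lam} {c : Equiv.Perm (Fin n)} {o l : Fin n}

/-- The exponent of the leading term of the image of `f_{μ,T}` under the affine intertwiner. -/
def rotate (c : Equiv.Perm (Fin n)) (l : Fin n) (μ : Fin n → ℕ) : Fin n → ℕ := inc (permExp c μ) l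

theorem rotate_apply (hc : IsRotation c o l) (k : Fin n) :
    rotate c l μ (c k) = if k = o then μ o + 1 else μ k := by
  rw [rotate, inc_apply, permExp_apply, ← hc.map_fst]
  simp only [EmbeddingLike.apply_eq_iff_eq]
  split_ifs with h
  · rw [h]
  · rfl

theorem IsRotation.map_lt (hc : IsRotation c o l) {k k' : Fin n} (h : k' ≠ o) :
    c k < c k' ↔ k ≠ o ∧ k < k' := by
  have h' := hc.map_eq_of_ne h
  have := hc.val_lst
  by_cases hk : k = o
  · subst hk
    rw [hc.map_fst, Fin.lt_def]
    simp only [ne_eq, not_true_eq_false, false_and, iff_false]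
    omega
  · have := hc.map_eq_of_ne hk
    rw [Fin.lt_def, Fin.lt_def]
    simp only [ne_eq, hk, not_false_eq_true, true_and]
    omega

theorem IsRotation.lt_map_fst (hc : IsRotation c o l) {k : Fin n} (h : k ≠ o) : c k < c o := by
  rw [hc.map_fst, Fin.lt_def]
  have := hc.map_eq_of_ne h
  have := hc.val_lst
  omega

theorem IsRotation.fst_lt (hc : IsRotation c o l) {k : Fin n} (h : k ≠ o) : o < k := by
  rw [Fin.lt_def]
  have := hc.map_eq_of_ne h
  have := hc.val_fst
  omega

/-- In first position an entry ranks above all entries equal to it. In last position and increased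
by one, it ranks below all entries equal to its new value; its place among the others is the same.
-/
theorem wPerm_rotate (hc : IsRotation c o l) (μ : Fin n → ℕ) :
    wPerm (rotate c l μ) * c = wPerm μ := by
  have h : wPerm μ * c⁻¹ = wPerm (rotate c l μ) := by
    refine eq_wPerm fun a b hab => ?_
    obtain ⟨a, rfl⟩ := c.surjective a
    obtain ⟨b, rfl⟩ := c.surjective b
    rw [Equiv.Perm.mul_apply, Equiv.Perm.mul_apply, perm_inv_apply, perm_inv_apply, wPerm_lt_iff]
    rw [rotate_apply hc, rotate_apply hc] at hab
    by_cases ha : a = o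
    · subst ha
      by_cases hb : b = a
      · subst hb
        simp at hab
      · rw [if_pos rfl, if_neg hb] at hab
        left
        omega
    · rw [if_neg ha, hc.map_lt ha] at hab
      by_cases hb : b = o
      · subst hb
        rw [if_pos rfl] at hab
        have := hc.fst_lt ha
        rcases hab with hab | hab
        · rcases Nat.lt_succ_iff_lt_or_eq.1 hab with h | h
          · exact Or.inl h
          · exact Or.inr ⟨h, this⟩
        · exact absurd rfl hab.2.1
      · rw [if_neg hb] at hab
        rcases hab with hab | hab
        · exact Or.inl hab
        · exact Or.inr ⟨hab.1, hab.2.2⟩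
  rw [← h, mul_assoc, inv_mul_cancel, mul_one]

theorem tWt_rotate (hc : IsRotation c o l) (k : Fin n) :
    tWt (rotate c l μ) T (c k) = (if k = o then -1 else 0) + tWt μ T k := by
  have h : wPerm (rotate c l μ) (c k) = wPerm μ k := by rw [← wPerm_rotate hc μ]; rfl
  rw [tWt, tWt, h, rotate_apply hc]
  split_ifs with h
  · subst h
    push_cast
    ring
  · ring

theorem zVal_rotate_of_ne (hc : IsRotation c o l) {k : Fin n} (hk : k ≠ o) :
    zVal p (rotate c l μ) T (c k) = zVal p μ T k := by
  have h : wPerm (rotate c l μ) (c k) = wPerm μ k := by rw [← wPerm_rotate hc μ]; rfl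
  rw [zVal, zVal, h, rotate_apply hc, if_neg hk]

theorem zVal_rotate_fst (hc : IsRotation c o l) :
    zVal p (rotate c l μ) T (c o) = zVal p μ T o + (p.κ - (p.d (tWt (rotate c l μ) T (c o)) -
      p.d (tWt (rotate c l μ) T (c o) - 1))) := by
  have h : wPerm (rotate c l μ) (c o) = wPerm μ o := by rw [← wPerm_rotate hc μ]; rfl
  rw [zVal, zVal, tWt, h, rotate_apply hc, if_pos rfl]
  push_cast
  have e : (T.1 (wPerm μ o)).β - ((μ o : ZMod r) + 1) - 1 =
      (T.1 (wPerm μ o)).β - ((μ o : ZMod r) + 1 + 1) := by ring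
  rw [e]
  ring

theorem dSum_smul {k : Fin n} {b : ZMod r}
    (h : ∀ u, t p (diag (Pi.mulSingle k u)) • f = chr F b u • f) :
    dSum p (tHom p) k • f = (p.d b - p.d (b - 1)) • f := by
  unfold dSum
  simp only [Finset.sum_smul, smul_assoc, tHom_apply, h]
  rw [Finset.sum_eq_single b]
  · have e : ∀ u : rootsOfUnity r ℂ, chr F (-b) u • chr F b u • f = f := by
      intro u
      rw [smul_smul, mul_comm, chr_mul_neg, one_smul]
    have h2 := sum_chr (F := F) (r := r) 0
    simp only [chr_zero, if_true] at h2
    have h3 : ∑ _u : rootsOfUnity r ℂ, f = (r : F) • f := by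
      rw [← h2, Finset.sum_smul]
      simp only [one_smul]
    rw [Finset.sum_congr rfl fun u _ => e u, h3, smul_smul (r : F)⁻¹,
      inv_mul_cancel₀ (r_ne_zero (F := F)), one_smul]
  · intro b' _ hb'
    have e : ∀ u : rootsOfUnity r ℂ, chr F (-b') u • chr F b u • f = chr F (b - b') u • f := by
      intro u
      rw [smul_smul, mul_comm, chr_sub]
    rw [Finset.sum_congr rfl fun u _ => e u, ← Finset.sum_smul, sum_chr,
      if_neg (sub_ne_zero.2 hb'.symm), zero_smul, smul_zero, smul_zero]
  · simp

/-- Only the index moved to the end needs care: there `dSum` acts by the difference of `d` at the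
new weight and at its predecessor, which is the increment in `zVal_rotate_fst`. -/
theorem IsEigenvector.affine (hc : IsRotation c o l) (hf : IsEigenvector p μ T f) :
    IsEigenvector p (rotate c l μ) T (affine p c l • f) := by
  have ht : ∀ k u, t p (diag (Pi.mulSingle k u)) • Cherednik.affine p c l • f =
      chr F (tWt (rotate c l μ) T k) u • Cherednik.affine p c l • f := by
    intro k u
    obtain ⟨k, rfl⟩ := c.surjective k
    rw [← mul_smul, t_diag_mul_affine hc, smul_assoc, mul_smul, hf.t_smul, tWt_rotate hc, chr_add,
      mul_smul (chr F _ u), smul_comm (Cherednik.affine p c l)]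
  refine ⟨fun k => ?_, ht⟩
  obtain ⟨k, rfl⟩ := c.surjective k
  by_cases hk : k = o
  · subst hk
    have h := z_last_mul_affine (p := p) hc
    have e := dSum_smul (ht (c k))
    rw [zVal_rotate_fst hc]
    rw [hc.map_fst] at e ⊢
    rw [← mul_smul, h, add_smul, mul_smul, hf.z_smul, mul_smul, sub_smul (algebraMap F _ p.κ), e,
      algebraMap_smul, smul_comm (Cherednik.affine p c l), add_smul]
    simp only [sub_smul]
  · rw [zVal_rotate_of_ne hc hk, ← mul_smul, z_mul_affine hc (hc.map_eq_of_ne hk), mul_smul,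
      hf.z_smul, smul_comm]

variable {B : PolyMod F lam →ₗ[F] PolyMod F lam →ₛₗ[σ] F}

/-- The adjoint of `x_l t_c` is `t_c⁻¹ y_l`, and conjugation by `t_c` carries `y_o x_o` to `y_l
x_l`. The composite is thus `y_o x_o`, which equals `z_o` at the first index. -/
theorem IsContravariant.norm_rotate (hB : IsContravariant p lam B) (hσ : IsConj p σ)
    (hp : IsGeneric p) (hc : IsRotation c o l) (hf : IsMonicEigenvector p μ T f)
    {g : PolyMod F lam} (hg : IsMonicEigenvector p (rotate c l μ) T g) :
    B g g = zVal p μ T o * B f f := by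
  have hl : leadCoeff (rotate c l μ) T (affine p c l • f) = 1 := by
    have hA : ∀ ν v, (xOp F lam l * tOp F lam (perm r c)) (mono ν v) =
        mono (rotate c l ν) (spechtRep F lam (perm r c) v) := by
      intro ν v
      rw [Module.End.mul_apply, tOp_perm_mono, xOp_mono]
      rfl
    have hinj : Function.Injective (rotate c l) := by
      intro ν ν' h
      funext k
      have := congrFun h (c k)
      rw [rotate_apply hc, rotate_apply hc] at this
      split_ifs at this with h1
      · rw [h1]
        omega
      · exact this
    have h := leadCoeff_map hA hinj (wPerm_rotate hc μ) T f
    rw [hf.leadCoeff_self] at h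
    rw [affine, mul_smul, X_smul, t_smul]
    exact h
  rw [hg.eq_of_leadCoeff hp (hf.toIsEigenvector.affine hc) hl, affine, mul_smul, hB.adjoint_x,
    t_adjoint hB.invariant]
  have h0 : Cherednik.z p o = Y p o * X p o := by
    rw [Cherednik.z, jm_eq, Finset.sum_eq_zero, smul_zero, add_zero]
    intro k hk
    have h := (Finset.mem_filter.1 hk).2
    rw [Fin.lt_def, hc.val_fst] at h
    omega
  have e : t p (perm r c)⁻¹ • Y p l • X p l • t p (perm r c) • f = Cherednik.z p o • f := by
    rw [← mul_smul (Y p l), ← mul_smul _ (t p (perm r c)), ← hc.map_fst]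
    have := t_mul_YX (p := p) (perm r c) o
    rw [perm_right] at this
    rw [← this, ← mul_smul, ← mul_assoc, ← t_mul, inv_mul_cancel, t_one, one_mul, h0]
  rw [e, hf.z_smul, form_smul_right, hσ.map_zVal]

end Affine

theorem IsContravariant.norm_zero {B : PolyMod F lam →ₗ[F] PolyMod F lam →ₛₗ[σ] F}
    (hB : IsContravariant p lam B) {T : SYT lam} {f : PolyMod F lam}
    (hf : IsMonicEigenvector p 0 T f) : B f f = 1 := by
  have h1 : below F lam (0 : Fin n → ℕ) = ⊥ := by
    refine Submodule.span_eq_bot.2 ?_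
    rintro _ ⟨ν, v, h, -⟩
    have h2 := h.sum_eq
    simp only [Pi.zero_apply, Finset.sum_const_zero, Finset.sum_eq_zero_iff, Finset.mem_univ,
      true_implies] at h2
    have h3 : ν = 0 := funext h2
    exact absurd (h3 ▸ h) (weightLT_irrefl 0)
  have h2 := hf.sub_mem
  rw [h1, Submodule.mem_bot, sub_eq_zero] at h2
  rw [h2, rotVec, ← tOp_mono_zero, ← t_smul (p := p), hB.invariant, hB.norm_vec]

end Norms

end

noncomputable section

/-! ### The norm formula -/

section NormFormula

variable {r n : ℕ} [NeZero r] {F : Type} [Field F] [Algebra ℂ F] {p : Params r F}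
  {lam : RPartition r n} {σ : F →+* F}

variable (p) in
/-- The linear factor of the norm formula for the entry `q` of `T`. -/
def normLin (T : SYT lam) (q : Fin n) (k : ℕ) : F :=
  p.κ * (k : ℕ) - (p.d (T.1 q).β - p.d ((T.1 q).β - (k : ZMod r))) - p.c₀ * r * (T.1 q).ct

variable (p) in
/-- The linear form in the quadratic factors of the norm formula for the entries `q` and `q'`
of `T`. -/
def normDiff (T : SYT lam) (q q' : Fin n) (k : ℕ) : F :=
  p.κ * (k : ℕ) - (p.d (T.1 q).β - p.d (T.1 q').β) - p.c₀ * r * ((T.1 q).ct - (T.1 q').ct)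

variable (p) in
/-- The quadratic factor of the norm formula for the entries `q` and `q'` of `T`. -/
def normQuad (T : SYT lam) (q q' : Fin n) (k : ℕ) : F :=
  (normDiff p T q q' k ^ 2 - (p.c₀ * r) ^ 2) / normDiff p T q q' k ^ 2

variable (p) in
/-- The product of the quadratic factors for `k = 1, …, m`. -/
def normPair (T : SYT lam) (q q' : Fin n) (m : ℕ) : F :=
  ∏ k ∈ (Finset.Icc 1 m).filter (fun k : ℕ => (k : ZMod r) = (T.1 q).β - (T.1 q').β),
    normQuad p T q q' k

theorem normPair_zero (T : SYT lam) (q q' : Fin n) : normPair p T q q' 0 = 1 := by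
  simp [normPair]

theorem normPair_succ (T : SYT lam) (q q' : Fin n) (m : ℕ) :
    normPair p T q q' (m + 1) = normPair p T q q' m *
      if ((m + 1 : ℕ) : ZMod r) = (T.1 q).β - (T.1 q').β then normQuad p T q q' (m + 1) else 1 := by
  rw [normPair, normPair, Finset.prod_filter, Finset.prod_filter,
    Finset.prod_Icc_succ_top (by omega)]

/-- The number of quadratic factors for a pair of indices, before the restriction to a residue
class. -/
def gap (μ : Fin n → ℕ) (i j : Fin n) : ℕ := μ i - μ j - if j < i then 1 else 0

variable (p) in
/-- The right hand side of the norm formula. -/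
def normProd (μ : Fin n → ℕ) (T : SYT lam) : F :=
  (∏ i, ∏ k ∈ Finset.Icc 1 (μ i), normLin p T (wPerm μ i) k) *
    ∏ i, ∏ j, normPair p T (wPerm μ i) (wPerm μ j) (gap μ i j)

theorem prod_prod_ite (a b : Fin n) (x : F) :
    ∏ i : Fin n, ∏ j : Fin n, (if i = a ∧ j = b then x else 1) = x := by
  rw [Finset.prod_eq_single a]
  · rw [Finset.prod_eq_single b]
    · simp
    · intro j _ hj
      simp [hj]
    · simp
  · intro i _ hi
    simp [hi]
  · simp

theorem swap_lt_swap_iff {i j k l : Fin n} (hij : (i : ℕ) + 1 = j) (h1 : ¬ (k = i ∧ l = j))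
    (h2 : ¬ (k = j ∧ l = i)) : Equiv.swap i j l < Equiv.swap i j k ↔ l < k := by
  rw [Equiv.swap_apply_def, Equiv.swap_apply_def]
  simp only [Fin.lt_def, Fin.ext_iff] at *
  split_ifs <;> omega

/-- Reindexing by the transposition changes only the order of the pair `i`, `j`. For the larger
entry against the smaller one the gap grows by one, giving one new factor; in the other direction
the gap is zero before and after. -/
theorem normProd_swap {μ : Fin n → ℕ} (T : SYT lam) {i j : Fin n} (hij : (i : ℕ) + 1 = j)
    (hlt : μ i < μ j) :
    normProd p (μ ∘ Equiv.swap i j) T = normProd p μ T *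
      if ((μ j - μ i : ℕ) : ZMod r) = (T.1 (wPerm μ j)).β - (T.1 (wPerm μ i)).β then
        normQuad p T (wPerm μ j) (wPerm μ i) (μ j - μ i) else 1 := by
  have hlt' : i < j := Fin.lt_def.2 (by omega)
  have hw := wPerm_comp_swap (μ := μ) hlt' hlt.ne
    (fun k h1 h2 => by rw [Fin.lt_def] at h1 h2; omega)
  set s := Equiv.swap i j with hs
  set x := (if ((μ j - μ i : ℕ) : ZMod r) = (T.1 (wPerm μ j)).β - (T.1 (wPerm μ i)).β then
    normQuad p T (wPerm μ j) (wPerm μ i) (μ j - μ i) else 1) with hx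
  have hss : ∀ k, s (s k) = k := fun k => Equiv.swap_apply_self i j k
  have e1 : ∏ k, ∏ m ∈ Finset.Icc 1 ((μ ∘ s) k), normLin p T (wPerm (μ ∘ s) k) m =
      ∏ k, ∏ m ∈ Finset.Icc 1 (μ k), normLin p T (wPerm μ k) m := by
    rw [hw]
    exact Equiv.prod_comp s (fun k => ∏ m ∈ Finset.Icc 1 (μ k), normLin p T (wPerm μ k) m)
  have e2 : ∏ k, ∏ l, normPair p T (wPerm (μ ∘ s) k) (wPerm (μ ∘ s) l) (gap (μ ∘ s) k l) =
      ∏ k, ∏ l, (normPair p T (wPerm μ k) (wPerm μ l) (gap μ k l) *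
        if k = j ∧ l = i then x else 1) := by
    rw [hw, ← Equiv.prod_comp s]
    refine Finset.prod_congr rfl fun k _ => ?_
    rw [← Equiv.prod_comp s]
    refine Finset.prod_congr rfl fun l _ => ?_
    rw [Equiv.Perm.mul_apply, Equiv.Perm.mul_apply, hss, hss]
    have hg : gap (μ ∘ s) (s k) (s l) = μ k - μ l - if s l < s k then 1 else 0 := by
      rw [gap, Function.comp_apply, Function.comp_apply, hss, hss]
    rw [hg]
    by_cases h2 : k = j ∧ l = i
    · obtain ⟨rfl, rfl⟩ := h2
      have hneg : ¬ s l < s k := by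
        rw [hs, Equiv.swap_apply_left, Equiv.swap_apply_right]
        exact hlt'.not_gt
      obtain ⟨m, hm⟩ : ∃ m, μ k - μ l = m + 1 := ⟨μ k - μ l - 1, by omega⟩
      rw [if_neg hneg, gap, if_pos hlt', Nat.sub_zero,
        if_pos (⟨rfl, rfl⟩ : k = k ∧ l = l), hx, hm, Nat.add_sub_cancel, normPair_succ]
    · rw [if_neg h2, mul_one]
      by_cases h1 : k = i ∧ l = j
      · obtain ⟨rfl, rfl⟩ := h1
        congr 1
        rw [gap]
        omega
      · rw [gap]
        simp only [hs, swap_lt_swap_iff hij h1 h2]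
  rw [normProd, normProd, e1, e2]
  simp only [Finset.prod_mul_distrib, prod_prod_ite]
  rw [mul_assoc]

/-- All gaps are preserved: the change by one of the first entry compensates the change in its
position relative to the others. Only the linear factors of that entry gain a term, which is the
eigenvalue of `z_o`. -/
theorem normProd_rotate {μ : Fin n → ℕ} (T : SYT lam) {c : Equiv.Perm (Fin n)} {o l : Fin n}
    (hc : IsRotation c o l) :
    normProd p (rotate c l μ) T = zVal p μ T o * normProd p μ T := by
  have hw : ∀ k, wPerm (rotate c l μ) (c k) = wPerm μ k := by
    intro k
    rw [← wPerm_rotate hc μ]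
    rfl
  have e1 : ∏ k, ∏ m ∈ Finset.Icc 1 (rotate c l μ k), normLin p T (wPerm (rotate c l μ) k) m =
      zVal p μ T o * ∏ k, ∏ m ∈ Finset.Icc 1 (μ k), normLin p T (wPerm μ k) m := by
    rw [← Equiv.prod_comp c, ← Finset.mul_prod_erase _ _ (Finset.mem_univ o),
      ← Finset.mul_prod_erase _ (fun k => ∏ m ∈ Finset.Icc 1 (μ k), normLin p T (wPerm μ k) m)
        (Finset.mem_univ o), hw, rotate_apply hc, if_pos rfl, Finset.prod_Icc_succ_top (by omega)]
    have h : ∏ k ∈ Finset.univ.erase o, ∏ m ∈ Finset.Icc 1 (rotate c l μ (c k)),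
        normLin p T (wPerm (rotate c l μ) (c k)) m =
        ∏ k ∈ Finset.univ.erase o, ∏ m ∈ Finset.Icc 1 (μ k), normLin p T (wPerm μ k) m := by
      refine Finset.prod_congr rfl fun k hk => ?_
      rw [hw, rotate_apply hc, if_neg (Finset.ne_of_mem_erase hk)]
    have h2 : normLin p T (wPerm μ o) (μ o + 1) = zVal p μ T o := rfl
    rw [h, h2]
    ring
  have e2 : ∏ k, ∏ m, normPair p T (wPerm (rotate c l μ) k) (wPerm (rotate c l μ) m)
      (gap (rotate c l μ) k m) = ∏ k, ∏ m, normPair p T (wPerm μ k) (wPerm μ m) (gap μ k m) := by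
    rw [← Equiv.prod_comp c]
    refine Finset.prod_congr rfl fun k _ => ?_
    rw [← Equiv.prod_comp c]
    refine Finset.prod_congr rfl fun m _ => ?_
    rw [hw, hw]
    congr 1
    rw [gap, gap, rotate_apply hc, rotate_apply hc]
    by_cases hk : k = o
    · subst hk
      by_cases hm : m = k
      · subst hm
        simp
      · rw [if_pos rfl, if_neg hm, if_pos (hc.lt_map_fst hm), if_neg (hc.fst_lt hm).not_gt]
        omega
    · by_cases hm : m = o
      · subst hm
        rw [if_neg hk, if_pos rfl, if_neg (hc.lt_map_fst hk).not_gt, if_pos (hc.fst_lt hk)]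
        omega
      · rw [if_neg hk, if_neg hm]
        simp only [hc.map_lt hk, ne_eq, hm, not_false_eq_true, true_and]
  rw [normProd, normProd, e1, e2, mul_assoc]

theorem normProd_zero (T : SYT lam) : normProd p 0 T = 1 := by
  have h : ∀ i j : Fin n, gap (0 : Fin n → ℕ) i j = 0 := fun i j => by simp [gap]
  simp [normProd, h, normPair_zero]

/-- If the weights agree, the terms of `d` with shifted index in the two eigenvalues coincide and
drop out of the difference, which is then `normDiff` up to sign. Otherwise the coefficient is zero.
-/
theorem one_sub_swapCoeff_sq (hp : IsGeneric p) {μ : Fin n → ℕ} (T : SYT lam) {i j : Fin n}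
    (hlt : μ i < μ j) :
    1 - swapCoeff p μ T i j ^ 2 =
      if ((μ j - μ i : ℕ) : ZMod r) = (T.1 (wPerm μ j)).β - (T.1 (wPerm μ i)).β then
        normQuad p T (wPerm μ j) (wPerm μ i) (μ j - μ i) else 1 := by
  have hiff : tWt μ T i = tWt μ T j ↔
      ((μ j - μ i : ℕ) : ZMod r) = (T.1 (wPerm μ j)).β - (T.1 (wPerm μ i)).β := by
    rw [tWt, tWt, Nat.cast_sub hlt.le]
    constructor
    · intro h
      linear_combination h
    · intro h
      linear_combination h
  by_cases h : tWt μ T i = tWt μ T j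
  · have hne : zVal p μ T i - zVal p μ T j ≠ 0 := sub_ne_zero.2 (zVal_ne hp hlt.ne)
    have hE : normDiff p T (wPerm μ j) (wPerm μ i) (μ j - μ i) =
        -(zVal p μ T i - zVal p μ T j) := by
      have e : (T.1 (wPerm μ i)).β - ((μ i + 1 : ℕ) : ZMod r) =
          (T.1 (wPerm μ j)).β - ((μ j + 1 : ℕ) : ZMod r) := by
        rw [tWt, tWt] at h
        push_cast
        linear_combination h
      rw [normDiff, zVal, zVal, e, Nat.cast_sub hlt.le]
      push_cast
      ring
    rw [if_pos (hiff.1 h), normQuad, hE, swapCoeff, if_pos h]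
    field_simp
  · rw [if_neg (fun h' => h (hiff.2 h')), swapCoeff, if_neg h]
    simp

theorem exists_rotate_eq {c : Equiv.Perm (Fin n)} {o l : Fin n} (hc : IsRotation c o l)
    {μ : Fin n → ℕ} (h : 0 < μ l) : ∃ μ', rotate c l μ' = μ ∧ ∑ k, μ k = ∑ k, μ' k + 1 := by
  have hr : rotate c l (fun k => if k = o then μ (c k) - 1 else μ (c k)) = μ := by
    funext k
    obtain ⟨k, rfl⟩ := c.surjective k
    rw [rotate_apply hc]
    by_cases h1 : k = o
    · subst h1
      rw [if_pos rfl, if_pos rfl, hc.map_fst]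
      omega
    · rw [if_neg h1, if_neg h1]
  refine ⟨_, hr, ?_⟩
  conv_lhs => rw [← hr]
  rw [← Equiv.sum_comp c, ← Finset.add_sum_erase _ _ (Finset.mem_univ o),
    ← Finset.add_sum_erase (Finset.univ) (fun k => if k = o then μ (c k) - 1 else μ (c k))
      (Finset.mem_univ o), rotate_apply hc, if_pos rfl, add_right_comm]
  congr 2
  refine Finset.sum_congr rfl fun k hk => ?_
  rw [rotate_apply hc, if_neg (Finset.ne_of_mem_erase hk)]

theorem IsContravariant.norm_eq {B : PolyMod F lam →ₗ[F] PolyMod F lam →ₛₗ[σ] F}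
    (hB : IsContravariant p lam B) (hσ : IsConj p σ) (hp : IsGeneric p) (hn : 0 < n)
    (μ : Fin n → ℕ) (T : SYT lam) {f : PolyMod F lam} (hf : IsMonicEigenvector p μ T f) :
    B f f = normProd p μ T := by
  obtain ⟨c, o, l, hc⟩ := exists_isRotation hn
  have hex : ∀ μ : Fin n → ℕ, ∃ f : PolyMod F lam, IsMonicEigenvector p μ T f := by
    intro μ
    obtain ⟨f, h1, h2⟩ := exists_isEigenvector hn hp μ T
    exact ⟨f, h2, h1⟩
  suffices h : ∀ d, ∀ μ : Fin n → ℕ, ∑ k, μ k = d → ∀ f, IsMonicEigenvector p μ T f →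
      B f f = normProd p μ T from h _ μ rfl f hf
  intro d
  induction d with
  | zero =>
    intro μ hμ f hf
    have : μ = 0 := by
      funext k
      exact (Finset.sum_eq_zero_iff.1 hμ) k (Finset.mem_univ k)
    subst this
    rw [hB.norm_zero hf, normProd_zero]
  | succ d ih =>
    have hlast : ∀ μ : Fin n → ℕ, ∑ k, μ k = d + 1 → 0 < μ l → ∀ f, IsMonicEigenvector p μ T f →
        B f f = normProd p μ T := by
      intro μ hμ hl f hf
      obtain ⟨μ', rfl, h2⟩ := exists_rotate_eq hc hl
      obtain ⟨f', hf'⟩ := hex μ'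
      rw [hB.norm_rotate hσ hp hc hf' hf, ih μ' (by omega) f' hf', normProd_rotate T hc]
    -- Here `m` bounds the distance of a positive entry from the last position. The entry is pushed
    -- there by adjacent transpositions, after which the affine intertwiner lowers the degree.
    have key : ∀ m : ℕ, ∀ μ : Fin n → ℕ, ∑ k, μ k = d + 1 → ∀ q : Fin n, 0 < μ q →
        (l : ℕ) ≤ q + m → ∀ f, IsMonicEigenvector p μ T f → B f f = normProd p μ T := by
      intro m
      induction m with
      | zero =>
        intro μ hμ q hq hql f hf
        have : q = l := by
          have := hc.val_lst
          have := q.2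
          exact Fin.ext (by omega)
        exact hlast μ hμ (this ▸ hq) f hf
      | succ m ihm =>
        intro μ hμ q hq hql f hf
        by_cases hql' : (l : ℕ) ≤ q + m
        · exact ihm μ hμ q hq hql' f hf
        · have hqn : (q : ℕ) + 1 < n := by
            have := hc.val_lst
            omega
          set q' : Fin n := ⟨q + 1, hqn⟩ with hq'
          have hqq : (q : ℕ) + 1 = q' := rfl
          by_cases h0 : 0 < μ q'
          · exact ihm μ hμ q' h0 (by omega) f hf
          -- The entry at `q'` is zero, so `μ'` increases from `q` to `q'`. This is the direction in
          -- which `norm_swap` applies, and `μ` is recovered from `μ'`.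
          · set μ' := μ ∘ Equiv.swap q q' with hμ'
            have e : μ' ∘ Equiv.swap q q' = μ := by
              funext k
              simp [hμ']
            have e1 : μ' q = μ q' := by simp [hμ']
            have e2 : μ' q' = μ q := by simp [hμ']
            have hlt : μ' q < μ' q' := by omega
            obtain ⟨f', hf'⟩ := hex μ'
            have hsum : ∑ k, μ' k = d + 1 := (Equiv.sum_comp (Equiv.swap q q') μ).trans hμ
            have hf2 : IsMonicEigenvector p (μ' ∘ Equiv.swap q q') T f := by rwa [e]
            rw [hB.norm_swap hσ hp hf' hqq hlt hf2,
              ihm μ' hsum q' (by omega) (by omega) f' hf', one_sub_swapCoeff_sq hp T hlt, mul_comm,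
              ← normProd_swap T hqq hlt, e]
    intro μ hμ f hf
    obtain ⟨q, hq⟩ : ∃ q, 0 < μ q := by
      by_contra! hne
      have : ∑ k, μ k = 0 := Finset.sum_eq_zero fun k _ => Nat.le_zero.1 (hne k)
      omega
    exact key l μ hμ q hq (by omega) f hf

theorem prod_pair_split {G : Fin n → Fin n → F} (hd : ∀ i, G i i = 1) :
    ∏ i, ∏ j, G i j = (∏ i, ∏ j ∈ Finset.univ.filter (fun j => i < j), G i j) *
      ∏ i, ∏ j ∈ Finset.univ.filter (fun j => i < j), G j i := by
  have h : ∀ i j, G i j = (if i < j then G i j else 1) * (if j < i then G i j else 1) := by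
    intro i j
    rcases lt_trichotomy i j with h | rfl | h
    · rw [if_pos h, if_neg h.not_gt, mul_one]
    · rw [if_neg (lt_irrefl _), hd, mul_one]
    · rw [if_pos h, if_neg h.not_gt, one_mul]
  simp only [Finset.prod_filter]
  conv_lhs => rw [Finset.prod_congr rfl fun i _ => Finset.prod_congr rfl fun j _ => h i j]
  simp only [Finset.prod_mul_distrib]
  congr 1
  rw [Finset.prod_comm]

/-- A product over ordered pairs suits the recursions better than the two products over `i < j`. The
pairs excluded by the inequalities have gap zero and contribute an empty product. -/
theorem normProd_eq (μ : Fin n → ℕ) (T : SYT lam) :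
    normProd p μ T = (∏ i, ∏ k ∈ Finset.Icc 1 (μ i), normLin p T (wPerm μ i) k) *
      (∏ i, ∏ j ∈ Finset.univ.filter (fun j => i < j ∧ μ j < μ i),
        normPair p T (wPerm μ i) (wPerm μ j) (μ i - μ j)) *
      ∏ i, ∏ j ∈ Finset.univ.filter (fun j => i < j ∧ μ i + 1 < μ j),
        normPair p T (wPerm μ j) (wPerm μ i) (μ j - μ i - 1) := by
  rw [normProd, prod_pair_split, mul_assoc]
  · congr 1
    congr 1
    · refine Finset.prod_congr rfl fun i _ => ?_
      rw [← Finset.filter_filter, Finset.prod_filter (p := fun j => μ j < μ i)]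
      refine Finset.prod_congr rfl fun j hj => ?_
      rw [gap, if_neg (Finset.mem_filter.1 hj).2.not_gt, Nat.sub_zero]
      split_ifs with h
      · rfl
      · rw [Nat.sub_eq_zero_of_le (not_lt.1 h), normPair_zero]
    · refine Finset.prod_congr rfl fun i _ => ?_
      rw [← Finset.filter_filter, Finset.prod_filter (p := fun j => μ i + 1 < μ j)]
      refine Finset.prod_congr rfl fun j hj => ?_
      rw [gap, if_pos (Finset.mem_filter.1 hj).2]
      split_ifs with h
      · rfl
      · have : μ j - μ i - 1 = 0 := by omega
        rw [this, normPair_zero]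
  · intro i
    have : gap μ i i = 0 := by simp [gap]
    rw [this, normPair_zero]

end NormFormula

/-! ### Generic parameters -/

section Generic

variable {r n : ℕ} [NeZero r]

theorem algebraMap_C (x : ℂ) : algebraMap ℂ (GenericField r) x =
    algebraMap (MvPolynomial (Param r) ℂ) (GenericField r) (MvPolynomial.C x) := by
  rw [IsScalarTower.algebraMap_apply ℂ (MvPolynomial (Param r) ℂ) (GenericField r),
    MvPolynomial.algebraMap_eq]

theorem conjF_algebraMap (x : MvPolynomial (Param r) ℂ) :
    conjF r (algebraMap _ (GenericField r) x) =
      algebraMap _ (GenericField r) (MvPolynomial.map (starRingEnd ℂ) x) :=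
  IsFractionRing.ringEquivOfRingEquiv_algebraMap _ x

theorem conjF_paramVal (q : Param r) : conjF r (paramVal q) = paramVal q := by
  rw [paramVal, conjF_algebraMap, MvPolynomial.map_X]

theorem isConj_generic : IsConj (generic r) (conjF r) where
  invol x := by
    have h : ∀ a : MvPolynomial (Param r) ℂ, conjF r (conjF r (algebraMap _ (GenericField r) a)) =
        algebraMap _ (GenericField r) a := by
      intro a
      rw [conjF_algebraMap, conjF_algebraMap, MvPolynomial.map_map]
      have e : (starRingEnd ℂ).comp (starRingEnd ℂ) = RingHom.id ℂ :=
        RingHom.ext fun z => Complex.conj_conj z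
      rw [e, MvPolynomial.map_id]
    obtain ⟨a, b, -, rfl⟩ := IsFractionRing.div_surjective (A := MvPolynomial (Param r) ℂ) x
    rw [map_div₀, map_div₀, h, h]
  map_algebraMap x := by
    rw [algebraMap_C, conjF_algebraMap, MvPolynomial.map_C, algebraMap_C]
  map_κ := conjF_paramVal _
  map_c₀ := conjF_paramVal _
  map_d j := by
    change conjF r (genericD r j) = genericD r j
    unfold genericD
    split_ifs with h
    · rw [map_neg, map_sum]
      simp only [conjF_paramVal]
    · rw [conjF_paramVal]

/-- A polynomial which represents `d_j`. -/
def dPoly (r : ℕ) [NeZero r] (j : ZMod r) : MvPolynomial (Param r) ℂ :=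
  if h : j = 0 then -∑ k : {k : ZMod r // k ≠ 0}, MvPolynomial.X (Param.d k)
  else MvPolynomial.X (Param.d ⟨j, h⟩)

theorem algebraMap_dPoly (j : ZMod r) :
    algebraMap _ (GenericField r) (dPoly r j) = (generic r).d j := by
  change _ = genericD r j
  unfold dPoly genericD
  split_ifs
  · rw [map_neg, map_sum]
    rfl
  · rfl

theorem eval_dPoly {v : Param r → ℂ} (hv : ∀ k, v (Param.d k) = 0) (j : ZMod r) :
    MvPolynomial.eval v (dPoly r j) = 0 := by
  unfold dPoly
  split_ifs
  · rw [map_neg, map_sum]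
    simp [hv]
  · simp [hv]

/-- A relation between the parameters is an identity of polynomials, and may be evaluated with every
`d_j = 0`. Setting one of `κ`, `c₀` to one and the other to zero isolates each coefficient. -/
theorem isGeneric_generic : IsGeneric (generic r) := by
  intro m a b₁ b₂ b₃ b₄ h
  set P : MvPolynomial (Param r) ℂ := MvPolynomial.X Param.κ * (m : MvPolynomial (Param r) ℂ) -
    (dPoly r b₁ - dPoly r b₂) + (dPoly r b₃ - dPoly r b₄) -
    MvPolynomial.X Param.c₀ * (r : MvPolynomial (Param r) ℂ) * (a : MvPolynomial (Param r) ℂ) with hP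
  have hP0 : P = 0 := by
    apply IsFractionRing.injective (MvPolynomial (Param r) ℂ) (GenericField r)
    rw [hP, map_zero]
    simp only [map_sub, map_add, map_mul, algebraMap_dPoly, map_natCast, map_intCast]
    exact h
  have hev : ∀ v : Param r → ℂ, (∀ k, v (Param.d k) = 0) →
      v Param.κ * m - v Param.c₀ * r * a = 0 := by
    intro v hv
    have h2 := congrArg (MvPolynomial.eval v) hP0
    rw [hP] at h2
    simpa only [map_sub, map_add, map_mul, eval_dPoly hv, map_natCast, map_intCast,
      MvPolynomial.eval_X, sub_zero, add_zero, map_zero] using h2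
  constructor
  · have := hev (fun q => match q with | Param.κ => 1 | _ => 0) (fun _ => rfl)
    simp only [one_mul, zero_mul, sub_zero] at this
    exact_mod_cast this
  · have := hev (fun q => match q with | Param.c₀ => 1 | _ => 0) (fun _ => rfl)
    simp only [one_mul, zero_mul, zero_sub, neg_eq_zero, mul_eq_zero, Nat.cast_eq_zero,
      NeZero.ne r, false_or] at this
    exact_mod_cast this

end Generic

/-! ### Transport of forms to the standard module -/

section Transport

variable {r n : ℕ} [NeZero r] {lam : RPartition r n}

/-- Transport of a sesquilinear form along a linear isomorphism. -/
def pullForm {F M N : Type*} [Field F] {σ : F →+* F} [AddCommGroup M] [Module F M]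
    [AddCommGroup N] [Module F N] (e : N →ₗ[F] M) (B : M →ₗ[F] M →ₛₗ[σ] F) :
    N →ₗ[F] N →ₛₗ[σ] F where
  toFun f := (B (e f)).comp e
  map_add' f g := by
    rw [map_add, map_add, LinearMap.add_comp]
  map_smul' c f := by
    rw [map_smul, map_smul, LinearMap.smul_comp, RingHom.id_apply]

theorem pullForm_apply {F M N : Type*} [Field F] {σ : F →+* F} [AddCommGroup M] [Module F M]
    [AddCommGroup N] [Module F N] (e : N →ₗ[F] M) (B : M →ₗ[F] M →ₛₗ[σ] F) (f g : N) :
    pullForm e B f g = B (e f) (e g) := rfl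

theorem stdEquivF_smul {F : Type} [Field F] [Algebra ℂ F] {p : Params r F} (h : RCA n p)
    (f : StdModule p lam) : stdEquivF p lam (h • f) = h • stdEquivF p lam f :=
  map_smul (stdEquiv p lam) h f

theorem stdEquivF_symm_smul {F : Type} [Field F] [Algebra ℂ F] {p : Params r F} (h : RCA n p)
    (f : PolyMod F lam) : (stdEquivF p lam).symm (h • f) = h • (stdEquivF p lam).symm f :=
  map_smul (stdEquiv p lam).symm h f

theorem stdEquivF_vec {F : Type} [Field F] [Algebra ℂ F] {p : Params r F} (T : SYT lam) :
    stdEquivF p lam (vec p T) = mono 0 (fillVec F T.1) :=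
  stdEquiv_vec T

theorem IsContravariant.pullForm
    {B : PolyMod (GenericField r) lam →ₗ[GenericField r]
      PolyMod (GenericField r) lam →ₛₗ[conjF r] GenericField r}
    (hB : IsContravariant (generic r) lam B) :
    IsContravariantForm lam (pullForm (stdEquivF (generic r) lam).toLinearMap B) where
  hermitian f g := hB.hermitian _ _
  norm_vec T := by
    rw [pullForm_apply, LinearEquiv.coe_coe, stdEquivF_vec, hB.norm_vec]
  invariant w f g := by
    simp only [pullForm_apply, LinearEquiv.coe_coe, stdEquivF_smul, hB.invariant]
  adjoint_x i f g := by
    simp only [pullForm_apply, LinearEquiv.coe_coe, stdEquivF_smul, hB.adjoint_x]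
  adjoint_y i f g := by
    simp only [pullForm_apply, LinearEquiv.coe_coe, stdEquivF_smul, hB.adjoint_y]

theorem IsContravariantForm.pullForm
    {B : StdModule (generic r) lam →ₗ[GenericField r]
      StdModule (generic r) lam →ₛₗ[conjF r] GenericField r} (hB : IsContravariantForm lam B) :
    IsContravariant (generic r) lam
      (pullForm (stdEquivF (generic r) lam).symm.toLinearMap B) where
  hermitian f g := hB.hermitian _ _
  norm_vec T := by
    rw [pullForm_apply, LinearEquiv.coe_coe, ← stdEquivF_vec (p := generic r),
      LinearEquiv.symm_apply_apply, hB.norm_vec]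
  invariant w f g := by
    simp only [pullForm_apply, LinearEquiv.coe_coe, stdEquivF_symm_smul, hB.invariant]
  adjoint_x i f g := by
    simp only [pullForm_apply, LinearEquiv.coe_coe, stdEquivF_symm_smul, hB.adjoint_x]
  adjoint_y i f g := by
    simp only [pullForm_apply, LinearEquiv.coe_coe, stdEquivF_symm_smul, hB.adjoint_y]

theorem existsUnique_isContravariantForm : ∃! B, IsContravariantForm lam B := by
  refine ⟨_, (contraForm_isContravariant isConj_generic).pullForm, fun B hB => ?_⟩
  have h := hB.pullForm.unique (contraForm_isContravariant isConj_generic) isConj_generic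
  ext f g
  have h2 := congrArg (fun B' => B' (stdEquivF (generic r) lam f) (stdEquivF (generic r) lam g)) h
  simpa only [pullForm_apply, LinearEquiv.coe_coe, LinearEquiv.symm_apply_apply] using h2

theorem IsContravariantForm.norm_eq (hn : 0 < n)
    {B : StdModule (generic r) lam →ₗ[GenericField r]
      StdModule (generic r) lam →ₛₗ[conjF r] GenericField r} (hB : IsContravariantForm lam B)
    {μ : Fin n → ℕ} {T : SYT lam} {f : StdModule (generic r) lam}
    (hf : IsEigenfunction (generic r) μ T f) : B f f = normProd (generic r) μ T := by
  obtain ⟨h1, h2⟩ := isEigenfunction_iff.1 hf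
  have h := hB.pullForm.norm_eq isConj_generic isGeneric_generic hn μ T
    (f := stdEquivF (generic r) lam f) ⟨h2, h1⟩
  rwa [pullForm_apply, LinearEquiv.coe_coe, LinearEquiv.symm_apply_apply] at h

end Transport

end

end Cherednik

/-! ### Existence, uniqueness and the norm formula. -/

theorem theorem6 (r n : ℕ) [NeZero r] (hn : 0 < n) (lam : Cherednik.RPartition r n) :
    -- the contravariant form and the eigenvectors `f_{μ,T}` exist and are unique
    (∃! B, Cherednik.IsContravariantForm lam B) ∧
    (∀ (μ : Fin n → ℕ) (T : Cherednik.SYT lam),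
      ∃! f, Cherednik.IsEigenfunction (Cherednik.generic r) μ T f) ∧
    -- the norm formula
    ∀ B, Cherednik.IsContravariantForm lam B →
    ∀ (μ : Fin n → ℕ) (T : Cherednik.SYT lam) (f : Cherednik.StdModule (Cherednik.generic r) lam),
      Cherednik.IsEigenfunction (Cherednik.generic r) μ T f →
      let κ := (Cherednik.generic r).κ
      let c₀ := (Cherednik.generic r).c₀
      let d := (Cherednik.generic r).d
      let a : Fin n → ℤ := fun i => (T.1 (Cherednik.wPerm μ i)).ct
      let b : Fin n → ZMod r := fun i => (T.1 (Cherednik.wPerm μ i)).β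
      B f f =
        (∏ i : Fin n, ∏ k ∈ Finset.Icc 1 (μ i),
          (κ * (k : ℕ) - (d (b i) - d (b i - (k : ZMod r))) - c₀ * r * a i)) *
        (∏ i : Fin n, ∏ j ∈ Finset.univ.filter (fun j : Fin n => i < j ∧ μ j < μ i),
          ∏ k ∈ (Finset.Icc 1 (μ i - μ j)).filter (fun k : ℕ => (k : ZMod r) = b i - b j),
            ((κ * (k : ℕ) - (d (b i) - d (b j)) - c₀ * r * (a i - a j)) ^ 2 - (c₀ * r) ^ 2) /
              (κ * (k : ℕ) - (d (b i) - d (b j)) - c₀ * r * (a i - a j)) ^ 2) *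
        (∏ i : Fin n, ∏ j ∈ Finset.univ.filter (fun j : Fin n => i < j ∧ μ i + 1 < μ j),
          ∏ k ∈ (Finset.Icc 1 (μ j - μ i - 1)).filter (fun k : ℕ => (k : ZMod r) = b j - b i),
            ((κ * (k : ℕ) - (d (b j) - d (b i)) - c₀ * r * (a j - a i)) ^ 2 - (c₀ * r) ^ 2) /
              (κ * (k : ℕ) - (d (b j) - d (b i)) - c₀ * r * (a j - a i)) ^ 2) := by
  refine ⟨Cherednik.existsUnique_isContravariantForm, fun μ T =>
    Cherednik.existsUnique_isEigenfunction hn Cherednik.isGeneric_generic μ T, fun B hB μ T f hf => ?_⟩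
  intro κ c₀ d a b
  rw [hB.norm_eq hn hf, Cherednik.normProd_eq]
  rfl
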